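/- **Setting.** Let $d\ge 2$ and let $P$ be a probability distribution of a pair $(x,y)\in\mathbb R^d\times\mathbb R$ with $y=\langle\theta^*,x\rangle+\zeta$, $\mathbb E[\zeta\mid x]=0$, $\|\theta^*\|_0\le k$ (where $k\ge 1$) and $\|\theta^*\|_1\le 1$. Assume that $x$ and $y$ are sub-Gaussian with variance proxy $\sigma^2$, i.e. $\mathbb E\,e^{s\langle x,u\rangle}\le e^{\sigma^2s^2/2}$ and $\mathbb E\,e^{sy}\le e^{\sigma^2s^2/2}$ for all $s\in\mathbb R$ and all unit vectors $u$ (in particular both have mean zero). Let $\gamma=\lambda_{\max}(\mathbb E[xx^T])$ and $\mu=\lambda_{\min}(\mathbb E[xx^T])$, and assume $\mu>0$. The matrix $\mathbb E[xx^T]$ need not be a multiple of the identity. **Randomizer.** For $v\in\mathbb R^d$ with $\|v\|_2\le r$ let $\mathcal R^r_\epsilon(v)=B\,U$, where the random unit vector $U$ is obtained as follows. Draw a sign $b=\pm1$ with $\mathbb P(b=1)=\frac12+\frac{\|v\|_2}{2r}$; with probability $\frac{e^\epsilon}{e^\epsilon+1}$ let $U$ be uniform on $\{u\in\mathbb S^{d-1}:\langle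 u,bv\rangle>0\}$, otherwise uniform on $\{u\in\mathbb S^{d-1}:\langle u,bv\rangle\le 0\}$ (for $v=0$, $U$ is uniform on $\mathbb S^{d-1}$). Here $B=r\,\frac{e^\epsilon+1}{e^\epsilon-1}\,\big(\mathbb E|u_1|\big)^{-1}$, with $u$ uniform on $\mathbb S^{d-1}$, is the scale that makes $\mathcal R^r_\epsilon$ unbiased. **Algorithm.** Inputs: data $(x_i,y_i)_{i=1}^n$, $T\ge1$, $\epsilon>0$, step size $\eta_0$, $\tau_1,\tau_2>0$, an integer $k'$, and an initial parameter $\theta_0$ with $\|\theta_0\|_0\le k'$ and $\|\theta_0\|_2\le2$. Each user shrinks the data to $\tilde x_{ij}=\operatorname{sgn}(x_{ij})\min\{|x_{ij}|,\tau_1\}$ and $\tilde y_i=\operatorname{sgn}(y_i)\min\{|y_i|,\tau_2\}$. The users are split into consecutive groups $S_1,\dots,S_T$ of $\lfloor n/T\rfloor$ users, the last group also taking the remaining users. For $t=1,\dots,T$, each user $i\in S_t$ sends $z_i=\mathcal R^r_\epsilon(\nabla_i)$ with $\nabla_i=\tilde x_i(\langle\theta_{t-1},\tilde x_i\rangle-\tilde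 y_i)$ and $r=\sqrt d\,\tau_1(2\sqrt{k'}\,\tau_1+\tau_2)$. The server computes $\tilde\theta_t=\theta_{t-1}-\frac{\eta_0}{|S_t|}\sum_{i\in S_t}z_i$, keeps the $k'$ entries of $\tilde\theta_t$ of largest magnitude (ties broken by the index) and sets the others to zero, and lets $\theta_t$ be the projection of the result onto the Euclidean ball of radius $2$ centred at $0$. The output is $\theta_T$. **Theorem.** (i) For every dimension $d\ge1$, every $n$, every $\epsilon>0$ and all inputs as above, every $\nabla_i$ satisfies $\|\nabla_i\|_2\le r$ whatever the data and the earlier messages are, and the algorithm is $\epsilon$ sequentially interactive LDP: the law $Q_i(\cdot\mid x_i,y_i,z_1,\dots,z_{i-1})$ of the message of user $i$ is a Markov kernel with $$Q_i(S\mid (x,y),z_1,\dots,z_{i-1})\le e^{\epsilon}\,Q_i(S\mid (x',y'),z_1,\dots,z_{i-1})$$ for all $z_1,\dots,z_{i-1}$, all $(x,y),(x',y')\in\mathbb R^d\times\mathbb R$ and all measurable $S$. (ii) There are absolute constants $c_1,c_2>0$ and $a\in\mathbb N$, and constants $C_0,C>0$ depending only on $\sigma,\gamma,\mu$, such that the following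 holds for every $P$ as in the setting and all $n\ge1$, $\epsilon>0$, $\delta\in(0,1)$. Let the data be i.i.d. from $P$, and run the algorithm with $T=\lceil c_1\frac{\gamma}{\mu}\log n\rceil$, $\eta_0=\frac{2}{3\gamma}$, $\tau_1=\tau_2=c_2\sigma\sqrt{\log n}$, $k'=\lceil 72\frac{\gamma^2}{\mu^2}k\rceil$ and an initial parameter with $\|\theta_0\|_0\le k'$ and $\|\theta_0-\theta^*\|_2\le\frac12\frac{\mu}{\gamma}$. If $$n\ \ge\ C_0\,\frac{k'^2d}{\min\{\epsilon,1\}^2}\,\log^a\frac{nd}{\delta},$$ then, with probability at least $1-\delta$, $$\|\theta_T-\theta^*\|_2\ \le\ C\,\frac{\sqrt d\,k\,\log^2 n\,\sqrt{\log(d/\delta)}}{\sqrt n\,\min\{\epsilon,1\}}.$$ -/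

import Mathlib

open MeasureTheory ProbabilityTheory Real
open scoped ENNReal NNReal

namespace LDPIHT

/-! ### Sequentially interactive local privacy -/

/-- A sequentially interactive protocol for `n` users with private data in `X` and messages in
`Z`: the message of user `i` is drawn from a kernel that sees the user's own datum and the
messages of the users before `i`, and nothing else. -/
abbrev Protocol (X Z : Type*) [MeasurableSpace X] [MeasurableSpace Z] (n : ℕ) :=
  (i : Fin n) → Kernel (X × (Fin i → Z)) Z

section Protocol

variable {X Z : Type*} [MeasurableSpace X] [MeasurableSpace Z] {n : ℕ}

/-- `ε` sequentially interactive local differential privacy: the channel of every user is a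
Markov kernel and, for all earlier messages and all pairs of private data, the conditional laws of
the message are within a factor `e^ε` of each other on every event. -/
def IsSeqLDP (ε : ℝ) (Q : Protocol X Z n) : Prop :=
  (∀ i, IsMarkovKernel (Q i)) ∧
    ∀ (i : Fin n) (z : Fin i → Z) (x x' : X) (S : Set Z), MeasurableSet S →
      Q i (x, z) S ≤ ENNReal.ofReal (exp ε) * Q i (x', z) S

lemma measurable_finSnoc (m : ℕ) :
    Measurable (fun p : (Fin m → Z) × Z => (Fin.snoc p.1 p.2 : Fin (m + 1) → Z)) := by
  refine measurable_pi_lambda _ fun j => ?_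
  refine Fin.lastCases ?_ (fun j => ?_) j
  · simpa using measurable_snd
  · simp only [Fin.snoc_castSucc]
    exact (measurable_pi_apply j).comp measurable_fst

/-- The law of the first `m` messages, as a kernel from the data set. -/
noncomputable def transcriptUpTo (Q : Protocol X Z n) :
    (m : ℕ) → m ≤ n → Kernel (Fin n → X) (Fin m → Z)
  | 0, _ => Kernel.const _ (Measure.dirac Fin.elim0)
  | m + 1, h =>
    ((transcriptUpTo Q m (Nat.le_of_succ_le h)).compProd
      ((Q ⟨m, h⟩).comap
        (fun p : (Fin n → X) × (Fin m → Z) => (p.1 ⟨m, h⟩, p.2))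
        (((measurable_pi_apply _).comp measurable_fst).prodMk measurable_snd))).map
      (fun p => (Fin.snoc p.1 p.2 : Fin (m + 1) → Z))

/-- The law of the messages of all users, as a kernel from the data set. -/
noncomputable def transcript (Q : Protocol X Z n) : Kernel (Fin n → X) (Fin n → Z) :=
  transcriptUpTo Q n le_rfl

end Protocol

/-! ### The private randomizer -/

/-- `ℝ^d` with the Euclidean norm. -/
abbrev Vec (d : ℕ) := EuclideanSpace ℝ (Fin d)

/-- The uniform probability measure on the unit sphere of `ℝ^d`, as a measure on `ℝ^d`. -/
noncomputable def sphereUniform (d : ℕ) : Measure (Vec d) :=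
  (ProbabilityTheory.cond (volume : Measure (Vec d)).toSphere Set.univ).map Subtype.val

/-- The open half-space in the direction `x`. -/
def halfSpace {d : ℕ} (x : Vec d) : Set (Vec d) := {u | 0 < inner ℝ u x}

/-- With probability `e^ε / (e^ε + 1)` a uniform point of the sphere in `{u | ⟨u, x⟩ > 0}`,
otherwise a uniform point of the sphere in `{u | ⟨u, x⟩ ≤ 0}`. -/
noncomputable def hemisphereLaw {d : ℕ} (ε : ℝ) (x : Vec d) : Measure (Vec d) :=
  ENNReal.ofReal (exp ε / (exp ε + 1)) • ProbabilityTheory.cond (sphereUniform d) (halfSpace x) +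
    ENNReal.ofReal (1 / (exp ε + 1)) • ProbabilityTheory.cond (sphereUniform d) (halfSpace x)ᶜ

/-- The probability `1/2 + ‖x‖/(2r)` of the sign `+1`. On the domain `‖x‖ ≤ r` of the randomizer
the minimum is not active; it only makes the value a probability elsewhere. -/
noncomputable def signProb {d : ℕ} (r : ℝ) (x : Vec d) : ℝ≥0∞ :=
  ENNReal.ofReal (min 1 (1 / 2 + ‖x‖ / (2 * r)))

/-- The law of the random direction: the sign `b` is `+1` with probability `1/2 + ‖x‖/(2r)` and
`-1` otherwise, and the hemispheres are those of the direction of `b x`. For `x = 0` both signs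
are equally likely and every choice of the direction of `x` gives the uniform law. -/
noncomputable def directionLaw {d : ℕ} (ε r : ℝ) (x : Vec d) : Measure (Vec d) :=
  open Classical in
  if x = 0 then sphereUniform d
  else signProb r x • hemisphereLaw ε x + (1 - signProb r x) • hemisphereLaw ε (-x)

/-- `E|u₁|` for `u` uniform on the unit sphere of `ℝ^d`, a number of order `1/√d`; it is written
as the average of `E|u_j|` over the coordinates, which all have the same law. -/
noncomputable def sphereMeanAbs (d : ℕ) : ℝ :=
  (d : ℝ)⁻¹ * ∫ u, ∑ j, |u j| ∂(sphereUniform d)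

/-- The length of the output of the randomizer, of order `r √d` for fixed `ε`: the factor for
which the randomizer is unbiased. -/
noncomputable def outputScale (d : ℕ) (ε r : ℝ) : ℝ :=
  r * ((exp ε + 1) / (exp ε - 1)) * (sphereMeanAbs d)⁻¹

instance (d : ℕ) : IsFiniteMeasure (sphereUniform d) := by
  unfold sphereUniform; infer_instance

lemma measurable_sphereUniform_cond_section {d : ℕ} {S : Set (Vec d × Vec d)}
    (hS : MeasurableSet S) :
    Measurable (fun x : Vec d => ProbabilityTheory.cond (sphereUniform d) (Prod.mk x ⁻¹' S)) := by
  refine Measure.measurable_of_measurable_coe _ fun A hA => ?_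
  have h2 : ∀ x : Vec d, ProbabilityTheory.cond (sphereUniform d) (Prod.mk x ⁻¹' S) A =
      (sphereUniform d (Prod.mk x ⁻¹' S))⁻¹ *
        sphereUniform d (Prod.mk x ⁻¹' (S ∩ Prod.snd ⁻¹' A)) := fun x =>
    cond_apply (measurable_prodMk_left hS) _ _
  simp_rw [h2]
  exact (measurable_measure_prodMk_left hS).inv.mul
    (measurable_measure_prodMk_left (hS.inter (measurable_snd hA)))

lemma measurable_sphereUniform_cond {d : ℕ} :
    Measurable (fun x : Vec d => ProbabilityTheory.cond (sphereUniform d) (halfSpace x)) ∧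
      Measurable (fun x : Vec d => ProbabilityTheory.cond (sphereUniform d) (halfSpace x)ᶜ) := by
  have hi : Measurable (fun p : Vec d × Vec d => (inner ℝ p.2 p.1 : ℝ)) :=
    measurable_snd.inner measurable_fst
  have hS : MeasurableSet {p : Vec d × Vec d | 0 < (inner ℝ p.2 p.1 : ℝ)} :=
    measurableSet_lt measurable_const hi
  have e1 : ∀ x : Vec d, halfSpace x =
      Prod.mk x ⁻¹' {p : Vec d × Vec d | 0 < (inner ℝ p.2 p.1 : ℝ)} := fun x => rfl
  have e2 : ∀ x : Vec d, (halfSpace x)ᶜ =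
      Prod.mk x ⁻¹' {p : Vec d × Vec d | 0 < (inner ℝ p.2 p.1 : ℝ)}ᶜ := fun x => rfl
  constructor
  · simp_rw [e1]
    exact measurable_sphereUniform_cond_section hS
  · simp_rw [e2]
    exact measurable_sphereUniform_cond_section hS.compl

lemma measurable_hemisphereLaw {d : ℕ} (ε : ℝ) :
    Measurable (hemisphereLaw ε : Vec d → Measure (Vec d)) := by
  refine Measure.measurable_of_measurable_coe _ fun A hA => ?_
  have h1 := (Measure.measurable_coe hA).comp (measurable_sphereUniform_cond (d := d)).1
  have h2 := (Measure.measurable_coe hA).comp (measurable_sphereUniform_cond (d := d)).2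
  simp only [hemisphereLaw, Measure.add_apply, Measure.smul_apply, smul_eq_mul]
  exact (h1.const_mul _).add (h2.const_mul _)

lemma measurable_directionLaw {d : ℕ} (ε r : ℝ) :
    Measurable (directionLaw ε r : Vec d → Measure (Vec d)) := by
  classical
  have hp : Measurable (signProb r : Vec d → ℝ≥0∞) := by
    unfold signProb; fun_prop
  have h : Measurable (fun x : Vec d =>
      signProb r x • hemisphereLaw ε x + (1 - signProb r x) • hemisphereLaw ε (-x)) := by
    refine Measure.measurable_of_measurable_coe _ fun A hA => ?_
    have h1 := (Measure.measurable_coe hA).comp (measurable_hemisphereLaw (d := d) ε)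
    have h2 := h1.comp (measurable_neg (G := Vec d))
    simp only [Measure.add_apply, Measure.smul_apply, smul_eq_mul]
    exact (hp.mul h1).add ((measurable_const.sub hp).mul h2)
  unfold directionLaw
  exact Measurable.ite (measurableSet_singleton (0 : Vec d)) measurable_const h

/-- The private randomizer with privacy parameter `ε` for vectors of norm at most `r`. -/
noncomputable def randomizer (d : ℕ) (ε r : ℝ) : Kernel (Vec d) (Vec d) :=
  Kernel.map ⟨directionLaw ε r, measurable_directionLaw ε r⟩
    (fun u => outputScale d ε r • u)

/-! ### Iterative hard thresholding -/

/-- The number of non-zero coordinates. -/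
noncomputable def l0 {d : ℕ} (v : Vec d) : ℕ :=
  open Classical in (Finset.univ.filter fun j => v j ≠ 0).card

/-- Shrinkage of a number to `[-τ, τ]`. -/
noncomputable def shrink (τ a : ℝ) : ℝ := Real.sign a * min |a| τ

/-- Coordinatewise shrinkage of a vector. -/
noncomputable def shrinkVec {d : ℕ} (τ : ℝ) (x : Vec d) : Vec d :=
  WithLp.toLp 2 fun j => shrink τ (x j)

/-- `Trunc(v, s)`: keep the `s` coordinates of largest magnitude (ties are broken in favour of the
smaller index) and set the others to zero. Coordinate `j` is kept if fewer than `s` coordinates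
come before it. -/
noncomputable def trunc {d : ℕ} (s : ℕ) (v : Vec d) : Vec d :=
  open Classical in
  WithLp.toLp 2 fun j =>
    if (Finset.univ.filter fun l => |v j| < |v l| ∨ (|v j| = |v l| ∧ l < j)).card < s
    then v j else 0

/-- The projection onto the closed Euclidean ball of radius `2` around `0`. -/
noncomputable def projBall {d : ℕ} (v : Vec d) : Vec d :=
  open Classical in if ‖v‖ ≤ 2 then v else (2 / ‖v‖) • v

/-- The inputs of the algorithm other than the data. -/
structure Params (d : ℕ) where
  /-- number of iterations -/
  T : ℕ
  /-- privacy parameter -/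
  ε : ℝ
  /-- step size -/
  η : ℝ
  /-- shrinkage level of the covariates -/
  τ₁ : ℝ
  /-- shrinkage level of the responses -/
  τ₂ : ℝ
  /-- threshold of the truncation step -/
  k' : ℕ
  /-- initial parameter -/
  θ₀ : Vec d

/-- The users (numbered from `0`) of the group `t` (numbered from `0`): consecutive blocks of
`⌊n/T⌋` users, the last block taking all the remaining users as well. -/
def group (n T t : ℕ) : Finset ℕ :=
  Finset.Ico (t * (n / T)) (if t + 1 = T then n else (t + 1) * (n / T))

/-- The group of the user `i`. -/
def groupOf (n T i : ℕ) : ℕ :=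
  if n / T = 0 then T - 1 else min (i / (n / T)) (T - 1)

/-- Sanity check: among `n` users, `groupOf` is the group that contains the user. -/
lemma mem_group_groupOf {n T i : ℕ} (hT : 1 ≤ T) (hi : i < n) :
    i ∈ group n T (groupOf n T i) ∧ groupOf n T i < T := by
  unfold group groupOf
  rcases Nat.eq_zero_or_pos (n / T) with h | h
  · simp only [h, if_true]
    rw [if_pos (by omega)]
    simp; omega
  · rw [if_neg h.ne']
    have h1 := Nat.div_mul_le_self i (n / T)
    have h2 := Nat.lt_div_mul_add h (a := i)
    refine ⟨?_, by omega⟩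
    rw [Finset.mem_Ico]
    refine ⟨(Nat.mul_le_mul_right _ (min_le_left _ _)).trans h1, ?_⟩
    split_ifs with h3
    · exact hi
    · have : min (i / (n / T)) (T - 1) = i / (n / T) := by omega
      rw [this, add_mul]; omega

/-- The iterate `θ_t` as a function of the messages of the users: averaging over the group,
gradient step, truncation, projection. -/
noncomputable def iterate {d : ℕ} (n : ℕ) (A : Params d) (z : ℕ → Vec d) : ℕ → Vec d
  | 0 => A.θ₀
  | t + 1 =>
    projBall (trunc A.k' (iterate n A z t -
      A.η • (((group n A.T t).card : ℝ)⁻¹ • ∑ i ∈ group n A.T t, z i)))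

/-- A finite list of messages as a sequence, padded by zeros. -/
noncomputable def padZero {d m : ℕ} (z : Fin m → Vec d) (i : ℕ) : Vec d :=
  if h : i < m then z ⟨i, h⟩ else 0

/-- The gradient `x̃ (⟨θ, x̃⟩ - ỹ)` of a user with data `p = (x, y)` at `θ`. -/
noncomputable def userGradient {d : ℕ} (A : Params d) (θ : Vec d) (p : Vec d × ℝ) : Vec d :=
  (inner ℝ θ (shrinkVec A.τ₁ p.1) - shrink A.τ₂ p.2) • shrinkVec A.τ₁ p.1

/-- The gradient that the user `i` sends to the randomizer: the one at the iterate that the server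
computed from the messages of the earlier groups, all of which come before `i`. -/
noncomputable def sentGradient {d : ℕ} (n : ℕ) (A : Params d) (i : ℕ)
    (q : (Vec d × ℝ) × (Fin i → Vec d)) : Vec d :=
  userGradient A (iterate n A (padZero q.2) (groupOf n A.T i)) q.1

/-- The radius `r = √d τ₁ (2 √k' τ₁ + τ₂)` of the randomizer. -/
noncomputable def radius {d : ℕ} (A : Params d) : ℝ :=
  √(d : ℝ) * A.τ₁ * (2 * √(A.k' : ℝ) * A.τ₁ + A.τ₂)

lemma measurable_shrink (τ : ℝ) : Measurable (shrink τ) := by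
  have : Measurable Real.sign := by
    unfold Real.sign
    exact Measurable.ite measurableSet_Iio measurable_const
      (Measurable.ite measurableSet_Ioi measurable_const measurable_const)
  unfold shrink; fun_prop

lemma measurable_shrinkVec {d : ℕ} (τ : ℝ) : Measurable (shrinkVec τ : Vec d → Vec d) := by
  have := measurable_shrink τ
  unfold shrinkVec; fun_prop

lemma measurable_trunc {d : ℕ} (s : ℕ) : Measurable (trunc s : Vec d → Vec d) := by
  classical
  have hcard : ∀ j : Fin d, Measurable (fun v : Vec d =>
      (Finset.univ.filter fun l => |v j| < |v l| ∨ (|v j| = |v l| ∧ l < j)).card) := by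
    intro j
    simp_rw [Finset.card_filter]
    refine Finset.measurable_sum _ fun l _ => Measurable.ite ?_ measurable_const measurable_const
    have h : ∀ i : Fin d, Measurable (fun v : Vec d => |v i|) := fun i => by fun_prop
    exact (measurableSet_lt (h j) (h l)).union
      ((measurableSet_eq_fun (h j) (h l)).inter (MeasurableSet.const _))
  unfold trunc
  refine (WithLp.measurable_toLp 2 (Fin d → ℝ)).comp (measurable_pi_lambda _ fun j => ?_)
  exact Measurable.ite (measurableSet_lt (by convert hcard j) measurable_const) (by fun_prop)
    measurable_const

lemma measurable_projBall {d : ℕ} : Measurable (projBall : Vec d → Vec d) := by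
  classical
  unfold projBall
  have h : Measurable (fun v : Vec d => (2 / ‖v‖) • v) :=
    (measurable_const.div measurable_norm).smul measurable_id
  exact Measurable.ite (measurableSet_le measurable_norm measurable_const) measurable_id h

lemma measurable_iterate {d : ℕ} (n : ℕ) (A : Params d) (t : ℕ) :
    Measurable (fun z : ℕ → Vec d => iterate n A z t) := by
  induction t with
  | zero => exact measurable_const
  | succ t ih =>
    refine measurable_projBall.comp ((measurable_trunc _).comp (ih.sub ?_))
    have h : Measurable (fun z : ℕ → Vec d => ∑ i ∈ group n A.T t, z i) :=
      Finset.measurable_sum _ fun i _ => measurable_pi_apply i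
    exact (h.const_smul ((group n A.T t).card : ℝ)⁻¹).const_smul A.η

lemma measurable_padZero {d m : ℕ} :
    Measurable (fun z : Fin m → Vec d => (padZero z : ℕ → Vec d)) := by
  refine measurable_pi_lambda _ fun i => ?_
  unfold padZero
  split_ifs with h
  · exact measurable_pi_apply _
  · exact measurable_const

lemma measurable_sentGradient {d : ℕ} (n : ℕ) (A : Params d) (i : ℕ) :
    Measurable (sentGradient (d := d) n A i) := by
  have h1 : Measurable (fun q : (Vec d × ℝ) × (Fin i → Vec d) =>
      iterate n A (padZero q.2) (groupOf n A.T i)) :=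
    (measurable_iterate n A _).comp (measurable_padZero.comp measurable_snd)
  have h2 : Measurable (fun q : (Vec d × ℝ) × (Fin i → Vec d) => shrinkVec A.τ₁ q.1.1) :=
    (measurable_shrinkVec _).comp (measurable_fst.comp measurable_fst)
  have h3 : Measurable (fun q : (Vec d × ℝ) × (Fin i → Vec d) => shrink A.τ₂ q.1.2) :=
    (measurable_shrink _).comp (measurable_snd.comp measurable_fst)
  exact ((h1.inner h2).sub h3).smul h2

/-- LDP iterative hard thresholding as a sequentially interactive protocol: the user `i` sends the
randomized gradient. -/
noncomputable def protocol {d : ℕ} (n : ℕ) (A : Params d) : Protocol (Vec d × ℝ) (Vec d) n :=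
  fun i => (randomizer d A.ε (radius A)).comap (sentGradient n A i)
    (measurable_sentGradient n A i)

/-- The output `θ_T` as a function of the messages of all users. -/
noncomputable def output {d n : ℕ} (A : Params d) (z : Fin n → Vec d) : Vec d :=
  iterate n A (padZero z) A.T

/-- The law of the output `θ_T` when the data of the `n` users are i.i.d. with law `P`. -/
noncomputable def outputLaw {d : ℕ} (n : ℕ) (A : Params d) (P : Measure (Vec d × ℝ)) :
    Measure (Vec d) :=
  ((Measure.pi fun _ : Fin n => P).bind (transcript (protocol n A))).map (output A)

/-! ### The regression model -/

/-- The matrix `E[x xᵀ]` of a law `P` of `(x, y)`. -/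
noncomputable def secondMoment {d : ℕ} (P : Measure (Vec d × ℝ)) : Matrix (Fin d) (Fin d) ℝ :=
  Matrix.of fun i j => ∫ p, p.1 i * p.1 j ∂P

/-- The law `P` of `(x, y)` follows the `k`-sparse linear model `y = ⟨θ*, x⟩ + ζ`, `E[ζ | x] = 0`,
`‖θ*‖₀ ≤ k`, `‖θ*‖₁ ≤ 1`, with `x` and `y` sub-Gaussian with variance proxy `σ²`. (The last two
conditions contain that `x` and `y` have mean zero.) -/
structure IsSparseModel {d : ℕ} (P : Measure (Vec d × ℝ)) (θ : Vec d) (k : ℕ) (σ : ℝ≥0) :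
    Prop where
  sparse : l0 θ ≤ k
  l1_le : ∑ j, |θ j| ≤ 1
  noise : P[fun p => p.2 - inner ℝ θ p.1 |
    MeasurableSpace.comap Prod.fst inferInstance] =ᵐ[P] 0
  subgaussian_x : ∀ u : Vec d, ‖u‖ = 1 → HasSubgaussianMGF (fun p => inner ℝ p.1 u) (σ ^ 2) P
  subgaussian_y : HasSubgaussianMGF (fun p => p.2) (σ ^ 2) P

/-- The parameters of the accuracy guarantee: `T = ⌈c₁ (γ/μ) log n⌉`, `η₀ = 2/(3γ)`,
`τ₁ = τ₂ = c₂ σ √(log n)`, `k' = ⌈72 (γ/μ)² k⌉`. -/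
noncomputable def tunedParams {d : ℕ} (c₁ c₂ : ℝ) (σ : ℝ≥0) (γ μ : ℝ) (n k : ℕ) (ε : ℝ)
    (θ₀ : Vec d) : Params d where
  T := ⌈c₁ * (γ / μ) * log n⌉₊
  ε := ε
  η := 2 / (3 * γ)
  τ₁ := c₂ * σ * √(log n)
  τ₂ := c₂ * σ * √(log n)
  k' := ⌈72 * (γ / μ) ^ 2 * k⌉₊
  θ₀ := θ₀

end LDPIHT

/-! Privacy is a density bound. Every half-sphere has uniform mass 1/2, so a hemisphere law has a
density with respect to the uniform law that takes only the values 2e^ε/(e^ε+1) and 2/(e^ε+1).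
Mixing over the sign stays between these values and rescaling is harmless, so any two inputs give
laws within a factor e^ε (`directionLaw_privacy`). Truncation and projection keep each iterate
k'-sparse and of norm at most 2, hence of ℓ¹ norm at most 2√k', and the gradient stays in the ball
of radius r whatever the messages are (`norm_userGradient_le`).

Accuracy has a stochastic and a deterministic half. The coordinates of a uniform point of the sphere
are sub-Gaussian at scale 1/√d, as a comparison of Gaussian integrals in Cartesian and polar
coordinates shows. The density is at most 2, so the coordinates of a message inherit exponential
moments at scale B/√d around the unbiased mean (`lintegral_exp_randomizer_le`). The iterate used by
a group depends on earlier groups only and each datum is fresh, so the centred messages of a group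
are martingale differences. A Chernoff bound and a union over T·d pairs control all group averages
in sup norm (`messageLaw_forall_close`). The mean of the shrunken gradient differs from the
population gradient Σ(θ - θ*) by order σ²√k'/√n in each coordinate, because E[x_j ζ] = 0 and
shrinkage acts on sub-Gaussian tails only (`IsSparseModel.abs_meanGradient_sub_le`).

On the good event every iteration is a population gradient step with a perturbation that is small in
sup norm. The exact step contracts by 1 - 2μ/(3γ). Truncation expands by at most 1 + √(k/k') ≤ 1 +
μ/(8γ) and sees at most 2k' coordinates, so the perturbation costs √(2k') and not √d times its sup
norm; the net contraction is 1 - μ/(2γ) (`norm_step_sub_le`). After T ≥ 2(γ/μ) log n steps the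
initial error is at most 1/n and the perturbations sum to a factor 2γ/μ. One √k' from r and one from
the truncation produce the factor k of the rate. -/

namespace LDPIHT

section Sphere

open Set Metric Pointwise

/-! ### The uniform law on the sphere -/

/-- Polar coordinates for the Lebesgue measure. -/
lemma lintegral_polar {d : ℕ} (hd : 0 < d) (F : Vec d → ℝ≥0∞) (hF : Measurable F) :
    ∫⁻ x, F x = ∫⁻ u : sphere (0 : Vec d) 1, (∫⁻ r in Ioi (0 : ℝ),
      ENNReal.ofReal (r ^ (d - 1)) * F (r • (u : Vec d))) ∂(volume : Measure (Vec d)).toSphere := by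
  have : Nonempty (Fin d) := ⟨⟨0, hd⟩⟩
  have h0 : ∫⁻ x, F x = ∫⁻ x : ({(0)}ᶜ : Set (Vec d)), F x
      ∂((volume : Measure (Vec d)).comap (↑)) := by
    rw [lintegral_subtype_comap (measurableSet_singleton _).compl, restrict_compl_singleton]
  have h1 := (volume : Measure (Vec d)).measurePreserving_homeomorphUnitSphereProd
  have h2 := h1.lintegral_comp_emb (Homeomorph.measurableEmbedding _)
    (fun q => F ((q.2 : ℝ) • (q.1 : Vec d)))
  have h3 : ∀ x : ({(0)}ᶜ : Set (Vec d)),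
      ((homeomorphUnitSphereProd (Vec d) x).2 : ℝ) •
        ((homeomorphUnitSphereProd (Vec d) x).1 : Vec d) = x := by
    intro x
    have hx : ‖(x : Vec d)‖ ≠ 0 := norm_ne_zero_iff.2 x.2
    simp [smul_smul, hx]
  simp only [h3] at h2
  rw [h0, h2, lintegral_prod]
  · refine lintegral_congr fun u => ?_
    rw [finrank_euclideanSpace_fin, Measure.volumeIoiPow,
      lintegral_withDensity_eq_lintegral_mul _
        (by fun_prop) (by fun_prop)]
    simp only [Pi.mul_apply]
    rw [lintegral_subtype_comap measurableSet_Ioi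
      (fun r : ℝ => ENNReal.ofReal (r ^ (d - 1)) * F (r • (u : Vec d)))]
  · refine Measurable.aemeasurable ?_
    fun_prop

/-- The sphere measure of a set is a multiple of the volume of the cone over it; through this
formula invariance and null sets are inherited from Lebesgue measure. -/
lemma sphereUniform_apply {d : ℕ} {A : Set (Vec d)} (hA : MeasurableSet A) :
    sphereUniform d A = ((volume : Measure (Vec d)).toSphere univ)⁻¹ *
      (d * volume (Ioo (0 : ℝ) 1 • (sphere (0 : Vec d) 1 ∩ A))) := by
  have h : MeasurableSet ((Subtype.val : sphere (0 : Vec d) 1 → Vec d) ⁻¹' A) :=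
    measurable_subtype_coe hA
  rw [sphereUniform, Measure.map_apply measurable_subtype_coe hA,
    cond_apply MeasurableSet.univ, univ_inter, Measure.toSphere_apply' _ h,
    Subtype.image_preimage_coe, finrank_euclideanSpace_fin]

/-- Forming the cone commutes with a linear isometry, and the isometry preserves volume. -/
lemma sphereUniform_map {d : ℕ} (f : Vec d ≃ₗᵢ[ℝ] Vec d) :
    (sphereUniform d).map f = sphereUniform d := by
  refine Measure.ext fun A hA => ?_
  rw [Measure.map_apply f.continuous.measurable hA, sphereUniform_apply hA,
    sphereUniform_apply (f.continuous.measurable hA)]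
  have h : Ioo (0 : ℝ) 1 • (sphere (0 : Vec d) 1 ∩ f ⁻¹' A) =
      f.toMeasurableEquiv ⁻¹' (Ioo (0 : ℝ) 1 • (sphere (0 : Vec d) 1 ∩ A)) := by
    ext x
    simp only [Set.mem_smul, mem_inter_iff, mem_preimage, mem_sphere_zero_iff_norm]
    constructor
    · rintro ⟨r, hr, u, ⟨hu, hu'⟩, rfl⟩
      exact ⟨r, hr, f u, ⟨by simpa using hu, hu'⟩, by simp⟩
    · rintro ⟨r, hr, u, ⟨hu, hu'⟩, h⟩
      refine ⟨r, hr, f.symm u, ⟨by simpa using hu, by simpa using hu'⟩, ?_⟩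
      apply f.injective
      simpa using h
  rw [h, (f.measurePreserving).measure_preimage_equiv]

lemma toSphere_univ_ne_zero {d : ℕ} (hd : 0 < d) :
    (volume : Measure (Vec d)).toSphere univ ≠ 0 := by
  have : Nonempty (Fin d) := ⟨⟨0, hd⟩⟩
  simpa [hd.ne'] using (measure_ball_pos volume (0 : Vec d) one_pos).ne'

lemma isProbabilityMeasure_sphereUniform {d : ℕ} (hd : 0 < d) :
    IsProbabilityMeasure (sphereUniform d) := by
  have := cond_isProbabilityMeasure (toSphere_univ_ne_zero hd)
  exact Measure.isProbabilityMeasure_map measurable_subtype_coe.aemeasurable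

lemma ae_norm_sphereUniform (d : ℕ) : ∀ᵐ u ∂(sphereUniform d), ‖u‖ = 1 := by
  rw [sphereUniform, ae_map_iff measurable_subtype_coe.aemeasurable
    (measurableSet_eq_fun measurable_norm measurable_const)]
  exact Filter.Eventually.of_forall fun u => by simp

lemma lintegral_sphereUniform {d : ℕ} (F : Vec d → ℝ≥0∞) (hF : Measurable F) :
    ∫⁻ u, F u ∂(sphereUniform d) = ((volume : Measure (Vec d)).toSphere univ)⁻¹ *
      ∫⁻ u : sphere (0 : Vec d) 1, F u ∂(volume : Measure (Vec d)).toSphere := by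
  rw [sphereUniform, lintegral_map hF measurable_subtype_coe, ProbabilityTheory.cond,
    Measure.restrict_univ, lintegral_smul_measure, smul_eq_mul]

/-- The cone over the section lies in the proper subspace orthogonal to `x`, which has volume zero.
-/
lemma sphereUniform_hyperplane {d : ℕ} {x : Vec d} (hx : x ≠ 0) :
    sphereUniform d {u | inner ℝ u x = 0} = 0 := by
  have hm : MeasurableSet {u : Vec d | inner ℝ u x = 0} :=
    measurableSet_eq_fun (by fun_prop) measurable_const
  rw [sphereUniform_apply hm]
  have h0 : volume ((ℝ ∙ x)ᗮ : Set (Vec d)) = 0 := by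
    refine Measure.addHaar_submodule _ _ fun h => hx ?_
    have : x ∈ (ℝ ∙ x)ᗮ := h ▸ Submodule.mem_top
    rwa [Submodule.mem_orthogonal_singleton_iff_inner_left, inner_self_eq_zero] at this
  have h1 : volume (Ioo (0 : ℝ) 1 • (sphere (0 : Vec d) 1 ∩ {u | inner ℝ u x = 0})) = 0 := by
    refine measure_mono_null ?_ h0
    intro v hv
    obtain ⟨r, -, u, ⟨-, hu⟩, rfl⟩ := Set.mem_smul.1 hv
    have hu' : inner ℝ u x = 0 := hu
    change r • u ∈ (ℝ ∙ x)ᗮ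
    rw [Submodule.mem_orthogonal_singleton_iff_inner_left, inner_smul_left, hu', mul_zero]
  rw [h1, mul_zero, mul_zero]

lemma measurableSet_halfSpace {d : ℕ} (x : Vec d) : MeasurableSet (halfSpace x) :=
  measurableSet_lt measurable_const (by fun_prop)

lemma sphereUniform_halfSpace_neg {d : ℕ} (x : Vec d) :
    sphereUniform d (halfSpace (-x)) = sphereUniform d (halfSpace x) := by
  conv_rhs => rw [← sphereUniform_map (LinearIsometryEquiv.neg ℝ)]
  rw [Measure.map_apply (LinearIsometryEquiv.neg ℝ).continuous.measurable
    (measurableSet_halfSpace x)]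
  congr 1
  ext u
  simp [halfSpace]

/-- The two sets differ by a null hyperplane section, so the asymmetry between `> 0` and `≤ 0` in
the randomizer is immaterial. -/
lemma halfSpace_compl_ae {d : ℕ} {x : Vec d} (hx : x ≠ 0) :
    ((halfSpace x)ᶜ : Set (Vec d)) =ᵐ[sphereUniform d] halfSpace (-x) := by
  have h : ∀ᵐ u ∂(sphereUniform d), inner ℝ u x ≠ 0 := by
    rw [ae_iff]; simpa using sphereUniform_hyperplane hx
  filter_upwards [h] with u hu
  refine propext ⟨fun h1 => ?_, fun h1 => ?_⟩
  · have h2 : ¬ 0 < inner ℝ u x := h1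
    show 0 < inner ℝ u (-x)
    rw [inner_neg_right]
    have := lt_of_le_of_ne (not_lt.1 h2) hu
    linarith
  · have h2 : 0 < inner ℝ u (-x) := h1
    rw [inner_neg_right] at h2
    show ¬ 0 < inner ℝ u x
    linarith

lemma sphereUniform_halfSpace {d : ℕ} (hd : 0 < d) {x : Vec d} (hx : x ≠ 0) :
    sphereUniform d (halfSpace x) = 2⁻¹ ∧ sphereUniform d (halfSpace x)ᶜ = 2⁻¹ := by
  have := isProbabilityMeasure_sphereUniform hd
  have h1 : sphereUniform d (halfSpace x)ᶜ = sphereUniform d (halfSpace x) := by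
    rw [measure_congr (halfSpace_compl_ae hx), sphereUniform_halfSpace_neg]
  have h2 := measure_add_measure_compl (μ := sphereUniform d) (measurableSet_halfSpace x)
  rw [h1, measure_univ, ← two_mul] at h2
  rw [h1]
  have h3 : sphereUniform d (halfSpace x) = 2⁻¹ := by
    rw [← ENNReal.eq_inv_of_mul_eq_one_left (a := sphereUniform d (halfSpace x)) (b := 2)]
    rwa [mul_comm]
  exact ⟨h3, h3⟩

/-! ### Gaussian integrals and exponential moments of the coordinates -/

/-- The integrand factorises over the coordinates, and only the factor of `j` depends on `c`. This
is the Cartesian side of the comparison with polar coordinates. -/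
lemma integral_gaussian_coord {d : ℕ} (j : Fin d) {c : ℝ} (hc : c < 1 / 2) :
    Integrable (fun x : Vec d => exp (c * x j ^ 2 - ‖x‖ ^ 2 / 2)) ∧
    ∫ x : Vec d, exp (c * x j ^ 2 - ‖x‖ ^ 2 / 2) =
      √(π / (1 / 2 - c)) * √(π / (1 / 2)) ^ (d - 1) := by
  set f : Fin d → ℝ → ℝ := fun i t => exp (-(if i = j then 1 / 2 - c else 1 / 2) * t ^ 2) with hf
  have hpos : ∀ i, 0 < (if i = j then 1 / 2 - c else 1 / 2 : ℝ) := by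
    intro i; split_ifs <;> linarith
  have h1 : ∀ x : Vec d, exp (c * x j ^ 2 - ‖x‖ ^ 2 / 2) = ∏ i, f i (x i) := by
    intro x
    rw [hf, ← exp_sum, EuclideanSpace.real_norm_sq_eq]
    congr 1
    have : ∀ i, -(if i = j then 1 / 2 - c else 1 / 2) * x i ^ 2 =
        (if i = j then c * x i ^ 2 else 0) - x i ^ 2 / 2 := by
      intro i; split_ifs <;> ring
    simp_rw [this]
    rw [Finset.sum_sub_distrib, Finset.sum_div]
    simp
  have hI : Integrable (fun x : Fin d → ℝ => ∏ i, f i (x i)) :=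
    Integrable.fintype_prod_dep fun i => integrable_exp_neg_mul_sq (hpos i)
  have hmp := PiLp.volume_preserving_ofLp (Fin d)
  have hemb : MeasurableEmbedding (@WithLp.ofLp 2 (Fin d → ℝ)) :=
    (MeasurableEquiv.toLp 2 (Fin d → ℝ)).symm.measurableEmbedding
  simp_rw [h1]
  refine ⟨(hmp.integrable_comp_emb hemb).2 hI, ?_⟩
  rw [hmp.integral_comp hemb (fun x : Fin d → ℝ => ∏ i, f i (x i)),
    integral_fintype_prod_volume_eq_prod, ← Finset.mul_prod_erase _ _ (Finset.mem_univ j)]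
  simp only [hf]
  congr 1
  · simp only [if_true]
    rw [integral_gaussian]
  · rw [Finset.prod_congr rfl (g := fun _ => √(π / (1 / 2)))]
    · simp
    · intro i hi
      rw [if_neg (Finset.ne_of_mem_erase hi), integral_gaussian]

/-- `∫ r^(d-1) e^{-b r²} dr` is proportional to `b^(-d/2)`. -/
lemma lintegral_radial {d : ℕ} (hd : 0 < d) {b : ℝ} (hb : 0 < b) :
    ∫⁻ r in Ioi (0 : ℝ), ENNReal.ofReal (r ^ (d - 1)) * ENNReal.ofReal (exp (-b * r ^ 2)) =
      ENNReal.ofReal (b ^ (-(d : ℝ) / 2)) * ENNReal.ofReal (1 / 2 * Real.Gamma (d / 2)) := by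
  have hd1 : ((d - 1 : ℕ) : ℝ) = d - 1 := by
    rw [Nat.cast_sub hd]; simp
  have hdpos : (0 : ℝ) < d := by exact_mod_cast hd
  have hint := integral_rpow_mul_exp_neg_mul_rpow (p := 2) (q := (d : ℝ) - 1) (b := b)
    (by norm_num) (by linarith) hb
  have hI : IntegrableOn (fun x : ℝ => x ^ ((d : ℝ) - 1) * exp (-b * x ^ (2 : ℝ))) (Ioi 0) :=
    integrableOn_rpow_mul_exp_neg_mul_rpow (by linarith) (by norm_num) hb
  rw [← ENNReal.ofReal_mul (by positivity)]
  have : b ^ (-(d : ℝ) / 2) * (1 / 2 * Real.Gamma (d / 2)) =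
      ∫ x in Ioi (0 : ℝ), x ^ ((d : ℝ) - 1) * exp (-b * x ^ (2 : ℝ)) := by
    rw [hint]
    simp only [sub_add_cancel]
    ring
  rw [this, ofReal_integral_eq_lintegral_ofReal hI]
  · refine setLIntegral_congr_fun measurableSet_Ioi fun r hr => ?_
    have hr' : (0 : ℝ) < r := hr
    rw [← ENNReal.ofReal_mul (by positivity), ← hd1]
    simp only [rpow_natCast, rpow_ofNat]
  · refine (ae_restrict_mem measurableSet_Ioi).mono fun r hr => ?_
    have hr' : (0 : ℝ) < r := hr
    simp only [Pi.zero_apply]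
    positivity

/-- The polar side: along the ray through `u` the exponent is -(1/2 - c u_j²) r², so the radial
integral leaves (1/2 - c u_j²)^(-d/2). -/
lemma lintegral_gaussian_eq_sphere {d : ℕ} (hd : 0 < d) (j : Fin d) {c : ℝ} (hc0 : 0 ≤ c)
    (hc : c < 1 / 2) :
    ENNReal.ofReal (√(π / (1 / 2 - c)) * √(π / (1 / 2)) ^ (d - 1)) =
      (∫⁻ u : sphere (0 : Vec d) 1,
        ENNReal.ofReal ((1 / 2 - c * (u : Vec d) j ^ 2) ^ (-(d : ℝ) / 2))
        ∂(volume : Measure (Vec d)).toSphere) * ENNReal.ofReal (1 / 2 * Real.Gamma (d / 2)) := by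
  obtain ⟨h1, h2⟩ := integral_gaussian_coord j hc
  rw [← h2, ofReal_integral_eq_lintegral_ofReal h1
    (Filter.Eventually.of_forall fun _ => (exp_pos _).le), lintegral_polar hd _ (by fun_prop),
    ← lintegral_mul_const']
  · refine lintegral_congr fun u => ?_
    have hu : ‖(u : Vec d)‖ = 1 := by simp
    have hu2 : (u : Vec d) j ^ 2 ≤ 1 := by
      have := EuclideanSpace.real_norm_sq_eq (u : Vec d)
      rw [hu] at this
      have h3 := Finset.single_le_sum (f := fun i => (u : Vec d) i ^ 2)
        (fun i _ => sq_nonneg _) (Finset.mem_univ j)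
      simp only at h3
      linarith
    rw [← lintegral_radial hd (by nlinarith)]
    refine lintegral_congr fun r => ?_
    congr 3
    rw [norm_smul, hu, PiLp.smul_apply, smul_eq_mul, mul_one, Real.norm_eq_abs, sq_abs]
    ring
  · exact ENNReal.ofReal_ne_top

/-- Dividing the polar identity for `c` by the one for 0 cancels the surface area and the Gamma
factor and gives E(1 - 2c u_j²)^(-d/2) = (1 - 2c)^(-1/2). The left side dominates the exponential
moment because 1 - t ≤ e^(-t). -/
lemma lintegral_exp_coord_le {d : ℕ} (hd : 0 < d) (j : Fin d) {c : ℝ} (hc0 : 0 ≤ c)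
    (hc : c < 1 / 2) :
    ∫⁻ u, ENNReal.ofReal (exp (c * d * u j ^ 2)) ∂(sphereUniform d) ≤
      ENNReal.ofReal (√(1 - 2 * c))⁻¹ := by
  have hdpos : (0 : ℝ) < d := by exact_mod_cast hd
  have hΓ : 0 < Real.Gamma ((d : ℝ) / 2) := Real.Gamma_pos_of_pos (by positivity)
  have e1 := lintegral_gaussian_eq_sphere hd j hc0 hc
  have e0 := lintegral_gaussian_eq_sphere hd j le_rfl (by norm_num : (0 : ℝ) < 1 / 2)
  simp only [zero_mul, sub_zero] at e0
  rw [lintegral_const] at e0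
  set S := (volume : Measure (Vec d)).toSphere univ with hS
  have hS0 : S ≠ 0 := toSphere_univ_ne_zero hd
  have hSt : S ≠ ⊤ := measure_ne_top _ _
  set G := ENNReal.ofReal (1 / 2 * Real.Gamma (d / 2)) with hG
  have hG0 : G ≠ 0 := by simp [hG, hΓ]
  have hGt : G ≠ ⊤ := ENNReal.ofReal_ne_top
  have hhalf : (0 : ℝ) < (1 / 2 : ℝ) ^ (-(d : ℝ) / 2) := by positivity
  set H := ENNReal.ofReal ((1 / 2 : ℝ) ^ (-(d : ℝ) / 2)) with hH
  have hH0 : H ≠ 0 := by rw [hH]; simpa using hhalf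
  have hHt : H ≠ ⊤ := ENNReal.ofReal_ne_top
  have hm : Measurable fun u : Vec d => ENNReal.ofReal (exp (c * d * u j ^ 2)) := by fun_prop
  rw [lintegral_sphereUniform _ hm]
  set J := ∫⁻ u : sphere (0 : Vec d) 1, ENNReal.ofReal (exp (c * d * (u : Vec d) j ^ 2))
    ∂(volume : Measure (Vec d)).toSphere with hJ
  have hJle : H * J ≤ ∫⁻ u : sphere (0 : Vec d) 1,
        ENNReal.ofReal ((1 / 2 - c * (u : Vec d) j ^ 2) ^ (-(d : ℝ) / 2))
        ∂(volume : Measure (Vec d)).toSphere := by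
    rw [hJ, ← lintegral_const_mul' _ _ hHt]
    refine lintegral_mono fun u => ?_
    have hu : ‖(u : Vec d)‖ = 1 := by simp
    have hu2 : (u : Vec d) j ^ 2 ≤ 1 := by
      have := EuclideanSpace.real_norm_sq_eq (u : Vec d)
      rw [hu] at this
      have h3 := Finset.single_le_sum (f := fun i => (u : Vec d) i ^ 2)
        (fun i _ => sq_nonneg _) (Finset.mem_univ j)
      simp only at h3
      linarith
    rw [hH, ← ENNReal.ofReal_mul hhalf.le]
    refine ENNReal.ofReal_le_ofReal ?_
    set t := c * (u : Vec d) j ^ 2 with ht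
    have ht1 : t < 1 / 2 := by nlinarith [sq_nonneg ((u : Vec d) j)]
    have ht0 : 0 ≤ t := by positivity
    have e : (1 / 2 - t : ℝ) = 1 / 2 * (1 - 2 * t) := by ring
    rw [e, mul_rpow (by norm_num) (by linarith)]
    refine mul_le_mul_of_nonneg_left ?_ hhalf.le
    have h5 : 1 - 2 * t ≤ exp (-(2 * t)) := by
      have := add_one_le_exp (-(2 * t)); linarith
    calc exp (c * d * (u : Vec d) j ^ 2) = (exp (-(2 * t))) ^ (-(d : ℝ) / 2) := by
          rw [← exp_mul]; congr 1; rw [ht]; ring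
      _ ≤ _ := rpow_le_rpow_of_nonpos (by linarith) h5 (by
          have : 0 ≤ (d : ℝ) / 2 := by positivity
          linarith [neg_div 2 (d : ℝ)])
  have hfac : √(π / (1 / 2 - c)) * √(π / (1 / 2)) ^ (d - 1) =
      (√(1 - 2 * c))⁻¹ * (√(π / (1 / 2)) * √(π / (1 / 2)) ^ (d - 1)) := by
    rw [← mul_assoc, ← Real.sqrt_inv, ← Real.sqrt_mul (by
      have : 0 ≤ 1 - 2 * c := by linarith
      positivity)]
    congr 2
    have : (1 - 2 * c) ≠ 0 := by linarith
    have : (1 / 2 - c) ≠ 0 := by linarith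
    field_simp
  rw [hfac, ENNReal.ofReal_mul (by positivity), e0] at e1
  have key : H * J * G ≤ ENNReal.ofReal (√(1 - 2 * c))⁻¹ * (H * S * G) := by
    rw [e1]; gcongr
  have key2 : J ≤ ENNReal.ofReal (√(1 - 2 * c))⁻¹ * S := by
    have h6 : (H * G) * J ≤ (H * G) * (ENNReal.ofReal (√(1 - 2 * c))⁻¹ * S) := by
      calc (H * G) * J = H * J * G := by ring
        _ ≤ _ := key
        _ = _ := by ring
    exact (ENNReal.mul_le_mul_iff_right (mul_ne_zero hH0 hG0) (ENNReal.mul_ne_top hHt hGt)).1 h6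
  calc S⁻¹ * J ≤ S⁻¹ * (ENNReal.ofReal (√(1 - 2 * c))⁻¹ * S) := by gcongr
    _ = ENNReal.ofReal (√(1 - 2 * c))⁻¹ := by
      rw [mul_comm _ S, ← mul_assoc, ENNReal.inv_mul_cancel hS0 hSt, one_mul]

/-! ### Symmetries and coordinate moments of the uniform law -/

lemma integral_sphereUniform_comp {d : ℕ} (f : Vec d ≃ₗᵢ[ℝ] Vec d) (g : Vec d → ℝ) :
    ∫ u, g (f u) ∂(sphereUniform d) = ∫ u, g u ∂(sphereUniform d) := by
  conv_rhs => rw [← sphereUniform_map f]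
  exact (f.toHomeomorph.measurableEmbedding.integral_map g).symm

lemma integrable_sphereUniform_of_bound {d : ℕ} {g : Vec d → ℝ} (hg : Measurable g) (C : ℝ)
    (hC : ∀ u, ‖u‖ = 1 → |g u| ≤ C) : Integrable g (sphereUniform d) :=
  Integrable.of_bound hg.aestronglyMeasurable C
    ((ae_norm_sphereUniform d).mono fun u hu => hC u hu)

lemma integrable_inner_sphereUniform {d : ℕ} (w : Vec d) :
    Integrable (fun u => inner ℝ u w) (sphereUniform d) := by
  refine integrable_sphereUniform_of_bound (by fun_prop) ‖w‖ fun u hu => ?_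
  have := abs_real_inner_le_norm u w
  rwa [hu, one_mul] at this

lemma abs_coord_le_norm {d : ℕ} (u : Vec d) (j : Fin d) : |u j| ≤ ‖u‖ := by
  simpa using PiLp.norm_apply_le u j

lemma integral_sphereUniform_coord {d : ℕ} (φ : ℝ → ℝ) (i j : Fin d) :
    ∫ u, φ (u i) ∂(sphereUniform d) = ∫ u, φ (u j) ∂(sphereUniform d) := by
  rw [← integral_sphereUniform_comp
    (LinearIsometryEquiv.piLpCongrLeft 2 ℝ ℝ (Equiv.swap i j)) (fun u => φ (u i))]
  congr 1
  ext u
  simp [LinearIsometryEquiv.piLpCongrLeft_apply, Equiv.piCongrLeft']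

lemma sphereMeanAbs_eq {d : ℕ} (j : Fin d) :
    sphereMeanAbs d = ∫ u, |u j| ∂(sphereUniform d) := by
  have hd : (d : ℝ) ≠ 0 := by
    have : 0 < d := j.pos
    exact_mod_cast this.ne'
  rw [sphereMeanAbs, integral_finsetSum]
  · rw [Finset.sum_congr rfl fun i _ => integral_sphereUniform_coord (fun t => |t|) i j]
    simp [hd]
  · intro i _
    refine integrable_sphereUniform_of_bound (by fun_prop) 1 fun u hu => ?_
    simpa [hu] using abs_coord_le_norm u i

lemma integral_coord_sq {d : ℕ} (j : Fin d) :
    ∫ u, u j ^ 2 ∂(sphereUniform d) = (d : ℝ)⁻¹ := by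
  have hd0 : 0 < d := j.pos
  have hd : (d : ℝ) ≠ 0 := by exact_mod_cast hd0.ne'
  have := isProbabilityMeasure_sphereUniform hd0
  have h1 : ∫ u, ∑ i, u i ^ 2 ∂(sphereUniform d) = 1 := by
    rw [integral_congr_ae (g := fun _ => (1 : ℝ))]
    · simp
    · refine (ae_norm_sphereUniform d).mono fun u hu => ?_
      have h2 := EuclideanSpace.real_norm_sq_eq u
      simp only
      rw [← h2, hu, one_pow]
  rw [integral_finsetSum] at h1
  · rw [Finset.sum_congr rfl fun i _ => integral_sphereUniform_coord (fun t => t ^ 2) i j] at h1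
    simp only [Finset.sum_const, Finset.card_univ, Fintype.card_fin, nsmul_eq_mul] at h1
    exact eq_inv_of_mul_eq_one_right h1
  · intro i _
    refine integrable_sphereUniform_of_bound (by fun_prop) 1 fun u hu => ?_
    have h3 := abs_coord_le_norm u i
    rw [hu] at h3
    rw [abs_pow]
    exact pow_le_one₀ (abs_nonneg _) h3

lemma integrable_exp_coord {d : ℕ} (j : Fin d) (c : ℝ) :
    Integrable (fun u => exp (c * u j ^ 2)) (sphereUniform d) := by
  refine integrable_sphereUniform_of_bound (by fun_prop) (exp |c|) fun u hu => ?_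
  have h3 := abs_coord_le_norm u j
  rw [hu] at h3
  rw [abs_of_pos (exp_pos _), exp_le_exp]
  have h4 : u j ^ 2 ≤ 1 := by rw [← sq_abs]; exact pow_le_one₀ (abs_nonneg _) h3
  calc c * u j ^ 2 ≤ |c| * u j ^ 2 := by gcongr; exact le_abs_self c
    _ ≤ |c| * 1 := by gcongr
    _ = |c| := mul_one _

lemma integral_exp_coord_le {d : ℕ} (j : Fin d) :
    ∫ u, exp (d / 4 * u j ^ 2) ∂(sphereUniform d) ≤ 3 / 2 := by
  have h1 := lintegral_exp_coord_le j.pos j (c := 1 / 4) (by norm_num) (by norm_num)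
  have h2 := ofReal_integral_eq_lintegral_ofReal (integrable_exp_coord j (1 / 4 * d))
    (Filter.Eventually.of_forall fun _ => (exp_pos _).le)
  rw [← h2] at h1
  -- At c = 1/4 the bound is √2 ≤ 3/2.
  have h3 : (√(1 - 2 * (1 / 4)) : ℝ)⁻¹ ≤ 3 / 2 := by
    rw [inv_le_comm₀ (by norm_num) (by norm_num)]
    apply Real.le_sqrt_of_sq_le; norm_num
  have h4 := (ENNReal.ofReal_le_ofReal_iff (by positivity)).1 h1
  have e : (d / 4 : ℝ) = 1 / 4 * d := by ring
  rw [e]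
  exact h4.trans h3

/-- A first moment is bounded below by a second and a fourth. With b = √d |u_j| one has E b² = 1,
and b⁴ is controlled by the exponential moment. -/
lemma sphereMeanAbs_ge {d : ℕ} (hd : 0 < d) : 1 / (32 * √d) ≤ sphereMeanAbs d := by
  set j : Fin d := ⟨0, hd⟩
  have hdpos : (0 : ℝ) < d := by exact_mod_cast hd
  have hs : 0 < √(d : ℝ) := Real.sqrt_pos.2 hdpos
  have hs2 : √(d : ℝ) ^ 2 = d := Real.sq_sqrt hdpos.le
  rw [sphereMeanAbs_eq j]
  -- Divided by √d, this is b ≥ b²/8 - b⁴/512 with b⁴ ≤ 32 exp(b²/4). In the mean it yields 1/8 -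
  -- (3/2)/16 = 1/32.
  have hpt : ∀ u : Vec d, √d * u j ^ 2 / 8 - (√d)⁻¹ * (exp (d / 4 * u j ^ 2) / 16) ≤ |u j| := by
    intro u
    set b := √d * |u j| with hb
    have hb0 : 0 ≤ b := by positivity
    have hb2 : b ^ 2 = d * u j ^ 2 := by rw [hb, mul_pow, hs2, sq_abs]
    have h1 : b ^ 2 / 8 - b ^ 4 / 512 ≤ b := by
      rcases le_total b 8 with h | h
      · nlinarith [sq_nonneg (b ^ 2)]
      · nlinarith [sq_nonneg b, mul_nonneg (sq_nonneg b) (by nlinarith : 0 ≤ b ^ 2 - 64)]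
    have h2 : b ^ 4 / 32 ≤ exp (b ^ 2 / 4) := by
      have := Real.quadratic_le_exp_of_nonneg (x := b ^ 2 / 4) (by positivity)
      nlinarith [sq_nonneg b]
    have h3 : b ^ 2 / 8 - exp (b ^ 2 / 4) / 16 ≤ b := by linarith
    have h4 : (√d)⁻¹ * (b ^ 2 / 8 - exp (b ^ 2 / 4) / 16) ≤ (√d)⁻¹ * b := by gcongr
    have h5 : (√d)⁻¹ * b = |u j| := by rw [hb, inv_mul_cancel_left₀ hs.ne']
    have h6 : (√d)⁻¹ * b ^ 2 = √d * u j ^ 2 := by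
      rw [hb, mul_pow, sq_abs]; field_simp
    have h7 : b ^ 2 / 4 = d / 4 * u j ^ 2 := by rw [hb2]; ring
    rw [h5, h7] at h4
    have : √d * u j ^ 2 / 8 - (√d)⁻¹ * (exp (d / 4 * u j ^ 2) / 16) =
        (√d)⁻¹ * (b ^ 2 / 8 - exp (d / 4 * u j ^ 2) / 16) := by
      rw [← h6]; ring
    rw [this]; exact h4
  have hI1 : Integrable (fun u : Vec d => u j ^ 2) (sphereUniform d) := by
    refine integrable_sphereUniform_of_bound (by fun_prop) 1 fun u hu => ?_
    have h3 := abs_coord_le_norm u j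
    rw [hu] at h3
    rw [abs_pow]
    exact pow_le_one₀ (abs_nonneg _) h3
  have hI2 : Integrable (fun u : Vec d => |u j|) (sphereUniform d) := by
    refine integrable_sphereUniform_of_bound (by fun_prop) 1 fun u hu => ?_
    simpa [hu] using abs_coord_le_norm u j
  have hI3 := integrable_exp_coord j (d / 4)
  have hmono := integral_mono (((hI1.const_mul (√d)).div_const 8).sub
    ((hI3.div_const 16).const_mul (√d)⁻¹)) hI2 hpt
  refine le_trans ?_ hmono
  simp only [Pi.sub_apply]
  rw [integral_sub ((hI1.const_mul (√d)).div_const 8)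
    ((hI3.div_const 16).const_mul (√d)⁻¹), integral_div, integral_const_mul, integral_const_mul,
    integral_div, integral_coord_sq]
  have h8 := integral_exp_coord_le j
  have h9 : (√d)⁻¹ * ((∫ u, exp (d / 4 * u j ^ 2) ∂(sphereUniform d)) / 16) ≤
      (√d)⁻¹ * (3 / 32) := by
    exact mul_le_mul_of_nonneg_left (by linarith) (by positivity)
  have h10 : √d * (d : ℝ)⁻¹ = (√d)⁻¹ := by
    rw [← div_eq_mul_inv, Real.sqrt_div_self', one_div]
  rw [h10]
  have h11 : 1 / (32 * √d) = (√d)⁻¹ / 32 := by field_simp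
  rw [h11]
  linarith

/-! ### Means over half-spheres -/

lemma integral_abs_inner {d : ℕ} (hd : 0 < d) (x : Vec d) :
    ∫ u, |inner ℝ u x| ∂(sphereUniform d) = ‖x‖ * sphereMeanAbs d := by
  set j : Fin d := ⟨0, hd⟩
  set e : Vec d := ‖x‖ • EuclideanSpace.single j (1 : ℝ) with he
  have hn : ‖x‖ = ‖e‖ := by simp [he, norm_smul]
  -- A reflection exchanging `x` with ‖x‖ times a basis vector reduces the claim to one coordinate.
  set f := Submodule.reflection (ℝ ∙ (x - e))ᗮ with hf
  have h1 : f x = e := Submodule.reflection_sub hn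
  have h2 : ∀ u, inner ℝ (f u) x = inner ℝ u e := by
    intro u
    rw [← h1, ← LinearIsometryEquiv.inner_map_map f u (f x)]
    rw [Submodule.reflection_reflection]
  rw [← integral_sphereUniform_comp f, sphereMeanAbs_eq j, ← integral_const_mul]
  refine integral_congr_ae (Filter.Eventually.of_forall fun u => ?_)
  simp only
  rw [h2, he, inner_smul_right, abs_mul, abs_of_nonneg (norm_nonneg x)]
  simp [EuclideanSpace.inner_single_right]

lemma integral_inner_sphereUniform {d : ℕ} (w : Vec d) :
    ∫ u, inner ℝ u w ∂(sphereUniform d) = 0 := by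
  have h := integral_sphereUniform_comp (LinearIsometryEquiv.neg ℝ) (fun u : Vec d => inner ℝ u w)
  simp only [LinearIsometryEquiv.coe_neg, inner_neg_left, integral_neg] at h
  linarith

/-- The reflection in the line through `x` fixes the half-space and changes the sign of the
integrand. -/
lemma integral_halfSpace_of_orthogonal {d : ℕ} {x w : Vec d} (hw : inner ℝ x w = 0) :
    ∫ u in halfSpace x, inner ℝ u w ∂(sphereUniform d) = 0 := by
  rw [← integral_indicator (measurableSet_halfSpace x)]
  set f := Submodule.reflection (ℝ ∙ x) with hf
  have hx : f x = x := Submodule.reflection_mem_subspace_eq_self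
    (Submodule.mem_span_singleton_self x)
  have hfw : f w = -w := Submodule.reflection_mem_subspace_orthogonalComplement_eq_neg
    (Submodule.mem_orthogonal_singleton_iff_inner_right.2 hw)
  have h1 : ∀ u, inner ℝ (f u) x = inner ℝ u x := fun u => by
    conv_lhs => rw [← hx]
    exact LinearIsometryEquiv.inner_map_map f u x
  have h2 : ∀ u, inner ℝ (f u) w = -inner ℝ u w := fun u => by
    have := LinearIsometryEquiv.inner_map_map f u w
    rw [hfw, inner_neg_right] at this
    linarith
  have h := integral_sphereUniform_comp f ((halfSpace x).indicator fun u => inner ℝ u w)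
  have h3 : ∀ u, (halfSpace x).indicator (fun u => (inner ℝ u w : ℝ)) (f u) =
      -(halfSpace x).indicator (fun u => inner ℝ u w) u := by
    intro u
    by_cases hu : u ∈ halfSpace x
    · have hu' : f u ∈ halfSpace x := by
        show 0 < inner ℝ (f u) x; rw [h1]; exact hu
      rw [indicator_of_mem hu, indicator_of_mem hu', h2]
    · have hu' : f u ∉ halfSpace x := by
        intro h'; apply hu
        show 0 < inner ℝ u x; rw [← h1]; exact h'
      rw [indicator_of_notMem hu, indicator_of_notMem hu', neg_zero]
  simp_rw [h3] at h
  rw [integral_neg] at h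
  linarith

/-- The mean over the whole sphere vanishes, so the positive part carries half of the mean absolute
value. -/
lemma integral_halfSpace_self {d : ℕ} (hd : 0 < d) (x : Vec d) :
    ∫ u in halfSpace x, inner ℝ u x ∂(sphereUniform d) = ‖x‖ * sphereMeanAbs d / 2 := by
  have hI := integrable_inner_sphereUniform x
  have h1 := integral_abs_inner hd x
  have h2 := integral_inner_sphereUniform x
  have h3 : ∫ u in halfSpace x, inner ℝ u x ∂(sphereUniform d) =
      ∫ u, (|inner ℝ u x| + inner ℝ u x) / 2 ∂(sphereUniform d) := by
    rw [← integral_indicator (measurableSet_halfSpace x)]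
    refine integral_congr_ae (Filter.Eventually.of_forall fun u => ?_)
    simp only
    by_cases hu : u ∈ halfSpace x
    · rw [indicator_of_mem hu, abs_of_pos hu]; ring
    · have : inner ℝ u x ≤ 0 := not_lt.1 hu
      rw [indicator_of_notMem hu, abs_of_nonpos this]; ring
  rw [h3, integral_div, integral_add hI.abs hI, h1, h2, add_zero]

lemma integral_halfSpace {d : ℕ} (hd : 0 < d) {x : Vec d} (hx : x ≠ 0) (w : Vec d) :
    ∫ u in halfSpace x, inner ℝ u w ∂(sphereUniform d) =
      sphereMeanAbs d / 2 * (inner ℝ x w / ‖x‖) := by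
  have hn : ‖x‖ ≠ 0 := norm_ne_zero_iff.2 hx
  set α := inner ℝ x w / ‖x‖ ^ 2 with hα
  have hort : inner ℝ x (w - α • x) = 0 := by
    rw [inner_sub_right, inner_smul_right, real_inner_self_eq_norm_sq, hα]
    field_simp; ring
  have h1 : ∀ u : Vec d, (inner ℝ u w : ℝ) = inner ℝ u (w - α • x) + α * inner ℝ u x := by
    intro u; rw [inner_sub_right, inner_smul_right]; ring
  simp_rw [h1]
  rw [integral_add (integrable_inner_sphereUniform _).integrableOn
    ((integrable_inner_sphereUniform _).const_mul _).integrableOn, integral_const_mul,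
    integral_halfSpace_of_orthogonal hort, integral_halfSpace_self hd, hort, hα,
    real_inner_self_eq_norm_sq]
  field_simp
  ring

lemma integral_halfSpace_compl {d : ℕ} (hd : 0 < d) {x : Vec d} (hx : x ≠ 0) (w : Vec d) :
    ∫ u in (halfSpace x)ᶜ, inner ℝ u w ∂(sphereUniform d) =
      -(sphereMeanAbs d / 2 * (inner ℝ x w / ‖x‖)) := by
  have h := integral_add_compl (measurableSet_halfSpace x) (integrable_inner_sphereUniform w)
  rw [integral_inner_sphereUniform, integral_halfSpace hd hx] at h
  linarith

/-! ### The randomizer: density bounds, privacy, unbiasedness -/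

lemma cond_halfSpace_eq {d : ℕ} (hd : 0 < d) {x : Vec d} (hx : x ≠ 0) :
    ProbabilityTheory.cond (sphereUniform d) (halfSpace x) =
        (2 : ℝ≥0∞) • (sphereUniform d).restrict (halfSpace x) ∧
      ProbabilityTheory.cond (sphereUniform d) (halfSpace x)ᶜ =
        (2 : ℝ≥0∞) • (sphereUniform d).restrict (halfSpace x)ᶜ := by
  obtain ⟨h1, h2⟩ := sphereUniform_halfSpace hd hx
  rw [ProbabilityTheory.cond, ProbabilityTheory.cond, h1, h2, inv_inv]
  exact ⟨rfl, rfl⟩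

/-- Since each half has mass 1/2, conditioning doubles the uniform law. The two resulting density
values have ratio e^ε, which is the source of privacy. -/
lemma hemisphereLaw_eq {d : ℕ} (hd : 0 < d) (ε : ℝ) {x : Vec d} (hx : x ≠ 0) :
    hemisphereLaw ε x =
      (ENNReal.ofReal (exp ε / (exp ε + 1)) * 2) • (sphereUniform d).restrict (halfSpace x) +
      (ENNReal.ofReal (1 / (exp ε + 1)) * 2) • (sphereUniform d).restrict (halfSpace x)ᶜ := by
  obtain ⟨h1, h2⟩ := cond_halfSpace_eq hd hx
  rw [hemisphereLaw, h1, h2, smul_smul, smul_smul]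

lemma isProbabilityMeasure_hemisphereLaw {d : ℕ} (hd : 0 < d) (ε : ℝ) {x : Vec d} (hx : x ≠ 0) :
    IsProbabilityMeasure (hemisphereLaw ε x) := by
  constructor
  obtain ⟨h1, h2⟩ := sphereUniform_halfSpace hd hx
  have h3 : (2 : ℝ≥0∞) * 2⁻¹ = 1 := ENNReal.mul_inv_cancel (by norm_num) (by norm_num)
  rw [hemisphereLaw_eq hd ε hx]
  simp only [Measure.add_apply, Measure.smul_apply, Measure.restrict_apply_univ, smul_eq_mul, h1,
    h2, mul_assoc, h3, mul_one]
  rw [← ENNReal.ofReal_add (by positivity) (by positivity), ← add_div,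
    div_self (by positivity), ENNReal.ofReal_one]

lemma signProb_le_one {d : ℕ} (r : ℝ) (x : Vec d) : signProb r x ≤ 1 := by
  rw [signProb, ENNReal.ofReal_le_one]; exact min_le_left _ _

lemma isProbabilityMeasure_directionLaw {d : ℕ} (hd : 0 < d) (ε r : ℝ) (x : Vec d) :
    IsProbabilityMeasure (directionLaw ε r x) := by
  rw [directionLaw]
  split_ifs with hx
  · exact isProbabilityMeasure_sphereUniform hd
  · have h1 := isProbabilityMeasure_hemisphereLaw hd ε hx
    have h2 := isProbabilityMeasure_hemisphereLaw hd ε (neg_ne_zero.2 hx)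
    constructor
    simp only [Measure.add_apply, Measure.smul_apply, smul_eq_mul, measure_univ, mul_one]
    exact add_tsub_cancel_of_le (signProb_le_one r x)

lemma hemisphereLaw_le {d : ℕ} (hd : 0 < d) {ε : ℝ} (hε : 0 < ε) {x : Vec d} (hx : x ≠ 0)
    {A : Set (Vec d)} (hA : MeasurableSet A) :
    hemisphereLaw ε x A ≤ ENNReal.ofReal (exp ε / (exp ε + 1)) * 2 * sphereUniform d A := by
  have hpq : ENNReal.ofReal (1 / (exp ε + 1)) ≤ ENNReal.ofReal (exp ε / (exp ε + 1)) := by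
    refine ENNReal.ofReal_le_ofReal ?_
    gcongr; exact one_le_exp hε.le
  have h := measure_inter_add_sdiff (μ := sphereUniform d) A (measurableSet_halfSpace x)
  rw [hemisphereLaw_eq hd ε hx]
  simp only [Measure.add_apply, Measure.smul_apply, smul_eq_mul, Measure.restrict_apply hA]
  rw [← h, mul_add, ← sdiff_eq]
  gcongr

lemma le_hemisphereLaw {d : ℕ} (hd : 0 < d) {ε : ℝ} (hε : 0 < ε) {x : Vec d} (hx : x ≠ 0)
    {A : Set (Vec d)} (hA : MeasurableSet A) :
    ENNReal.ofReal (1 / (exp ε + 1)) * 2 * sphereUniform d A ≤ hemisphereLaw ε x A := by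
  have hpq : ENNReal.ofReal (1 / (exp ε + 1)) ≤ ENNReal.ofReal (exp ε / (exp ε + 1)) := by
    refine ENNReal.ofReal_le_ofReal ?_
    gcongr; exact one_le_exp hε.le
  have h := measure_inter_add_sdiff (μ := sphereUniform d) A (measurableSet_halfSpace x)
  rw [hemisphereLaw_eq hd ε hx]
  simp only [Measure.add_apply, Measure.smul_apply, smul_eq_mul, Measure.restrict_apply hA]
  rw [← h, mul_add, ← sdiff_eq]
  gcongr

/-- A mixture of two laws with bounded density keeps the bound; for `x = 0` the density is 1, which
lies between the two extreme values. The bound does not involve `x`. -/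
lemma directionLaw_le {d : ℕ} (hd : 0 < d) {ε : ℝ} (hε : 0 < ε) (r : ℝ) (x : Vec d)
    {A : Set (Vec d)} (hA : MeasurableSet A) :
    directionLaw ε r x A ≤ ENNReal.ofReal (exp ε / (exp ε + 1)) * 2 * sphereUniform d A := by
  rw [directionLaw]
  split_ifs with hx
  · refine le_mul_of_one_le_left zero_le ?_
    rw [← ENNReal.ofReal_ofNat, ← ENNReal.ofReal_mul (by positivity), ENNReal.one_le_ofReal,
      div_mul_eq_mul_div, le_div_iff₀ (by positivity)]
    linarith [one_le_exp hε.le]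
  · simp only [Measure.add_apply, Measure.smul_apply, smul_eq_mul]
    calc _ ≤ signProb r x * (ENNReal.ofReal (exp ε / (exp ε + 1)) * 2 * sphereUniform d A) +
        (1 - signProb r x) * (ENNReal.ofReal (exp ε / (exp ε + 1)) * 2 * sphereUniform d A) := by
          gcongr
          · exact hemisphereLaw_le hd hε hx hA
          · exact hemisphereLaw_le hd hε (neg_ne_zero.2 hx) hA
      _ = _ := by
          rw [← add_mul, add_tsub_cancel_of_le (signProb_le_one r x), one_mul]

lemma le_directionLaw {d : ℕ} (hd : 0 < d) {ε : ℝ} (hε : 0 < ε) (r : ℝ) (x : Vec d)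
    {A : Set (Vec d)} (hA : MeasurableSet A) :
    ENNReal.ofReal (1 / (exp ε + 1)) * 2 * sphereUniform d A ≤ directionLaw ε r x A := by
  rw [directionLaw]
  split_ifs with hx
  · refine mul_le_of_le_one_left zero_le ?_
    rw [← ENNReal.ofReal_ofNat, ← ENNReal.ofReal_mul (by positivity), ENNReal.ofReal_le_one,
      div_mul_eq_mul_div, div_le_one (by positivity)]
    linarith [one_le_exp hε.le]
  · simp only [Measure.add_apply, Measure.smul_apply, smul_eq_mul]
    calc _ = signProb r x * (ENNReal.ofReal (1 / (exp ε + 1)) * 2 * sphereUniform d A) +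
        (1 - signProb r x) * (ENNReal.ofReal (1 / (exp ε + 1)) * 2 * sphereUniform d A) := by
          rw [← add_mul, add_tsub_cancel_of_le (signProb_le_one r x), one_mul]
      _ ≤ _ := by
          gcongr
          · exact le_hemisphereLaw hd hε hx hA
          · exact le_hemisphereLaw hd hε (neg_ne_zero.2 hx) hA

lemma directionLaw_privacy {d : ℕ} (hd : 0 < d) {ε : ℝ} (hε : 0 < ε) (r : ℝ) (x x' : Vec d)
    {A : Set (Vec d)} (hA : MeasurableSet A) :
    directionLaw ε r x A ≤ ENNReal.ofReal (exp ε) * directionLaw ε r x' A := by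
  calc _ ≤ ENNReal.ofReal (exp ε / (exp ε + 1)) * 2 * sphereUniform d A :=
        directionLaw_le hd hε r x hA
    _ = ENNReal.ofReal (exp ε) *
          (ENNReal.ofReal (1 / (exp ε + 1)) * 2 * sphereUniform d A) := by
        rw [← mul_assoc, ← mul_assoc, ← ENNReal.ofReal_mul (exp_pos _).le, mul_one_div]
    _ ≤ _ := by gcongr; exact le_directionLaw hd hε r x' hA

/-- A density bound free of ε transfers integrability and exponential moments from the uniform law
to the randomizer. -/
lemma directionLaw_le_two_smul {d : ℕ} (hd : 0 < d) {ε : ℝ} (hε : 0 < ε) (r : ℝ) (x : Vec d) :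
    directionLaw ε r x ≤ (2 : ℝ≥0∞) • sphereUniform d := by
  refine Measure.le_iff.2 fun A hA => (directionLaw_le hd hε r x hA).trans ?_
  rw [Measure.smul_apply, smul_eq_mul]
  gcongr
  refine mul_le_of_le_one_left zero_le ?_
  rw [ENNReal.ofReal_le_one, div_le_one (by positivity)]
  linarith [exp_pos ε]

lemma randomizer_apply {d : ℕ} (ε r : ℝ) (x : Vec d) :
    randomizer d ε r x = (directionLaw ε r x).map (fun u => outputScale d ε r • u) := by
  rw [randomizer, Kernel.map_apply _ (by fun_prop)]
  rfl

lemma isMarkovKernel_randomizer {d : ℕ} (hd : 0 < d) (ε r : ℝ) :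
    IsMarkovKernel (randomizer d ε r) := by
  constructor
  intro x
  rw [randomizer_apply]
  have := isProbabilityMeasure_directionLaw hd ε r x
  exact Measure.isProbabilityMeasure_map (by fun_prop)

lemma randomizer_privacy {d : ℕ} (hd : 0 < d) {ε : ℝ} (hε : 0 < ε) (r : ℝ) (x x' : Vec d)
    {A : Set (Vec d)} (hA : MeasurableSet A) :
    randomizer d ε r x A ≤ ENNReal.ofReal (exp ε) * randomizer d ε r x' A := by
  have hm : Measurable (fun u : Vec d => outputScale d ε r • u) := by fun_prop
  rw [randomizer_apply, randomizer_apply, Measure.map_apply hm hA, Measure.map_apply hm hA]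
  exact directionLaw_privacy hd hε r x x' (hm hA)

lemma integral_hemisphereLaw {d : ℕ} (hd : 0 < d) {ε : ℝ} {x : Vec d} (hx : x ≠ 0) (w : Vec d) :
    Integrable (fun u => inner ℝ u w) (hemisphereLaw ε x) ∧
    ∫ u, inner ℝ u w ∂(hemisphereLaw ε x) =
      (exp ε - 1) / (exp ε + 1) * sphereMeanAbs d * (inner ℝ x w / ‖x‖) := by
  have hI := integrable_inner_sphereUniform w
  have c1 : ENNReal.ofReal (exp ε / (exp ε + 1)) * 2 ≠ ⊤ := by finiteness
  have c2 : ENNReal.ofReal (1 / (exp ε + 1)) * 2 ≠ ⊤ := by finiteness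
  have I1 := (hI.integrableOn (s := halfSpace x)).smul_measure c1
  have I2 := (hI.integrableOn (s := (halfSpace x)ᶜ)).smul_measure c2
  rw [hemisphereLaw_eq hd ε hx]
  refine ⟨I1.add_measure I2, ?_⟩
  rw [integral_add_measure I1 I2, integral_smul_measure, integral_smul_measure,
    integral_halfSpace hd hx, integral_halfSpace_compl hd hx, ENNReal.toReal_mul,
    ENNReal.toReal_mul, ENNReal.toReal_ofReal (by positivity),
    ENNReal.toReal_ofReal (by positivity)]
  simp only [ENNReal.toReal_ofNat, smul_eq_mul]
  ring

/-- The mean of the random direction is proportional to the input. -/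
lemma integral_directionLaw {d : ℕ} (hd : 0 < d) {ε r : ℝ} (hr : 0 < r) {x : Vec d}
    (hx : ‖x‖ ≤ r) (w : Vec d) :
    ∫ u, inner ℝ u w ∂(directionLaw ε r x) =
      (exp ε - 1) / (exp ε + 1) * sphereMeanAbs d * (inner ℝ x w / r) := by
  rw [directionLaw]
  split_ifs with h0
  · rw [integral_inner_sphereUniform, h0, inner_zero_left, zero_div, mul_zero]
  · have hn : ‖x‖ ≠ 0 := norm_ne_zero_iff.2 h0
    obtain ⟨I1, e1⟩ := integral_hemisphereLaw hd (ε := ε) h0 w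
    obtain ⟨I2, e2⟩ := integral_hemisphereLaw hd (ε := ε) (neg_ne_zero.2 h0) w
    have hle : 1 / 2 + ‖x‖ / (2 * r) ≤ 1 := by
      have : ‖x‖ / (2 * r) ≤ 1 / 2 := by
        rw [div_le_div_iff₀ (by positivity) (by norm_num)]; linarith
      linarith
    have hp : signProb r x = ENNReal.ofReal (1 / 2 + ‖x‖ / (2 * r)) := by
      rw [signProb, min_eq_right hle]
    have hq : 1 - signProb r x = ENNReal.ofReal (1 - (1 / 2 + ‖x‖ / (2 * r))) := by
      rw [hp, ENNReal.ofReal_sub _ (by positivity), ENNReal.ofReal_one]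
    rw [integral_add_measure (I1.smul_measure (by rw [hp]; finiteness))
      (I2.smul_measure (by rw [hq]; finiteness)), integral_smul_measure, integral_smul_measure,
      e1, e2, hq, hp, ENNReal.toReal_ofReal (by positivity), ENNReal.toReal_ofReal (by linarith)]
    -- The hemisphere means for the two signs are opposite. With p the probability of the sign +1,
    -- 2p - 1 = ‖x‖ / r cancels the factor 1 / ‖x‖ in them.
    simp only [inner_neg_left, norm_neg, smul_eq_mul]
    field_simp
    ring

/-- The linear term is kept exactly, since its mean is known; everything else becomes a square
exponential, which only needs the uniform law. -/
lemma exp_le_add_exp_sq (y : ℝ) : exp y ≤ y + exp (y ^ 2) := by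
  have h2 := add_one_le_exp (y ^ 2)
  rcases le_total 1 y with h | h
  · have : exp y ≤ exp (y ^ 2) := exp_le_exp.2 (by nlinarith)
    linarith
  rcases le_total (-1) y with h' | h'
  · have := abs_le.1 (abs_exp_sub_one_sub_id_le (x := y) (abs_le.2 ⟨h', h⟩))
    linarith [this.2]
  · have : exp y ≤ 1 := exp_le_one_iff.2 (by linarith)
    nlinarith

/-- Convexity of `exp` on the segment from `0` to `z`. -/
lemma exp_mul_le {t z : ℝ} (h0 : 0 ≤ t) (h1 : t ≤ 1) :
    exp (t * z) ≤ 1 + t * (exp z - 1) := by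
  have h := convexOn_exp.2 (mem_univ (0 : ℝ)) (mem_univ z) (sub_nonneg.2 h1) h0 (by ring)
  simp only [smul_eq_mul, mul_zero, zero_add, exp_zero, mul_one] at h
  linarith

/-- Write a² = t d/4 with t ≤ 1. Convexity bounds exp(a² u_j²) by 1 + t (exp(d u_j²/4) - 1), so the
remainder is of order t with the exact linear term in front. -/
lemma integral_exp_directionLaw_le {d : ℕ} (j : Fin d) {ε r : ℝ} (hε : 0 < ε) (x : Vec d)
    {a : ℝ} (ha : a ^ 2 ≤ d / 4) :
    Integrable (fun u => exp (a * u j)) (directionLaw ε r x) ∧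
    ∫ u, exp (a * u j) ∂(directionLaw ε r x) ≤
      1 + a * ∫ u, u j ∂(directionLaw ε r x) + 4 * a ^ 2 / d := by
  have hd : 0 < d := j.pos
  have hdpos : (0 : ℝ) < d := by exact_mod_cast hd
  have hle := directionLaw_le_two_smul hd hε r x
  have := isProbabilityMeasure_directionLaw hd ε r x
  have := isProbabilityMeasure_sphereUniform hd
  have hint : ∀ g : Vec d → ℝ, Integrable g (sphereUniform d) →
      Integrable g (directionLaw ε r x) := fun g hg =>
    (hg.smul_measure (c := 2) (by norm_num)).mono_measure hle
  have hc : Integrable (fun u : Vec d => u j) (sphereUniform d) := by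
    refine integrable_sphereUniform_of_bound (by fun_prop) 1 fun u hu => ?_
    simpa [hu] using abs_coord_le_norm u j
  have he : Integrable (fun u : Vec d => exp (a * u j)) (sphereUniform d) := by
    refine integrable_sphereUniform_of_bound (by fun_prop) (exp |a|) fun u hu => ?_
    have h3 := abs_coord_le_norm u j
    rw [hu] at h3
    rw [abs_of_pos (exp_pos _), exp_le_exp]
    calc a * u j ≤ |a * u j| := le_abs_self _
      _ = |a| * |u j| := abs_mul _ _
      _ ≤ |a| * 1 := by gcongr
      _ = |a| := mul_one _
  refine ⟨hint _ he, ?_⟩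
  set t := 4 * a ^ 2 / d with ht
  have ht0 : 0 ≤ t := by positivity
  have ht1 : t ≤ 1 := by rw [ht, div_le_one hdpos]; linarith
  set E : Vec d → ℝ := fun u => exp (d / 4 * u j ^ 2) - 1 with hE
  have hEI : Integrable E (sphereUniform d) := (integrable_exp_coord j (d / 4)).sub
    (integrable_const 1)
  have hE0 : ∀ u, 0 ≤ E u := fun u => by
    have : 1 ≤ exp (d / 4 * u j ^ 2) := one_le_exp (by positivity)
    simp only [hE]; linarith
  have hpt : ∀ u : Vec d, exp (a * u j) ≤ a * u j + (1 + t * E u) := by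
    intro u
    refine (exp_le_add_exp_sq _).trans (add_le_add_right ?_ _)
    have e : (a * u j) ^ 2 = t * (d / 4 * u j ^ 2) := by
      rw [ht]; field_simp
    rw [e]
    exact exp_mul_le ht0 ht1
  -- Twice the uniform mean of `E`, which is at most 3/2 - 1.
  have h2E : ∫ u, E u ∂(directionLaw ε r x) ≤ 1 := by
    have h1 : ∫ u, E u ∂(directionLaw ε r x) ≤ ∫ u, E u ∂((2 : ℝ≥0∞) • sphereUniform d) :=
      integral_mono_measure hle (Filter.Eventually.of_forall hE0)
        (hEI.smul_measure (by norm_num))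
    refine h1.trans ?_
    rw [integral_smul_measure, hE, integral_sub (integrable_exp_coord j (d / 4))
      (integrable_const 1)]
    have := integral_exp_coord_le j
    simp only [ENNReal.toReal_ofNat, integral_const, probReal_univ, smul_eq_mul, mul_one]
    linarith
  have I1 := (hint _ hc).const_mul a
  have I2 : Integrable (fun u => 1 + t * E u) (directionLaw ε r x) :=
    (integrable_const (1 : ℝ)).add ((hint _ hEI).const_mul t)
  calc ∫ u, exp (a * u j) ∂(directionLaw ε r x)
      ≤ ∫ u, (a * u j + (1 + t * E u)) ∂(directionLaw ε r x) :=
        integral_mono (hint _ he) (I1.add I2) hpt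
    _ = a * ∫ u, u j ∂(directionLaw ε r x) +
        (1 + t * ∫ u, E u ∂(directionLaw ε r x)) := by
        rw [integral_add I1 I2, integral_const_mul,
          integral_add (integrable_const _) ((hint _ hEI).const_mul t), integral_const_mul]
        simp
    _ ≤ _ := by nlinarith

lemma outputScale_pos {d : ℕ} (hd : 0 < d) {ε r : ℝ} (hε : 0 < ε) (hr : 0 < r) :
    0 < outputScale d ε r := by
  have h1 : 0 < sphereMeanAbs d := lt_of_lt_of_le
    (by have : (0 : ℝ) < d := by exact_mod_cast hd
        positivity) (sphereMeanAbs_ge hd)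
  have h2 : 0 < exp ε - 1 := by linarith [add_one_lt_exp hε.ne']
  unfold outputScale
  positivity

lemma outputScale_le {d : ℕ} (hd : 0 < d) {ε r : ℝ} (hε : 0 < ε) (hr : 0 < r) :
    outputScale d ε r ≤ 128 * √d * r / min ε 1 := by
  have hdpos : (0 : ℝ) < d := by exact_mod_cast hd
  have hs : 0 < √(d : ℝ) := Real.sqrt_pos.2 hdpos
  have h1 : (sphereMeanAbs d)⁻¹ ≤ 32 * √d := by
    have := sphereMeanAbs_ge hd
    rw [inv_le_comm₀ (lt_of_lt_of_le (by positivity) this) (by positivity), ← one_div]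
    exact this
  have hm : 0 < min ε 1 := lt_min hε one_pos
  have he : min ε 1 ≤ exp ε - 1 := (min_le_left _ _).trans (by linarith [add_one_le_exp ε])
  -- For ε ≤ 1 use e^ε - 1 ≥ ε and e + 1 ≤ 4; for ε ≥ 1 the quotient is below 4. With the 32 above
  -- this makes 128.
  have h2 : (exp ε + 1) / (exp ε - 1) ≤ 4 / min ε 1 := by
    rw [div_le_div_iff₀ (by linarith) hm]
    rcases le_total ε 1 with h | h
    · rw [min_eq_left h] at *
      have h3 : exp ε ≤ exp 1 := exp_le_exp.2 h
      have := exp_one_lt_d9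
      nlinarith
    · rw [min_eq_right h] at *
      have h3 : exp 1 ≤ exp ε := exp_le_exp.2 h
      have := exp_one_gt_d9
      linarith
  have h3 : 0 ≤ (sphereMeanAbs d)⁻¹ := by
    refine inv_nonneg.2 (le_trans (by positivity) (sphereMeanAbs_ge hd))
  calc outputScale d ε r ≤ r * (4 / min ε 1) * (32 * √d) := by
        unfold outputScale; gcongr
    _ = _ := by ring

/-- The randomizer is unbiased, and its coordinates have sub-Gaussian exponential moments at the
scale `B / √d`, where `B` is the length of the output. -/
lemma lintegral_exp_randomizer_le {d : ℕ} (j : Fin d) {ε r : ℝ} (hε : 0 < ε) (hr : 0 < r)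
    {x : Vec d} (hx : ‖x‖ ≤ r) {s : ℝ} (hs : (s * outputScale d ε r) ^ 2 ≤ d / 4) :
    0 ≤ 1 + s * x j + 4 * (s * outputScale d ε r) ^ 2 / d ∧
    ∫⁻ w, ENNReal.ofReal (exp (s * w j)) ∂(randomizer d ε r x) ≤
      ENNReal.ofReal (1 + s * x j + 4 * (s * outputScale d ε r) ^ 2 / d) := by
  have hd : 0 < d := j.pos
  set B := outputScale d ε r with hB
  obtain ⟨hI, hle⟩ := integral_exp_directionLaw_le (r := r) j hε x hs
  have hle' : ∫ u, exp (s * B * u j) ∂(directionLaw ε r x) ≤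
      1 + s * x j + 4 * (s * B) ^ 2 / d := by
    refine hle.trans (le_of_eq ?_)
    have e2 := integral_directionLaw hd (ε := ε) hr hx (EuclideanSpace.single j (1 : ℝ))
    simp only [EuclideanSpace.inner_single_right, one_mul, conj_trivial] at e2
    -- `outputScale` is the reciprocal of the factor in the mean direction, so the linear term is
    -- exactly `s * x j`.
    rw [e2, hB, outputScale]
    have h1 : sphereMeanAbs d ≠ 0 := (lt_of_lt_of_le
      (by have : (0 : ℝ) < d := by exact_mod_cast hd
          positivity) (sphereMeanAbs_ge hd)).ne'
    have h2 : exp ε - 1 ≠ 0 := by linarith [add_one_lt_exp hε.ne']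
    field_simp
  refine ⟨(integral_nonneg fun u => (exp_pos _).le).trans hle', ?_⟩
  have hm : Measurable (fun u : Vec d => B • u) := by fun_prop
  rw [randomizer_apply, lintegral_map (by fun_prop) hm]
  have e1 : ∀ u : Vec d, s * (B • u) j = s * B * u j := fun u => by
    rw [PiLp.smul_apply, smul_eq_mul]; ring
  simp_rw [e1]
  rw [← ofReal_integral_eq_lintegral_ofReal hI
    (Filter.Eventually.of_forall fun _ => (exp_pos _).le)]
  exact ENNReal.ofReal_le_ofReal hle'

end Sphere

/-! ### Truncation and projection -/

/-- "Comes before" is a strict total order, so the rank of a coordinate, the number of its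
predecessors, is injective with values below `d`. Hence exactly min(s, d) coordinates have rank less
than `s`, ties included. -/
lemma trunc_spec {d : ℕ} (s : ℕ) (v : Vec d) :
    ∃ S : Finset (Fin d), S.card ≤ s ∧ (∀ j, trunc s v j = if j ∈ S then v j else 0) ∧
      (∀ j ∈ S, ∀ l ∉ S, |v l| ≤ |v j|) ∧ (S = Finset.univ ∨ S.card = s) := by
  classical
  set before : Fin d → Finset (Fin d) := fun j =>
    Finset.univ.filter fun l => |v j| < |v l| ∨ (|v j| = |v l| ∧ l < j) with hbefore
  have hself : ∀ j, j ∉ before j := by intro j; simp [hbefore]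
  have hlt : ∀ j l, l ∈ before j → (before l).card < (before j).card := by
    intro j l hl
    refine Finset.card_lt_card (Finset.ssubset_iff_of_subset ?_ |>.2 ⟨l, hl, hself l⟩)
    intro i hi
    simp only [hbefore, Finset.mem_filter, Finset.mem_univ, true_and] at hl hi ⊢
    rcases hl with hl | ⟨hl, hl'⟩ <;> rcases hi with hi | ⟨hi, hi'⟩
    · exact Or.inl (hl.trans hi)
    · exact Or.inl (hl.trans_eq hi)
    · exact Or.inl (hl.trans_lt hi)
    · exact Or.inr ⟨hl.trans hi, hi'.trans hl'⟩
  have htot : ∀ j l, j ≠ l → l ∈ before j ∨ j ∈ before l := by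
    intro j l hjl
    simp only [hbefore, Finset.mem_filter, Finset.mem_univ, true_and]
    rcases lt_trichotomy |v j| |v l| with h | h | h
    · exact Or.inl (Or.inl h)
    · rcases lt_or_gt_of_ne hjl with h' | h'
      · exact Or.inr (Or.inr ⟨h.symm, h'⟩)
      · exact Or.inl (Or.inr ⟨h, h'⟩)
    · exact Or.inr (Or.inl h)
  have hinj : Function.Injective fun j => (before j).card := by
    intro j l h
    by_contra hjl
    rcases htot j l hjl with h' | h'
    · exact (hlt _ _ h').ne h.symm
    · exact (hlt _ _ h').ne h
  have hd : ∀ j, (before j).card < d := fun j => by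
    have := Finset.card_lt_univ_of_notMem (hself j)
    simpa using this
  set S : Finset (Fin d) := Finset.univ.filter fun j => (before j).card < s with hS
  have hmem : ∀ j, j ∈ S ↔ (before j).card < s := fun j => by simp [hS]
  refine ⟨S, ?_, ?_, ?_, ?_⟩
  · have := Finset.card_le_card_of_injOn (s := S) (t := Finset.range s)
      (fun j => (before j).card) (fun j hj => by simpa using (hmem j).1 hj) hinj.injOn
    simpa using this
  · intro j
    simp only [hmem]
    simp only [trunc, hbefore]
  · intro j hj l hl
    by_contra h
    have h1 : l ∈ before j := by simp [hbefore, not_le.1 h]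
    exact hl ((hmem l).2 ((hlt _ _ h1).trans ((hmem j).1 hj)))
  · by_cases hsd : s ≤ d
    · right
      have hinj' : Function.Injective fun j => (⟨(before j).card, hd j⟩ : Fin d) := by
        intro j l h
        exact hinj (by simpa using h)
      have hsurj := Finite.surjective_of_injective hinj'
      refine le_antisymm ?_ ?_
      · have := Finset.card_le_card_of_injOn (s := S) (t := Finset.range s)
          (fun j => (before j).card) (fun j hj => by simpa using (hmem j).1 hj) hinj.injOn
        simpa using this
      · have : Finset.range s ⊆ S.image fun j => (before j).card := by
          intro i hi
          have hi' : i < s := Finset.mem_range.1 hi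
          obtain ⟨j, hj⟩ := hsurj ⟨i, hi'.trans_le hsd⟩
          have hj' : (before j).card = i := by simpa using hj
          exact Finset.mem_image.2 ⟨j, (hmem j).2 (hj' ▸ hi'), hj'⟩
        calc s = (Finset.range s).card := by simp
          _ ≤ _ := Finset.card_le_card this
          _ ≤ _ := Finset.card_image_le
    · left
      ext j
      simp only [hmem, Finset.mem_univ, iff_true]
      exact (hd j).trans (not_le.1 hsd)

lemma norm_toLp_ite {d : ℕ} (I : Finset (Fin d)) (v : Fin d → ℝ) :
    ‖(WithLp.toLp 2 fun j => if j ∈ I then v j else 0 : Vec d)‖ = √(∑ j ∈ I, v j ^ 2) := by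
  rw [EuclideanSpace.norm_eq]
  congr 1
  simp only [Real.norm_eq_abs, sq_abs, ite_pow, ne_eq, OfNat.ofNat_ne_zero, not_false_eq_true,
    zero_pow, Finset.sum_ite_mem, Finset.univ_inter]

/-- Truncation to `s ≥ k` coordinates is nearly a projection onto the `k`-sparse vectors. -/
lemma norm_trunc_sub_le {d : ℕ} {s k : ℕ} (hs : 0 < s) (hks : k ≤ s) (v θ : Vec d)
    (hθ : l0 θ ≤ k) :
    ∃ I : Finset (Fin d), I.card ≤ s + k ∧
      ‖trunc s v - θ‖ ≤ (1 + √((k : ℝ) / s)) * √(∑ j ∈ I, (v j - θ j) ^ 2) := by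
  classical
  obtain ⟨S, hS, htr, hle, hcard⟩ := trunc_spec s v
  set R : Finset (Fin d) := Finset.univ.filter fun j => θ j ≠ 0 with hR
  have hRk : R.card ≤ k := by
    refine le_trans (le_of_eq ?_) hθ
    rw [hR, l0]
  have hθR : ∀ j ∉ R, θ j = 0 := fun j hj => by simpa [hR] using hj
  refine ⟨S ∪ R, (Finset.card_union_le _ _).trans (add_le_add hS hRk), ?_⟩
  -- The error is that of `v` on the union of the kept set and the support, corrected on the part of
  -- the support that was discarded.
  have hdec : trunc s v - θ =
      (WithLp.toLp 2 fun j => if j ∈ S ∪ R then (v j - θ j) else 0 : Vec d) -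
        (WithLp.toLp 2 fun j => if j ∈ R \ S then v j else 0 : Vec d) := by
    ext j
    simp only [PiLp.sub_apply, htr, Finset.mem_union, Finset.mem_sdiff]
    by_cases h1 : j ∈ S <;> by_cases h2 : j ∈ R <;> simp [h1, h2, hθR]
  -- Each discarded entry is dominated by each kept one. Comparing all pairs bounds the discarded
  -- support energy by the kept energy off the support, with the ratio of the cardinalities.
  have hkey : (s : ℝ) * ∑ j ∈ R \ S, v j ^ 2 ≤ k * ∑ j ∈ S \ R, v j ^ 2 := by
    rcases (R \ S).eq_empty_or_nonempty with h0 | ⟨j0, hj0⟩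
    · rw [h0]; simp only [Finset.sum_empty, mul_zero]; positivity
    have hSs : S.card = s := by
      rcases hcard with h | h
      · exact absurd (h ▸ Finset.mem_univ j0) (Finset.mem_sdiff.1 hj0).2
      · exact h
    have hA : 0 < (R \ S).card := Finset.card_pos.2 ⟨j0, hj0⟩
    have c1 := Finset.card_sdiff_add_card_inter R S
    have c2 := Finset.card_sdiff_add_card_inter S R
    rw [Finset.inter_comm] at c2
    have hdouble : ((S \ R).card : ℝ) * ∑ j ∈ R \ S, v j ^ 2 ≤
        (R \ S).card * ∑ j ∈ S \ R, v j ^ 2 := by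
      have e1 : ((S \ R).card : ℝ) * ∑ j ∈ R \ S, v j ^ 2 =
          ∑ j ∈ R \ S, ∑ l ∈ S \ R, v j ^ 2 := by
        simp [Finset.mul_sum]
      have e2 : ((R \ S).card : ℝ) * ∑ j ∈ S \ R, v j ^ 2 =
          ∑ j ∈ R \ S, ∑ l ∈ S \ R, v l ^ 2 := by simp
      rw [e1, e2]
      refine Finset.sum_le_sum fun j hj => Finset.sum_le_sum fun l hl => ?_
      exact sq_le_sq.2 (hle l (Finset.mem_sdiff.1 hl).1 j (Finset.mem_sdiff.1 hj).2)
    -- With m common elements the ratio is at most (k - m)/(s - m) ≤ k/s, as k ≤ s.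
    have hcnt : (s : ℝ) * (R \ S).card ≤ k * (S \ R).card := by
      have e1 : ((R \ S).card : ℝ) + (R ∩ S).card = R.card := by exact_mod_cast c1
      have e2 : ((S \ R).card : ℝ) + (R ∩ S).card = s := by rw [← hSs]; exact_mod_cast c2
      have e3 : (R.card : ℝ) ≤ k := by exact_mod_cast hRk
      have e4 : (k : ℝ) ≤ s := by exact_mod_cast hks
      have e5 : (0 : ℝ) ≤ (R ∩ S).card := by positivity
      have e6 : (0 : ℝ) ≤ k := by positivity
      nlinarith [mul_nonneg (sub_nonneg.2 e4) e5, mul_nonneg (sub_nonneg.2 e4) (sub_nonneg.2 e3)]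
    have hX : 0 ≤ ∑ j ∈ R \ S, v j ^ 2 := Finset.sum_nonneg fun _ _ => sq_nonneg _
    have hA' : (0 : ℝ) < (R \ S).card := by exact_mod_cast hA
    refine le_of_mul_le_mul_left ?_ hA'
    calc ((R \ S).card : ℝ) * (s * ∑ j ∈ R \ S, v j ^ 2)
        = (s * (R \ S).card) * ∑ j ∈ R \ S, v j ^ 2 := by ring
      _ ≤ (k * (S \ R).card) * ∑ j ∈ R \ S, v j ^ 2 := by gcongr
      _ = k * ((S \ R).card * ∑ j ∈ R \ S, v j ^ 2) := by ring
      _ ≤ k * ((R \ S).card * ∑ j ∈ S \ R, v j ^ 2) := by gcongr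
      _ = _ := by ring
  have hY : ∑ j ∈ S \ R, v j ^ 2 ≤ ∑ j ∈ S ∪ R, (v j - θ j) ^ 2 := by
    calc ∑ j ∈ S \ R, v j ^ 2 = ∑ j ∈ S \ R, (v j - θ j) ^ 2 := by
          refine Finset.sum_congr rfl fun j hj => ?_
          rw [hθR j (Finset.mem_sdiff.1 hj).2, sub_zero]
      _ ≤ _ := Finset.sum_le_sum_of_subset_of_nonneg
          (Finset.sdiff_subset.trans Finset.subset_union_left) fun _ _ _ => sq_nonneg _
  have hs' : (0 : ℝ) < s := by exact_mod_cast hs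
  have hXY : √(∑ j ∈ R \ S, v j ^ 2) ≤
      √((k : ℝ) / s) * √(∑ j ∈ S ∪ R, (v j - θ j) ^ 2) := by
    rw [← Real.sqrt_mul (by positivity)]
    refine Real.sqrt_le_sqrt ?_
    rw [div_mul_eq_mul_div, le_div_iff₀ hs', mul_comm]
    exact hkey.trans (by gcongr)
  rw [hdec]
  refine (norm_sub_le _ _).trans ?_
  rw [norm_toLp_ite (S ∪ R) (fun j => v j - θ j), norm_toLp_ite]
  linarith

lemma l0_trunc_le {d : ℕ} (s : ℕ) (v : Vec d) : l0 (trunc s v) ≤ s := by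
  classical
  obtain ⟨S, hS, htr, -, -⟩ := trunc_spec s v
  refine le_trans (Finset.card_le_card fun j hj => ?_) hS
  by_contra h
  simp [htr, h] at hj

lemma l0_smul_le {d : ℕ} (c : ℝ) (v : Vec d) : l0 (c • v) ≤ l0 v := by
  classical
  refine Finset.card_le_card fun j hj => ?_
  refine Finset.mem_filter.2 ⟨Finset.mem_univ j, ?_⟩
  exact right_ne_zero_of_mul (Finset.mem_filter.1 hj).2

lemma l0_projBall_le {d : ℕ} (v : Vec d) : l0 (projBall v) ≤ l0 v := by
  rw [projBall]
  split_ifs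
  · exact le_rfl
  · exact l0_smul_le _ _

lemma norm_projBall_le {d : ℕ} (v : Vec d) : ‖projBall v‖ ≤ 2 := by
  rw [projBall]
  split_ifs with h
  · exact h
  · have : 0 < ‖v‖ := by linarith [not_le.1 h]
    rw [norm_smul, norm_div, norm_norm, div_mul_cancel₀ _ this.ne']
    norm_num

lemma norm_projBall_sub_le {d : ℕ} (v θ : Vec d) (hθ : ‖θ‖ ≤ 2) :
    ‖projBall v - θ‖ ≤ ‖v - θ‖ := by
  rw [projBall]
  split_ifs with h
  · exact le_rfl
  · have hv : 2 < ‖v‖ := not_le.1 h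
    have hv0 : ‖v‖ ≠ 0 := by linarith
    refine (sq_le_sq₀ (norm_nonneg _) (norm_nonneg _)).1 ?_
    rw [norm_sub_sq_real, norm_sub_sq_real, norm_smul, real_inner_smul_left, norm_div, norm_norm,
      div_mul_cancel₀ _ hv0, Real.norm_ofNat]
    have h1 := real_inner_le_norm v θ
    have h2 : 2 / ‖v‖ ≤ 1 := by rw [div_le_one (by linarith)]; exact hv.le
    have h3 : inner ℝ v θ ≤ 2 * ‖v‖ := h1.trans (by nlinarith)
    have h4 : (1 - 2 / ‖v‖) * inner ℝ v θ ≤ (1 - 2 / ‖v‖) * (2 * ‖v‖) :=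
      mul_le_mul_of_nonneg_left h3 (by linarith)
    have h5 : (1 - 2 / ‖v‖) * (2 * ‖v‖) = 2 * ‖v‖ - 4 := by field_simp; ring
    -- With the bound on the inner product, what remains is 4‖v‖ - 8 ≤ ‖v‖² - 4.
    nlinarith [sq_nonneg (‖v‖ - 2)]

lemma sum_abs_le_sqrt_l0 {d : ℕ} (θ : Vec d) : ∑ j, |θ j| ≤ √(l0 θ) * ‖θ‖ := by
  classical
  have h1 : ∑ j, |θ j| = ∑ j ∈ Finset.univ.filter (fun j => θ j ≠ 0), |θ j| := by
    rw [Finset.sum_filter_of_ne]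
    intro j _ hj
    simpa using hj
  have h2 := sq_sum_le_card_mul_sum_sq (s := Finset.univ.filter fun j => θ j ≠ 0)
    (f := fun j => |θ j|)
  have h3 : ((Finset.univ.filter fun j => θ j ≠ 0).card : ℝ) = l0 θ := by
    rw [l0]
  rw [← h1, h3] at h2
  have h4 : ∑ j ∈ Finset.univ.filter (fun j => θ j ≠ 0), |θ j| ^ 2 ≤ ‖θ‖ ^ 2 := by
    rw [EuclideanSpace.real_norm_sq_eq]
    simp only [sq_abs]
    exact Finset.sum_le_sum_of_subset_of_nonneg (Finset.subset_univ _) fun _ _ _ => sq_nonneg _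
  refine (sq_le_sq₀ (Finset.sum_nonneg fun _ _ => abs_nonneg _) (by positivity)).1 ?_
  rw [mul_pow, Real.sq_sqrt (by positivity)]
  exact h2.trans (by gcongr)

/-! ### Shrinkage, the range of the gradients and privacy of the protocol -/

lemma abs_shrink_le_abs (τ a : ℝ) (hτ : 0 ≤ τ) : |shrink τ a| ≤ |a| ∧ |shrink τ a| ≤ τ := by
  have h0 : 0 ≤ min |a| τ := le_min (abs_nonneg _) hτ
  have h1 : |Real.sign a| ≤ 1 := by
    rcases Real.sign_apply_eq a with h | h | h <;> simp [h]
  have h2 : |shrink τ a| ≤ min |a| τ := by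
    rw [shrink, abs_mul, abs_of_nonneg h0]
    exact mul_le_of_le_one_left h0 h1
  exact ⟨h2.trans (min_le_left _ _), h2.trans (min_le_right _ _)⟩

lemma abs_inner_le_sum {d : ℕ} (θ x : Vec d) : |inner ℝ θ x| ≤ ∑ j, |θ j| * |x j| := by
  rw [PiLp.inner_apply]
  refine (Finset.abs_sum_le_sum_abs _ _).trans (Finset.sum_le_sum fun j _ => ?_)
  simp [abs_mul, mul_comm]

/-- The inner product is bounded by ℓ¹–ℓ^∞ duality, and sparsity gives ‖θ‖₁ ≤ √k' ‖θ‖₂, so this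
factor costs √k' rather than √d. -/
lemma norm_userGradient_le {d : ℕ} (A : Params d) (hτ₁ : 0 ≤ A.τ₁) (hτ₂ : 0 ≤ A.τ₂)
    (θ : Vec d) (h0 : l0 θ ≤ A.k') (h2 : ‖θ‖ ≤ 2) (p : Vec d × ℝ) :
    ‖userGradient A θ p‖ ≤ radius A := by
  have hx : ‖shrinkVec A.τ₁ p.1‖ ≤ √d * A.τ₁ := by
    rw [EuclideanSpace.norm_eq]
    refine Real.sqrt_le_iff.2 ⟨by positivity, ?_⟩
    rw [mul_pow, Real.sq_sqrt (by positivity)]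
    calc _ ≤ ∑ _j : Fin d, A.τ₁ ^ 2 := by
          refine Finset.sum_le_sum fun j _ => ?_
          exact pow_le_pow_left₀ (norm_nonneg _) (abs_shrink_le_abs A.τ₁ (p.1 j) hτ₁).2 2
      _ = _ := by simp
  have hθ : ∑ j, |θ j| ≤ √A.k' * 2 := by
    refine (sum_abs_le_sqrt_l0 θ).trans ?_
    gcongr
  have hin : |inner ℝ θ (shrinkVec A.τ₁ p.1)| ≤ 2 * √A.k' * A.τ₁ := by
    calc _ ≤ ∑ j, |θ j| * |shrinkVec A.τ₁ p.1 j| := abs_inner_le_sum _ _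
      _ ≤ ∑ j, |θ j| * A.τ₁ := by
          gcongr with j
          exact (abs_shrink_le_abs A.τ₁ (p.1 j) hτ₁).2
      _ = (∑ j, |θ j|) * A.τ₁ := by rw [Finset.sum_mul]
      _ ≤ √A.k' * 2 * A.τ₁ := by gcongr
      _ = _ := by ring
  rw [userGradient, norm_smul, Real.norm_eq_abs, radius]
  calc _ ≤ (2 * √A.k' * A.τ₁ + A.τ₂) * (√d * A.τ₁) := by
        gcongr
        exact (abs_sub _ _).trans (add_le_add hin (abs_shrink_le_abs A.τ₂ p.2 hτ₂).2)
    _ = _ := by ring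

lemma iterate_mem {d : ℕ} (n : ℕ) (A : Params d) (h0 : l0 A.θ₀ ≤ A.k') (h2 : ‖A.θ₀‖ ≤ 2)
    (z : ℕ → Vec d) (t : ℕ) : l0 (iterate n A z t) ≤ A.k' ∧ ‖iterate n A z t‖ ≤ 2 := by
  cases t with
  | zero => exact ⟨h0, h2⟩
  | succ t => exact ⟨(l0_projBall_le _).trans (l0_trunc_le _ _), norm_projBall_le _⟩

lemma norm_sentGradient_le {d : ℕ} (n : ℕ) (A : Params d) (hτ₁ : 0 ≤ A.τ₁) (hτ₂ : 0 ≤ A.τ₂)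
    (h0 : l0 A.θ₀ ≤ A.k') (h2 : ‖A.θ₀‖ ≤ 2) (i : ℕ) (q : (Vec d × ℝ) × (Fin i → Vec d)) :
    ‖sentGradient n A i q‖ ≤ radius A := by
  obtain ⟨h3, h4⟩ := iterate_mem n A h0 h2 (padZero q.2) (groupOf n A.T i)
  exact norm_userGradient_le A hτ₁ hτ₂ _ h3 h4 _

lemma isMarkovKernel_protocol {d : ℕ} (hd : 0 < d) (n : ℕ) (A : Params d) (i : Fin n) :
    IsMarkovKernel (protocol n A i) := by
  have := isMarkovKernel_randomizer hd A.ε (radius A)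
  unfold protocol
  infer_instance

/-- Datum and earlier messages enter only through the input of the randomizer, whose privacy holds
for every pair of inputs. -/
lemma isSeqLDP_protocol {d : ℕ} (hd : 0 < d) (n : ℕ) (A : Params d) (hε : 0 < A.ε) :
    IsSeqLDP A.ε (protocol n A) := by
  refine ⟨isMarkovKernel_protocol hd n A, fun i z x x' S hS => ?_⟩
  simp only [protocol, Kernel.comap_apply]
  exact randomizer_privacy hd hε _ _ _ hS

/-! ### The law of the messages for i.i.d. data -/

section MessageLaw

variable {X Z : Type*} [MeasurableSpace X] [MeasurableSpace Z] {n : ℕ}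

lemma isMarkovKernel_transcriptUpTo (Q : Protocol X Z n) (hQ : ∀ i, IsMarkovKernel (Q i)) (m : ℕ)
    (h : m ≤ n) : IsMarkovKernel (transcriptUpTo Q m h) := by
  induction m with
  | zero => rw [transcriptUpTo]; infer_instance
  | succ m ih =>
    have := ih (Nat.le_of_succ_le h)
    have := hQ ⟨m, h⟩
    rw [transcriptUpTo]
    exact Kernel.IsMarkovKernel.map _ (measurable_finSnoc m)

lemma lintegral_transcriptUpTo_succ (Q : Protocol X Z n) (hQ : ∀ i, IsMarkovKernel (Q i)) (m : ℕ)
    (h : m + 1 ≤ n) (x : Fin n → X) {F : (Fin (m + 1) → Z) → ℝ≥0∞} (hF : Measurable F) :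
    ∫⁻ z, F z ∂(transcriptUpTo Q (m + 1) h x) =
      ∫⁻ z, ∫⁻ w, F (Fin.snoc z w) ∂(Q ⟨m, h⟩ (x ⟨m, h⟩, z))
        ∂(transcriptUpTo Q m (Nat.le_of_succ_le h) x) := by
  have := isMarkovKernel_transcriptUpTo Q hQ m (Nat.le_of_succ_le h)
  have := hQ ⟨m, h⟩
  rw [transcriptUpTo, Kernel.lintegral_map _ (measurable_finSnoc m) _ hF,
    Kernel.lintegral_compProd _ _ _ (f := fun p => F (Fin.snoc p.1 p.2))
      (hF.comp (measurable_finSnoc m))]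
  simp only [Kernel.comap_apply]

/-- The first `m` messages ignore the data of later users; this is what makes the datum of user `m`
fresh. -/
lemma transcriptUpTo_congr (Q : Protocol X Z n) (hQ : ∀ i, IsMarkovKernel (Q i)) (m : ℕ)
    (h : m ≤ n) (x x' : Fin n → X) (hx : ∀ i : Fin n, (i : ℕ) < m → x i = x' i) :
    transcriptUpTo Q m h x = transcriptUpTo Q m h x' := by
  induction m with
  | zero => simp [transcriptUpTo]
  | succ m ih =>
    refine Measure.ext_of_lintegral _ fun F hF => ?_
    rw [lintegral_transcriptUpTo_succ Q hQ m h x hF, lintegral_transcriptUpTo_succ Q hQ m h x' hF,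
      ih (Nat.le_of_succ_le h) fun i hi => hx i (Nat.lt_succ_of_lt hi),
      hx ⟨m, h⟩ (Nat.lt_succ_self m)]

/-- Resampling one coordinate preserves a product law. -/
lemma lintegral_pi_eq_lintegral_update {ι : Type*} [Fintype ι] [DecidableEq ι] (P : Measure X)
    [IsProbabilityMeasure P] (i : ι) {f : (ι → X) → ℝ≥0∞} (hf : Measurable f) :
    ∫⁻ x, f x ∂(Measure.pi fun _ => P) =
      ∫⁻ x, ∫⁻ y, f (Function.update x i y) ∂P ∂(Measure.pi fun _ => P) := by
  have h2 : (fun x => ∫⁻ y, f (Function.update x i y) ∂P) = ∫⋯∫⁻_{i}, f ∂fun _ => P := by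
    ext x; rw [lmarginal_singleton]
  have hm : Measurable (fun x => ∫⁻ y, f (Function.update x i y) ∂P) := by
    rw [h2]; exact hf.lmarginal _
  refine lintegral_eq_of_lmarginal_eq {i} hf hm ?_
  rw [← h2]
  ext x
  rw [lmarginal_singleton]
  simp

/-- The law of the first `m` messages for i.i.d. data. -/
noncomputable def messageLaw (Q : Protocol X Z n) (P : Measure X) (m : ℕ) (h : m ≤ n) :
    Measure (Fin m → Z) :=
  (Measure.pi fun _ : Fin n => P).bind (transcriptUpTo Q m h)

lemma isProbabilityMeasure_messageLaw (Q : Protocol X Z n) (hQ : ∀ i, IsMarkovKernel (Q i))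
    (P : Measure X) [IsProbabilityMeasure P] (m : ℕ) (h : m ≤ n) :
    IsProbabilityMeasure (messageLaw Q P m h) := by
  have := isMarkovKernel_transcriptUpTo Q hQ m h
  unfold messageLaw
  infer_instance

/-- Given the earlier messages, the message of the user `m` is drawn from its channel at a fresh
datum. -/
lemma lintegral_messageLaw_succ (Q : Protocol X Z n) (hQ : ∀ i, IsMarkovKernel (Q i))
    (P : Measure X) [IsProbabilityMeasure P] (m : ℕ) (h : m + 1 ≤ n)
    {F : (Fin (m + 1) → Z) → ℝ≥0∞} (hF : Measurable F) :
    ∫⁻ z, F z ∂(messageLaw Q P (m + 1) h) =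
      ∫⁻ z, ∫⁻ y, ∫⁻ w, F (Fin.snoc z w) ∂(Q ⟨m, h⟩ (y, z)) ∂P
        ∂(messageLaw Q P m (Nat.le_of_succ_le h)) := by
  have hm := Nat.le_of_succ_le h
  have := isMarkovKernel_transcriptUpTo Q hQ m hm
  have := isMarkovKernel_transcriptUpTo Q hQ (m + 1) h
  have := hQ ⟨m, h⟩
  have hsn := hF.comp (measurable_finSnoc m)
  have hG : Measurable fun p : X × (Fin m → Z) =>
      ∫⁻ w, F (Fin.snoc p.2 w) ∂(Q ⟨m, h⟩ p) := by
    refine Measurable.lintegral_kernel_prod_right' (κ := Q ⟨m, h⟩)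
      (f := fun p : (X × (Fin m → Z)) × Z => F (Fin.snoc p.1.2 p.2)) ?_
    exact hsn.comp ((measurable_snd.comp measurable_fst).prodMk measurable_snd)
  rw [messageLaw, messageLaw, Measure.lintegral_bind (Kernel.aemeasurable _) hF.aemeasurable,
    Measure.lintegral_bind (Kernel.aemeasurable _) (Measurable.aemeasurable ?_)]
  swap
  · exact Measurable.lintegral_prod_left' (f := fun p : X × (Fin m → Z) =>
      ∫⁻ w, F (Fin.snoc p.2 w) ∂(Q ⟨m, h⟩ p)) hG
  -- The datum of user `m` is resampled; the earlier messages do not notice the change.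
  rw [lintegral_pi_eq_lintegral_update P ⟨m, h⟩ (Measurable.lintegral_kernel hF)]
  refine lintegral_congr fun x => ?_
  rw [lintegral_lintegral_swap]
  · refine lintegral_congr fun y => ?_
    rw [lintegral_transcriptUpTo_succ Q hQ m h _ hF, transcriptUpTo_congr Q hQ m hm
      (Function.update x ⟨m, h⟩ y) x, Function.update_self]
    intro i hi
    rw [Function.update_of_ne]
    rintro rfl
    exact lt_irrefl _ hi
  · exact (hG.comp measurable_swap).aemeasurable

end MessageLaw

section Concentration

/-! ### Concentration of the averaged messages -/

/-- The mean of the gradient that is sent at the parameter `θ`. -/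
noncomputable def meanGradient {d : ℕ} (A : Params d) (P : Measure (Vec d × ℝ)) (θ : Vec d) :
    Vec d :=
  WithLp.toLp 2 fun j => ∫ p, userGradient A θ p j ∂P

lemma measurable_userGradient {d : ℕ} (A : Params d) :
    Measurable fun q : Vec d × (Vec d × ℝ) => userGradient A q.1 q.2 := by
  have h2 : Measurable fun q : Vec d × (Vec d × ℝ) => shrinkVec A.τ₁ q.2.1 :=
    (measurable_shrinkVec _).comp (measurable_fst.comp measurable_snd)
  have h3 : Measurable fun q : Vec d × (Vec d × ℝ) => shrink A.τ₂ q.2.2 :=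
    (measurable_shrink _).comp (measurable_snd.comp measurable_snd)
  exact ((measurable_fst.inner h2).sub h3).smul h2

lemma measurable_userGradient_right {d : ℕ} (A : Params d) (θ : Vec d) :
    Measurable fun p : Vec d × ℝ => userGradient A θ p := by
  have h2 : Measurable fun p : Vec d × ℝ => shrinkVec A.τ₁ p.1 :=
    (measurable_shrinkVec _).comp measurable_fst
  have h3 : Measurable fun p : Vec d × ℝ => shrink A.τ₂ p.2 :=
    (measurable_shrink _).comp measurable_snd
  exact ((measurable_const.inner h2).sub h3).smul h2

lemma measurable_meanGradient {d : ℕ} (A : Params d) (P : Measure (Vec d × ℝ))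
    [IsProbabilityMeasure P] (j : Fin d) : Measurable fun θ => meanGradient A P θ j := by
  have hc : Measurable fun v : Vec d => v j := by fun_prop
  have h : Measurable fun q : Vec d × (Vec d × ℝ) => userGradient A q.1 q.2 j :=
    hc.comp (measurable_userGradient A)
  exact (h.stronglyMeasurable.integral_prod_right (ν := P)).measurable

/-- For `t < A.T` the groups before `t` are ordinary blocks ending at t⌊n/T⌋; the last group with
its remainder is not among them. -/
lemma iterate_congr {d : ℕ} (n : ℕ) (A : Params d) {z z' : ℕ → Vec d} {t : ℕ} (ht : t < A.T)
    (h : ∀ i < t * (n / A.T), z i = z' i) : iterate n A z t = iterate n A z' t := by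
  induction t with
  | zero => rfl
  | succ t ih =>
    have h1 : ∀ i ∈ group n A.T t, z i = z' i := by
      intro i hi
      rw [group, if_neg ht.ne, Finset.mem_Ico] at hi
      exact h i hi.2
    have h2 : iterate n A z t = iterate n A z' t := by
      refine ih (by omega) fun i hi => h i (hi.trans_le ?_)
      gcongr; omega
    simp only [iterate, h2, Finset.sum_congr rfl h1]

lemma groupOf_eq {n T t i : ℕ} (ht : t < T) (hi : i ∈ group n T t) : groupOf n T i = t := by
  rw [group, Finset.mem_Ico] at hi
  obtain ⟨h1, h2⟩ := hi
  unfold groupOf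
  split_ifs with hq
  · rw [hq] at h1 h2
    split_ifs at h2 with h3
    · omega
    · omega
  · have hq' : 0 < n / T := Nat.pos_of_ne_zero hq
    have h4 : t ≤ i / (n / T) := (Nat.le_div_iff_mul_le hq').2 h1
    split_ifs at h2 with h3
    · omega
    · have h5 : i / (n / T) < t + 1 := (Nat.div_lt_iff_lt_mul hq').2 h2
      omega

lemma padZero_snoc {d m : ℕ} (z : Fin m → Vec d) (w : Vec d) :
    (∀ i < m, padZero (Fin.snoc z w : Fin (m + 1) → Vec d) i = padZero z i) ∧
      padZero (Fin.snoc z w : Fin (m + 1) → Vec d) m = w := by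
  constructor
  · intro i hi
    rw [padZero, padZero, dif_pos hi, dif_pos (hi.trans (Nat.lt_succ_self m))]
    simp [Fin.snoc, hi]
  · rw [padZero, dif_pos (Nat.lt_succ_self m)]
    simp [Fin.snoc]

/-- The centred sum of the coordinate `j` of the messages of the users `i < m` in the group `t`. -/
noncomputable def deviation {d : ℕ} (n : ℕ) (A : Params d) (P : Measure (Vec d × ℝ)) (t : ℕ)
    (j : Fin d) (m : ℕ) (z : ℕ → Vec d) : ℝ :=
  ∑ i ∈ (group n A.T t).filter (· < m), (z i j - meanGradient A P (iterate n A z t) j)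

lemma measurable_deviation {d : ℕ} (n : ℕ) (A : Params d) (P : Measure (Vec d × ℝ))
    [IsProbabilityMeasure P] (t : ℕ) (j : Fin d) (m : ℕ) :
    Measurable (deviation n A P t j m) := by
  refine Finset.measurable_sum _ fun i _ => Measurable.sub ?_ ?_
  · have : Measurable fun z : ℕ → Vec d => z i := measurable_pi_apply i
    fun_prop
  · exact (measurable_meanGradient A P j).comp (measurable_iterate n A t)

variable {d : ℕ} {n : ℕ} {A : Params d} {P : Measure (Vec d × ℝ)}

/-- A new message adds one martingale increment. The centring is unchanged: a user of group `t` has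
index at least t⌊n/T⌋, so its message cannot influence the iterate `t`. -/
lemma deviation_snoc {t : ℕ} (ht : t < A.T) (j : Fin d) {m : ℕ} (z : Fin m → Vec d) (w : Vec d) :
    deviation n A P t j (m + 1) (padZero (Fin.snoc z w : Fin (m + 1) → Vec d)) =
      deviation n A P t j m (padZero z) +
        if m ∈ group n A.T t then w j - meanGradient A P (iterate n A (padZero z) t) j else 0 := by
  obtain ⟨h1, h2⟩ := padZero_snoc z w
  have hit : t * (n / A.T) ≤ m → iterate n A (padZero (Fin.snoc z w : Fin (m + 1) → Vec d)) t =
      iterate n A (padZero z) t := fun h =>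
    iterate_congr n A ht fun i hi => h1 i (hi.trans_le h)
  have hold : ∑ i ∈ (group n A.T t).filter (· < m),
      (padZero (Fin.snoc z w : Fin (m + 1) → Vec d) i j -
        meanGradient A P (iterate n A (padZero (Fin.snoc z w : Fin (m + 1) → Vec d)) t) j) =
      deviation n A P t j m (padZero z) := by
    refine Finset.sum_congr rfl fun i hi => ?_
    obtain ⟨hi1, hi2⟩ := Finset.mem_filter.1 hi
    have h3 : t * (n / A.T) ≤ i := (Finset.mem_Ico.1 hi1).1
    rw [h1 i hi2, hit (h3.trans hi2.le)]
  unfold deviation at hold ⊢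
  split_ifs with hm
  · have h3 : t * (n / A.T) ≤ m := (Finset.mem_Ico.1 hm).1
    have hins : (group n A.T t).filter (· < m + 1) =
        insert m ((group n A.T t).filter (· < m)) := by
      ext i
      simp only [Finset.mem_filter, Finset.mem_insert, Nat.lt_succ_iff_lt_or_eq]
      constructor
      · rintro ⟨hi, hi' | hi'⟩
        · exact Or.inr ⟨hi, hi'⟩
        · exact Or.inl hi'
      · rintro (hi | ⟨hi, hi'⟩)
        · exact ⟨hi ▸ hm, Or.inr hi⟩
        · exact ⟨hi, Or.inl hi'⟩
    rw [hins, Finset.sum_insert (by simp), hold, h2, hit h3, add_comm]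
  · have hins : (group n A.T t).filter (· < m + 1) = (group n A.T t).filter (· < m) := by
      refine Finset.filter_congr fun i hi => ?_
      have : i ≠ m := fun h => hm (h ▸ hi)
      omega
    rw [hins, hold, add_zero]

lemma card_group_filter_succ (n T t m : ℕ) :
    ((group n T t).filter (· < m + 1)).card =
      ((group n T t).filter (· < m)).card + if m ∈ group n T t then 1 else 0 := by
  simp_rw [Finset.card_filter]
  rw [← Finset.sum_ite_eq' (group n T t) m (fun _ => 1), ← Finset.sum_add_distrib]
  refine Finset.sum_congr rfl fun i _ => ?_
  split_ifs <;> omega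

variable [IsProbabilityMeasure P]

lemma integrable_userGradient (hτ₁ : 0 ≤ A.τ₁) (hτ₂ : 0 ≤ A.τ₂) {θ : Vec d}
    (h0 : l0 θ ≤ A.k') (h2 : ‖θ‖ ≤ 2) (j : Fin d) :
    Integrable (fun p => userGradient A θ p j) P := by
  have hc : Measurable fun v : Vec d => v j := by fun_prop
  have hm : Measurable fun p => userGradient A θ p j :=
    hc.comp (measurable_userGradient_right A θ)
  exact Integrable.of_bound hm.aestronglyMeasurable (radius A)
    (Filter.Eventually.of_forall fun p =>
      (abs_coord_le_norm _ j).trans (norm_userGradient_le A hτ₁ hτ₂ θ h0 h2 p))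

/-- Exponential moments of one centred message at a fresh datum. -/
lemma lintegral_exp_message_le (hε : 0 < A.ε) (hr : 0 < radius A) (hτ₁ : 0 ≤ A.τ₁)
    (hτ₂ : 0 ≤ A.τ₂) {θ : Vec d} (h0 : l0 θ ≤ A.k') (h2 : ‖θ‖ ≤ 2) (j : Fin d) {s : ℝ}
    (hs : (s * outputScale d A.ε (radius A)) ^ 2 ≤ d / 4) :
    ∫⁻ p, ∫⁻ w, ENNReal.ofReal (exp (s * (w j - meanGradient A P θ j)))
        ∂(randomizer d A.ε (radius A) (userGradient A θ p)) ∂P ≤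
      ENNReal.ofReal (exp (4 * (s * outputScale d A.ε (radius A)) ^ 2 / d)) := by
  set g := meanGradient A P θ j with hg
  set c := 4 * (s * outputScale d A.ε (radius A)) ^ 2 / d with hc
  have hI := integrable_userGradient (P := P) hτ₁ hτ₂ h0 h2 j
  have hI1 : Integrable (fun p => 1 + s * userGradient A θ p j) P :=
    (integrable_const 1).add (hI.const_mul s)
  have hI' : Integrable (fun p => 1 + s * userGradient A θ p j + c) P :=
    hI1.add (integrable_const c)
  have hstep : ∀ p, 0 ≤ 1 + s * userGradient A θ p j + c ∧
      ∫⁻ w, ENNReal.ofReal (exp (s * w j))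
        ∂(randomizer d A.ε (radius A) (userGradient A θ p)) ≤
      ENNReal.ofReal (1 + s * userGradient A θ p j + c) := fun p =>
    lintegral_exp_randomizer_le j hε hr (norm_userGradient_le A hτ₁ hτ₂ θ h0 h2 p) hs
  calc _ = ∫⁻ p, ENNReal.ofReal (exp (-(s * g))) * ∫⁻ w, ENNReal.ofReal (exp (s * w j))
        ∂(randomizer d A.ε (radius A) (userGradient A θ p)) ∂P := by
        refine lintegral_congr fun p => ?_
        rw [← lintegral_const_mul' _ _ ENNReal.ofReal_ne_top]
        refine lintegral_congr fun w => ?_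
        rw [← ENNReal.ofReal_mul (exp_pos _).le, ← exp_add]
        congr 2; ring
    -- This bound is affine in the user gradient, so averaging over the datum merely replaces the
    -- gradient by its mean; the data need no separate concentration estimate.
    _ ≤ ∫⁻ p, ENNReal.ofReal (exp (-(s * g))) *
          ENNReal.ofReal (1 + s * userGradient A θ p j + c) ∂P := by
        gcongr with p
        exact (hstep p).2
    _ = ENNReal.ofReal (exp (-(s * g)) * (1 + s * g + c)) := by
        rw [lintegral_const_mul' _ _ ENNReal.ofReal_ne_top,
          ← ofReal_integral_eq_lintegral_ofReal hI'
            (Filter.Eventually.of_forall fun p => (hstep p).1),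
          ← ENNReal.ofReal_mul (exp_pos _).le]
        congr 2
        rw [integral_add hI1 (integrable_const c),
          integral_add (integrable_const 1) (hI.const_mul s), integral_const_mul]
        simp [hg, meanGradient]
    _ ≤ _ := by
        refine ENNReal.ofReal_le_ofReal ?_
        have h3 : 1 + s * g + c ≤ exp (s * g + c) := by linarith [add_one_le_exp (s * g + c)]
        calc _ ≤ exp (-(s * g)) * exp (s * g + c) := by gcongr
          _ = exp c := by rw [← exp_add]; congr 1; ring

/-- Induction over the users: conditionally on the past, each member of the group multiplies the
exponential moment by at most e^c, and every other user leaves it unchanged. -/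
lemma lintegral_exp_deviation_le (hε : 0 < A.ε) (hr : 0 < radius A) (hτ₁ : 0 ≤ A.τ₁)
    (hτ₂ : 0 ≤ A.τ₂) (h0 : l0 A.θ₀ ≤ A.k') (h2 : ‖A.θ₀‖ ≤ 2) {t : ℕ} (ht : t < A.T) (j : Fin d)
    {s : ℝ} (hs : (s * outputScale d A.ε (radius A)) ^ 2 ≤ d / 4) (m : ℕ) (h : m ≤ n) :
    ∫⁻ z, ENNReal.ofReal (exp (s * deviation n A P t j m (padZero z)))
        ∂(messageLaw (protocol n A) P m h) ≤
      ENNReal.ofReal (exp (((group n A.T t).filter (· < m)).card *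
        (4 * (s * outputScale d A.ε (radius A)) ^ 2 / d))) := by
  have hQ := isMarkovKernel_protocol j.pos n A
  induction m with
  | zero =>
    have := isProbabilityMeasure_messageLaw (protocol n A) hQ P 0 h
    simp [deviation]
  | succ m ih =>
    have hmeas : ∀ m, Measurable fun z : Fin m → Vec d =>
        ENNReal.ofReal (exp (s * deviation n A P t j m (padZero z))) := fun m => by
      have := (measurable_deviation n A P t j m).comp (measurable_padZero (d := d) (m := m))
      simp only [Function.comp_def] at this
      fun_prop
    rw [lintegral_messageLaw_succ _ hQ P m h (hmeas (m + 1))]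
    set c := 4 * (s * outputScale d A.ε (radius A)) ^ 2 / d with hc
    have hstep : ∀ z : Fin m → Vec d, ∫⁻ y, ∫⁻ w, ENNReal.ofReal (exp (s * deviation n A P t j
        (m + 1) (padZero (Fin.snoc z w : Fin (m + 1) → Vec d))))
          ∂(protocol n A ⟨m, h⟩ (y, z)) ∂P ≤
        ENNReal.ofReal (exp (s * deviation n A P t j m (padZero z))) *
          ENNReal.ofReal (exp ((if m ∈ group n A.T t then 1 else 0 : ℕ) * c)) := by
      intro z
      have e : ∀ w : Vec d, ENNReal.ofReal (exp (s * deviation n A P t j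
          (m + 1) (padZero (Fin.snoc z w : Fin (m + 1) → Vec d)))) =
          ENNReal.ofReal (exp (s * deviation n A P t j m (padZero z))) *
          ENNReal.ofReal (exp (s * if m ∈ group n A.T t then
            w j - meanGradient A P (iterate n A (padZero z) t) j else 0)) := by
        intro w
        rw [deviation_snoc ht, ← ENNReal.ofReal_mul (exp_pos _).le, ← exp_add, mul_add]
      simp_rw [e, lintegral_const_mul' _ _ ENNReal.ofReal_ne_top]
      gcongr
      by_cases hm : m ∈ group n A.T t
      · simp only [hm, if_true, Nat.cast_one, one_mul]
        obtain ⟨h3, h4⟩ := iterate_mem n A h0 h2 (padZero z) t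
        refine le_trans (le_of_eq ?_) (lintegral_exp_message_le (P := P) hε hr hτ₁ hτ₂ h3 h4 j hs)
        refine lintegral_congr fun y => ?_
        simp only [protocol, Kernel.comap_apply, sentGradient, groupOf_eq ht hm]
      · simp [hm]
    refine (lintegral_mono hstep).trans ?_
    rw [lintegral_mul_const' _ _ ENNReal.ofReal_ne_top, card_group_filter_succ, Nat.cast_add,
      add_mul, exp_add, ENNReal.ofReal_mul (exp_pos _).le]
    gcongr
    exact ih (Nat.le_of_succ_le h)

lemma group_filter_lt_of_lt {n T t : ℕ} (ht : t < T) :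
    (group n T t).filter (· < n) = group n T t := by
  refine Finset.filter_true_of_mem fun i hi => ?_
  rw [group, Finset.mem_Ico] at hi
  have h2 := hi.2
  split_ifs at h2 with h3
  · exact h2
  · refine h2.trans_le ((Nat.mul_le_mul_right _ ht).trans (Nat.mul_div_le n T))

/-- Chernoff bound for one group and one coordinate. -/
lemma messageLaw_deviation_le (hε : 0 < A.ε) (hr : 0 < radius A) (hτ₁ : 0 ≤ A.τ₁)
    (hτ₂ : 0 ≤ A.τ₂) (h0 : l0 A.θ₀ ≤ A.k') (h2 : ‖A.θ₀‖ ≤ 2) {t : ℕ} (ht : t < A.T) (j : Fin d)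
    {b : ℝ} (hb0 : 0 ≤ b) (hb : b ≤ 1 / 2) :
    messageLaw (protocol n A) P n le_rfl
        {z | (group n A.T t).card * (8 * b * outputScale d A.ε (radius A) / √d) ≤
          |deviation n A P t j n (padZero z)|} ≤
      ENNReal.ofReal (2 * exp (-(4 * b ^ 2 * (group n A.T t).card))) := by
  have hd : 0 < d := j.pos
  have hdpos : (0 : ℝ) < d := by exact_mod_cast hd
  have hsd : 0 < √(d : ℝ) := Real.sqrt_pos.2 hdpos
  have hsd2 : √(d : ℝ) ^ 2 = d := Real.sq_sqrt hdpos.le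
  have hB := outputScale_pos hd hε hr
  set B := outputScale d A.ε (radius A) with hBdef
  set N : ℝ := ((group n A.T t).card : ℝ) with hN
  set M := messageLaw (protocol n A) P n le_rfl
  -- The choice s = ±b√d/B turns the cost per user into 4b²; the threshold 8b² then leaves the
  -- exponent -4b². The requirement (sB)² ≤ d/4 is b ≤ 1/2.
  have hone : ∀ s : ℝ, (s = b * √d / B ∨ s = -(b * √d / B)) →
      M {z | N * (8 * b ^ 2) ≤ s * deviation n A P t j n (padZero z)} ≤
        ENNReal.ofReal (exp (-(4 * b ^ 2 * N))) := by
    intro s hs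
    have hsB : (s * B) ^ 2 = b ^ 2 * d := by
      rcases hs with rfl | rfl
      · rw [div_mul_cancel₀ _ hB.ne', mul_pow, hsd2]
      · rw [neg_mul, neg_sq, div_mul_cancel₀ _ hB.ne', mul_pow, hsd2]
    have hmgf := lintegral_exp_deviation_le (n := n) (P := P) hε hr hτ₁ hτ₂ h0 h2 ht j (s := s)
      (by
        have h3 : b ^ 2 ≤ 1 / 4 := by nlinarith
        have h4 := mul_le_mul_of_nonneg_right h3 hdpos.le
        rw [← hBdef, hsB]; linarith) n le_rfl
    rw [group_filter_lt_of_lt ht, ← hBdef, hsB, ← hN] at hmgf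
    have e1 : 4 * (b ^ 2 * d) / d = 4 * b ^ 2 := by field_simp
    rw [e1] at hmgf
    have hmeas : Measurable fun z : Fin n → Vec d =>
        ENNReal.ofReal (exp (s * deviation n A P t j n (padZero z))) := by
      have := (measurable_deviation n A P t j n).comp (measurable_padZero (d := d) (m := n))
      simp only [Function.comp_def] at this
      fun_prop
    have hmk := meas_ge_le_lintegral_div (μ := M) hmeas.aemeasurable
      (ε := ENNReal.ofReal (exp (N * (8 * b ^ 2)))) (by simp [exp_pos])
      ENNReal.ofReal_ne_top
    have hset : {z : Fin n → Vec d | N * (8 * b ^ 2) ≤ s * deviation n A P t j n (padZero z)} =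
        {z | ENNReal.ofReal (exp (N * (8 * b ^ 2))) ≤
          ENNReal.ofReal (exp (s * deviation n A P t j n (padZero z)))} := by
      ext z
      simp only [Set.mem_ofPred_eq]
      rw [ENNReal.ofReal_le_ofReal_iff (exp_pos _).le, exp_le_exp]
    rw [hset]
    refine hmk.trans ((ENNReal.div_le_div_right hmgf _).trans (le_of_eq ?_))
    rw [← ENNReal.ofReal_div_of_pos (exp_pos _), ← exp_sub]
    congr 2; ring
  have hsub : {z : Fin n → Vec d | N * (8 * b * B / √d) ≤
        |deviation n A P t j n (padZero z)|} ⊆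
      {z | N * (8 * b ^ 2) ≤ b * √d / B * deviation n A P t j n (padZero z)} ∪
      {z | N * (8 * b ^ 2) ≤ -(b * √d / B) * deviation n A P t j n (padZero z)} := by
    intro z hz
    have hz' : N * (8 * b * B / √d) ≤ |deviation n A P t j n (padZero z)| := hz
    have hc : 0 ≤ b * √d / B := by positivity
    have h3 := mul_le_mul_of_nonneg_left hz' hc
    have e2 : b * √d / B * (N * (8 * b * B / √d)) = N * (8 * b ^ 2) := by field_simp
    rw [e2] at h3
    rcases abs_cases (deviation n A P t j n (padZero z)) with ⟨h4, -⟩ | ⟨h4, -⟩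
    · left; rw [h4] at h3; exact h3
    · right; rw [h4] at h3
      show N * (8 * b ^ 2) ≤ -(b * √d / B) * deviation n A P t j n (padZero z)
      linarith
  calc M _ ≤ _ := measure_mono hsub
    _ ≤ _ := measure_union_le _ _
    _ ≤ ENNReal.ofReal (exp (-(4 * b ^ 2 * N))) + ENNReal.ofReal (exp (-(4 * b ^ 2 * N))) :=
        add_le_add (hone _ (Or.inl rfl)) (hone _ (Or.inr rfl))
    _ = _ := by rw [← ENNReal.ofReal_add (exp_pos _).le (exp_pos _).le, ← two_mul]

/-- The average of the messages of the group `t`. -/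
noncomputable def groupMean (n : ℕ) (A : Params d) (z : ℕ → Vec d) (t : ℕ) : Vec d :=
  ((group n A.T t).card : ℝ)⁻¹ • ∑ i ∈ group n A.T t, z i

/-- All group averages are uniformly close to the mean gradients, with high probability. -/
lemma messageLaw_forall_close (hd : 0 < d) (hT : 0 < A.T) (hε : 0 < A.ε) (hr : 0 < radius A)
    (hτ₁ : 0 ≤ A.τ₁) (hτ₂ : 0 ≤ A.τ₂) (h0 : l0 A.θ₀ ≤ A.k') (h2 : ‖A.θ₀‖ ≤ 2) {δ N₀ : ℝ}
    (hδ : 0 < δ) (hδ1 : δ < 1) (hN₀ : 0 < N₀) (hN : ∀ t < A.T, N₀ ≤ (group n A.T t).card)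
    (hlog : log (2 * d * A.T / δ) ≤ N₀) :
    ENNReal.ofReal (1 - δ) ≤ messageLaw (protocol n A) P n le_rfl
      {z | ∀ t < A.T, ∀ j, |groupMean n A (padZero z) t j -
        meanGradient A P (iterate n A (padZero z) t) j| ≤
          4 * outputScale d A.ε (radius A) / √d * √(log (2 * d * A.T / δ) / N₀)} := by
  have hdpos : (0 : ℝ) < d := by exact_mod_cast hd
  have hTpos : (0 : ℝ) < A.T := by exact_mod_cast hT
  have hQ := isMarkovKernel_protocol hd n A
  have := isProbabilityMeasure_messageLaw (protocol n A) hQ P n le_rfl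
  set M := messageLaw (protocol n A) P n le_rfl
  set B := outputScale d A.ε (radius A) with hBdef
  set L := log (2 * d * A.T / δ) with hL
  have hL0 : 0 ≤ L := by
    refine log_nonneg ?_
    rw [one_le_div hδ]
    have h1 : (1 : ℝ) ≤ d := by exact_mod_cast hd
    have h2 : (1 : ℝ) ≤ A.T := by exact_mod_cast hT
    nlinarith
  -- Chosen so that 4b²N₀ = L, which makes each two-sided tail at most δ/(Td); the hypothesis `hlog`
  -- is b ≤ 1/2.
  set b := √(L / N₀) / 2 with hb
  have hb0 : 0 ≤ b := by positivity
  have hb1 : b ≤ 1 / 2 := by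
    have : √(L / N₀) ≤ 1 := by
      rw [Real.sqrt_le_one]
      rwa [div_le_one hN₀]
    linarith
  have hb2 : 4 * b ^ 2 * N₀ = L := by
    rw [hb, div_pow, Real.sq_sqrt (by positivity)]
    field_simp
    ring
  have hexp : 2 * exp (-L) = δ / (A.T * d) := by
    rw [exp_neg, hL, exp_log (by positivity)]
    field_simp
  set bad : ℕ → Fin d → Set (Fin n → Vec d) := fun t j =>
    {z | (group n A.T t).card * (8 * b * B / √d) ≤ |deviation n A P t j n (padZero z)|} with hbad
  have hbadle : ∀ t < A.T, ∀ j, M (bad t j) ≤ ENNReal.ofReal (δ / (A.T * d)) := by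
    intro t ht j
    refine (messageLaw_deviation_le hε hr hτ₁ hτ₂ h0 h2 ht j hb0 hb1).trans
      (ENNReal.ofReal_le_ofReal ?_)
    rw [← hexp]
    gcongr
    rw [← hb2]
    gcongr
    exact hN t ht
  set U : Set (Fin n → Vec d) := ⋃ t ∈ Finset.range A.T, ⋃ j ∈ (Finset.univ : Finset (Fin d)),
    bad t j with hU
  have hUle : M U ≤ ENNReal.ofReal δ := by
    calc M U ≤ ∑ t ∈ Finset.range A.T, M (⋃ j ∈ (Finset.univ : Finset (Fin d)), bad t j) :=
          measure_biUnion_finset_le _ _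
      _ ≤ ∑ t ∈ Finset.range A.T, ∑ j : Fin d, M (bad t j) := by
          gcongr; exact measure_biUnion_finset_le _ _
      _ ≤ ∑ t ∈ Finset.range A.T, ∑ j : Fin d, ENNReal.ofReal (δ / (A.T * d)) :=
          Finset.sum_le_sum fun t ht => Finset.sum_le_sum fun j _ =>
            hbadle t (Finset.mem_range.1 ht) j
      _ = ENNReal.ofReal δ := by
          simp only [Finset.sum_const, Finset.card_univ, Fintype.card_fin, Finset.card_range,
            nsmul_eq_mul]
          rw [← ENNReal.ofReal_natCast, ← ENNReal.ofReal_natCast, ← ENNReal.ofReal_mul hdpos.le,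
            ← ENNReal.ofReal_mul hTpos.le]
          congr 1
          field_simp
  have hcompl : ENNReal.ofReal (1 - δ) ≤ M Uᶜ := by
    -- Subadditivity suffices, so measurability of the bad event is not required.
    have h3 : 1 ≤ M U + M Uᶜ := by
      rw [← measure_univ (μ := M), ← Set.union_compl_self U]
      exact measure_union_le _ _
    rw [ENNReal.ofReal_sub _ hδ.le, ENNReal.ofReal_one, tsub_le_iff_left]
    exact h3.trans (by gcongr)
  refine hcompl.trans (measure_mono fun z hz t ht j => ?_)
  have hz1 : z ∉ bad t j := fun h => hz (by
    simp only [hU, Set.mem_iUnion]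
    exact ⟨t, Finset.mem_range.2 ht, j, Finset.mem_univ j, h⟩)
  have hz2 : |deviation n A P t j n (padZero z)| < (group n A.T t).card * (8 * b * B / √d) :=
    not_le.1 hz1
  have hcard : (0 : ℝ) < (group n A.T t).card := hN₀.trans_le (hN t ht)
  have hdev : deviation n A P t j n (padZero z) = (group n A.T t).card *
      (groupMean n A (padZero z) t j - meanGradient A P (iterate n A (padZero z) t) j) := by
    rw [deviation, group_filter_lt_of_lt ht, Finset.sum_sub_distrib, groupMean, mul_sub]
    simp only [Finset.sum_const, nsmul_eq_mul, PiLp.smul_apply, smul_eq_mul, WithLp.ofLp_sum,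
      Finset.sum_apply]
    rw [mul_inv_cancel_left₀ hcard.ne']
  rw [hdev, abs_mul, abs_of_pos hcard] at hz2
  refine (lt_of_mul_lt_mul_left hz2 hcard.le).le.trans (le_of_eq ?_)
  rw [hb]; ring

end Concentration

section Population

/-! ### The bias of the shrinkage -/

lemma measurable_sub_shrink (τ : ℝ) : Measurable fun a => a - shrink τ a :=
  measurable_id.sub (measurable_shrink τ)

lemma sign_mul_abs_self (a : ℝ) : a.sign * |a| = a := by
  rcases lt_trichotomy a 0 with h | h | h
  · rw [Real.sign_of_neg h, abs_of_neg h]; ring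
  · rw [h, abs_zero, mul_zero]
  · rw [Real.sign_of_pos h, abs_of_pos h, one_mul]

/-- The error is at most (|a| - τ)₊, and u²/2 ≤ e^u for u ≥ 0 turns its square into an exponential
moment. -/
lemma sub_shrink_sq_le {s : ℝ} (hs : 0 < s) (τ a : ℝ) :
    (a - shrink τ a) ^ 2 ≤ 2 / s ^ 2 * exp (-(s * τ)) * (exp (s * a) + exp (-s * a)) := by
  have h1 : |a - shrink τ a| ≤ max (|a| - τ) 0 := by
    unfold shrink
    rcases le_total |a| τ with h | h
    · rw [min_eq_left h, sign_mul_abs_self, sub_self, abs_zero]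
      exact le_max_right _ _
    · rw [min_eq_right h]
      have e : a - a.sign * τ = a.sign * (|a| - τ) := by
        rw [mul_sub, sign_mul_abs_self]
      rw [e, abs_mul]
      have h2 : |a.sign| ≤ 1 := by
        rcases Real.sign_apply_eq a with h | h | h <;> simp [h]
      calc _ ≤ 1 * |(|a| - τ)| := by gcongr
        _ = |a| - τ := by rw [one_mul, abs_of_nonneg (by linarith)]
        _ ≤ _ := le_max_left _ _
  have h2 : (max (|a| - τ) 0) ^ 2 ≤ 2 / s ^ 2 * exp (s * (|a| - τ)) := by
    rcases le_total (|a| - τ) 0 with h | h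
    · rw [max_eq_right h, zero_pow two_ne_zero]; positivity
    · rw [max_eq_left h]
      have := Real.quadratic_le_exp_of_nonneg (x := s * (|a| - τ)) (mul_nonneg hs.le h)
      have h3 : (s * (|a| - τ)) ^ 2 ≤ 2 * exp (s * (|a| - τ)) := by nlinarith [mul_nonneg hs.le h]
      rw [div_mul_eq_mul_div, le_div_iff₀ (by positivity)]
      nlinarith
  have h3 : exp (s * |a|) ≤ exp (s * a) + exp (-s * a) := by
    rcases abs_cases a with ⟨h, -⟩ | ⟨h, -⟩
    · rw [h]; linarith [exp_pos (-s * a)]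
    · rw [h, mul_neg, neg_mul]; linarith [exp_pos (s * a)]
  calc (a - shrink τ a) ^ 2 = |a - shrink τ a| ^ 2 := (sq_abs _).symm
    _ ≤ (max (|a| - τ) 0) ^ 2 := by gcongr
    _ ≤ _ := h2
    _ = 2 / s ^ 2 * exp (-(s * τ)) * exp (s * |a|) := by
        rw [mul_assoc, ← exp_add]; congr 2; ring
    _ ≤ _ := by gcongr

section Subgaussian

variable {Ω : Type*} [MeasurableSpace Ω] {P : Measure Ω} {σ : ℝ≥0} {a b : Ω → ℝ}

lemma integral_sub_shrink_sq_le (ha : HasSubgaussianMGF a (σ ^ 2) P) (hm : Measurable a)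
    {s : ℝ} (hs : 0 < s) (τ : ℝ) :
    Integrable (fun ω => (a ω - shrink τ (a ω)) ^ 2) P ∧
    ∫ ω, (a ω - shrink τ (a ω)) ^ 2 ∂P ≤
      4 / s ^ 2 * exp (-(s * τ) + σ ^ 2 * s ^ 2 / 2) := by
  have I1 := ha.integrable_exp_mul s
  have I2 := ha.integrable_exp_mul (-s)
  have m1 := ha.mgf_le s
  have m2 := ha.mgf_le (-s)
  rw [neg_sq] at m2
  push_cast at m1 m2
  have I3 := (I1.add I2).const_mul (2 / s ^ 2 * exp (-(s * τ)))
  have I4 : Integrable (fun ω => (a ω - shrink τ (a ω)) ^ 2) P := by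
    refine I3.mono' (((measurable_sub_shrink τ).comp hm).pow_const 2).aestronglyMeasurable
      (Filter.Eventually.of_forall fun ω => ?_)
    rw [Real.norm_eq_abs, abs_of_nonneg (sq_nonneg _)]
    exact sub_shrink_sq_le hs τ (a ω)
  refine ⟨I4, (integral_mono I4 I3 fun ω => sub_shrink_sq_le hs τ (a ω)).trans ?_⟩
  simp only [Pi.add_apply]
  rw [integral_const_mul, integral_add I1 I2]
  unfold mgf at m1 m2
  calc _ ≤ 2 / s ^ 2 * exp (-(s * τ)) *
        (exp (σ ^ 2 * s ^ 2 / 2) + exp (σ ^ 2 * s ^ 2 / 2)) := by gcongr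
    _ = _ := by rw [exp_add]; ring

lemma integral_sq_le (ha : HasSubgaussianMGF a (σ ^ 2) P) (hm : Measurable a)
    {s : ℝ} (hs : 0 < s) :
    Integrable (fun ω => a ω ^ 2) P ∧
    ∫ ω, a ω ^ 2 ∂P ≤ 4 / s ^ 2 * exp (σ ^ 2 * s ^ 2 / 2) := by
  have h := integral_sub_shrink_sq_le ha hm hs 0
  have h0 : ∀ x, shrink 0 x = 0 := fun x => by
    rw [shrink, min_eq_right (abs_nonneg x), mul_zero]
  simpa [h0] using h

lemma integrable_mul_of_sq (hma : Measurable a) (hmb : Measurable b)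
    (ha : Integrable (fun ω => a ω ^ 2) P) (hb : Integrable (fun ω => b ω ^ 2) P) :
    Integrable (fun ω => a ω * b ω) P := by
  refine (ha.add hb).mono' (hma.mul hmb).aestronglyMeasurable
    (Filter.Eventually.of_forall fun ω => ?_)
  simp only [Pi.add_apply]
  rw [Real.norm_eq_abs, abs_mul]
  nlinarith [sq_nonneg (|a ω| - |b ω|), sq_abs (a ω), sq_abs (b ω)]

/-- At the shrinkage level `2 σ √(log n)` the effect of the shrinkage is of order `n^(-1/2)`. -/
lemma integral_abs_sub_shrink_mul_le (hσ : 0 < σ) (ha : HasSubgaussianMGF a (σ ^ 2) P)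
    (hb : HasSubgaussianMGF b (σ ^ 2) P) (hma : Measurable a) (hmb : Measurable b) {L τ : ℝ}
    (hL : 1 ≤ L) (hτ : τ = 2 * σ * √L) :
    Integrable (fun ω => |a ω - shrink τ (a ω)| * |b ω|) P ∧
    ∫ ω, |a ω - shrink τ (a ω)| * |b ω| ∂P ≤ 6 * σ ^ 2 * exp (-(L / 2)) := by
  have hσ' : (0 : ℝ) < σ := by exact_mod_cast hσ
  have hL0 : 0 < √L := Real.sqrt_pos.2 (by linarith)
  have hL2 : √L ^ 2 = L := Real.sq_sqrt (by linarith)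
  -- With τ = 2σ√L the exponent -sτ + σ²s²/2 equals -3L/2.
  set s := √L / σ with hs
  have hs0 : 0 < s := by positivity
  obtain ⟨I1, h1⟩ := integral_sub_shrink_sq_le ha hma hs0 τ
  obtain ⟨I2, h2⟩ := integral_sq_le hb hmb (inv_pos.2 hσ')
  have e1 : 4 / s ^ 2 * exp (-(s * τ) + σ ^ 2 * s ^ 2 / 2) =
      4 * σ ^ 2 / L * exp (-(3 * (L / 2))) := by
    have e2 : s ^ 2 = L / σ ^ 2 := by rw [hs, div_pow, hL2]
    have e3 : s * τ = 2 * L := by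
      rw [hs, hτ]
      calc √L / σ * (2 * σ * √L) = 2 * √L ^ 2 := by field_simp
        _ = 2 * L := by rw [hL2]
    rw [e2, e3]
    congr 1
    · field_simp
    · congr 1; field_simp; ring
  rw [e1] at h1
  have e4 : 4 / ((σ : ℝ)⁻¹) ^ 2 * exp (σ ^ 2 * ((σ : ℝ)⁻¹) ^ 2 / 2) =
      4 * σ ^ 2 * exp (1 / 2) := by
    congr 1
    · field_simp
    · congr 1; field_simp
  rw [e4] at h2
  have h3 : exp (1 / 2 : ℝ) ≤ 2 := by
    have h4 : exp (1 / 2 : ℝ) ^ 2 = exp 1 := by rw [← exp_nat_mul]; norm_num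
    have := exp_one_lt_d9
    nlinarith [exp_pos (1 / 2 : ℝ)]
  set ρ := exp (-(L / 2)) with hρ
  have hρ0 : 0 < ρ := exp_pos _
  have e5 : exp (-(3 * (L / 2))) = ρ ^ 3 := by
    rw [hρ, ← exp_nat_mul]; congr 1; push_cast; ring
  have hρ1 : ρ ≤ 1 := exp_le_one_iff.2 (by linarith)
  rw [e5] at h1
  have h5 : ∫ ω, (a ω - shrink τ (a ω)) ^ 2 ∂P ≤ 4 * σ ^ 2 * ρ ^ 2 := by
    refine h1.trans ?_
    have : 4 * (σ : ℝ) ^ 2 / L ≤ 4 * σ ^ 2 := div_le_self (by positivity) hL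
    calc _ ≤ 4 * (σ : ℝ) ^ 2 * ρ ^ 3 := by gcongr
      _ ≤ _ := by
        have : ρ ^ 3 ≤ ρ ^ 2 := pow_le_pow_of_le_one hρ0.le hρ1 (by norm_num)
        gcongr
  have h6 : ∫ ω, b ω ^ 2 ∂P ≤ 8 * σ ^ 2 := by
    refine h2.trans ?_
    nlinarith [sq_nonneg (σ : ℝ)]
  -- Weighted AM–GM with ρ = e^(-L/2): the second moments 4σ²ρ² and 8σ² contribute 2σ²ρ and 4σ²ρ.
  have hpt : ∀ ω, |a ω - shrink τ (a ω)| * |b ω| ≤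
      ρ⁻¹ / 2 * (a ω - shrink τ (a ω)) ^ 2 + ρ / 2 * b ω ^ 2 := by
    intro ω
    have h7 : 0 ≤ ρ⁻¹ / 2 * (|a ω - shrink τ (a ω)| - ρ * |b ω|) ^ 2 := by positivity
    rw [← sq_abs (a ω - shrink τ (a ω)), ← sq_abs (b ω)]
    have e6 : ρ⁻¹ / 2 * (|a ω - shrink τ (a ω)| - ρ * |b ω|) ^ 2 =
        ρ⁻¹ / 2 * |a ω - shrink τ (a ω)| ^ 2 + ρ / 2 * |b ω| ^ 2 -
          |a ω - shrink τ (a ω)| * |b ω| := by field_simp; ring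
    linarith
  have I3 := (I1.const_mul (ρ⁻¹ / 2)).add (I2.const_mul (ρ / 2))
  have I4 : Integrable (fun ω => |a ω - shrink τ (a ω)| * |b ω|) P := by
    refine I3.mono' ?_ (Filter.Eventually.of_forall fun ω => ?_)
    · have := (measurable_sub_shrink τ).comp hma
      exact (this.abs.mul hmb.abs).aestronglyMeasurable
    · rw [Real.norm_eq_abs, abs_of_nonneg (by positivity)]
      exact hpt ω
  refine ⟨I4, (integral_mono I4 I3 hpt).trans ?_⟩
  simp only [Pi.add_apply]
  rw [integral_add (I1.const_mul _) (I2.const_mul _), integral_const_mul, integral_const_mul]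
  calc _ ≤ ρ⁻¹ / 2 * (4 * σ ^ 2 * ρ ^ 2) + ρ / 2 * (8 * σ ^ 2) := by gcongr
    _ = _ := by field_simp; ring

end Subgaussian

/-! ### Moments of the regression model and the population gradient -/

variable {d : ℕ} {P : Measure (Vec d × ℝ)} {θstar : Vec d} {k : ℕ} {σ : ℝ≥0}

lemma IsSparseModel.subgaussian_coord (h : IsSparseModel P θstar k σ) (j : Fin d) :
    HasSubgaussianMGF (fun p => p.1 j) (σ ^ 2) P := by
  have := h.subgaussian_x (EuclideanSpace.single j 1) (by simp)
  simpa [EuclideanSpace.inner_single_right] using this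

lemma measurable_coord_fst (j : Fin d) : Measurable fun p : Vec d × ℝ => p.1 j := by
  have hc : Measurable fun v : Vec d => v j := by fun_prop
  exact hc.comp measurable_fst

lemma IsSparseModel.integrable_coord_mul (h : IsSparseModel P θstar k σ) (i j : Fin d) :
    Integrable (fun p => p.1 i * p.1 j) P :=
  integrable_mul_of_sq (measurable_coord_fst i) (measurable_coord_fst j)
    (integral_sq_le (h.subgaussian_coord i) (measurable_coord_fst i) one_pos).1
    (integral_sq_le (h.subgaussian_coord j) (measurable_coord_fst j) one_pos).1

lemma IsSparseModel.integrable_coord_mul_snd (h : IsSparseModel P θstar k σ) (j : Fin d) :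
    Integrable (fun p => p.1 j * p.2) P :=
  integrable_mul_of_sq (measurable_coord_fst j) measurable_snd
    (integral_sq_le (h.subgaussian_coord j) (measurable_coord_fst j) one_pos).1
    (integral_sq_le h.subgaussian_y measurable_snd one_pos).1

lemma real_inner_eq_sum (θ x : Vec d) : inner ℝ θ x = ∑ l, θ l * x l := by
  rw [PiLp.inner_apply]
  exact Finset.sum_congr rfl fun l _ => by simp [mul_comm]

lemma IsSparseModel.integrable_coord_mul_inner (h : IsSparseModel P θstar k σ) (j : Fin d)
    (θ : Vec d) : Integrable (fun p => p.1 j * inner ℝ θ p.1) P ∧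
    ∫ p, p.1 j * inner ℝ θ p.1 ∂P = (secondMoment P).mulVec θ j := by
  have e : (fun p : Vec d × ℝ => p.1 j * inner ℝ θ p.1) =
      fun p => ∑ l, θ l * (p.1 j * p.1 l) := by
    ext p
    rw [real_inner_eq_sum, Finset.mul_sum]
    exact Finset.sum_congr rfl fun l _ => by ring
  have hI : ∀ l ∈ Finset.univ, Integrable (fun p : Vec d × ℝ => θ l * (p.1 j * p.1 l)) P :=
    fun l _ => (h.integrable_coord_mul j l).const_mul _
  rw [e]
  refine ⟨integrable_finsetSum _ hI, ?_⟩
  rw [integral_finsetSum _ hI]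
  simp only [integral_const_mul, Matrix.mulVec, dotProduct, secondMoment, Matrix.of_apply]
  exact Finset.sum_congr rfl fun l _ => by ring

/-- Conditioning on x pulls out x_j, and the conditional mean of the noise is zero. -/
lemma IsSparseModel.integral_coord_mul_noise [IsProbabilityMeasure P]
    (h : IsSparseModel P θstar k σ) (j : Fin d) :
    ∫ p, p.1 j * (p.2 - inner ℝ θstar p.1) ∂P = 0 := by
  set m : MeasurableSpace (Vec d × ℝ) := MeasurableSpace.comap Prod.fst inferInstance with hm
  have hle : m ≤ Prod.instMeasurableSpace := measurable_fst.comap_le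
  have hI : Integrable (fun p : Vec d × ℝ => p.1 j * (p.2 - inner ℝ θstar p.1)) P := by
    have := (h.integrable_coord_mul_snd j).sub (h.integrable_coord_mul_inner j θstar).1
    refine this.congr (Filter.Eventually.of_forall fun p => ?_)
    simp only [Pi.sub_apply]
    ring
  have hIx : ∀ l, Integrable (fun p : Vec d × ℝ => p.1 l) P := fun l =>
    (h.subgaussian_coord l).integrable
  have hIζ : Integrable (fun p : Vec d × ℝ => p.2 - inner ℝ θstar p.1) P := by
    simp_rw [real_inner_eq_sum]
    exact h.subgaussian_y.integrable.sub (integrable_finsetSum _ fun l _ => (hIx l).const_mul _)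
  have hsm : StronglyMeasurable[m] fun p : Vec d × ℝ => p.1 j := by
    have hc : Measurable fun v : Vec d => v j := by fun_prop
    have : Measurable[m] fun p : Vec d × ℝ => p.1 := comap_measurable Prod.fst
    exact (hc.comp this).stronglyMeasurable
  have h1 := condExp_mul_of_stronglyMeasurable_left (μ := P) hsm hI hIζ
  rw [← integral_condExp hle]
  have h2 : P[fun p : Vec d × ℝ => p.1 j * (p.2 - inner ℝ θstar p.1)|m] =ᵐ[P] 0 := by
    refine h1.trans ?_
    filter_upwards [h.noise] with p hp
    simp only [Pi.mul_apply, Pi.zero_apply]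
    rw [hp]
    simp
  rw [integral_congr_ae h2]
  simp

/-- The mean gradient is close to the gradient of the population risk. -/
lemma IsSparseModel.abs_meanGradient_sub_le [IsProbabilityMeasure P]
    (h : IsSparseModel P θstar k σ) (hσ : 0 < σ) (A : Params d) {L : ℝ} (hL : 1 ≤ L)
    (hτ₁ : A.τ₁ = 2 * σ * √L) (hτ₂ : A.τ₂ = 2 * σ * √L) {θ : Vec d}
    (h0 : l0 θ ≤ A.k') (h2 : ‖θ‖ ≤ 2) (j : Fin d) :
    |meanGradient A P θ j - (secondMoment P).mulVec (θ - θstar : Vec d) j| ≤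
      2 * (∑ l, |θ l| + 1) * (6 * σ ^ 2 * exp (-(L / 2))) := by
  set β := 6 * (σ : ℝ) ^ 2 * exp (-(L / 2)) with hβ
  have hτ₁0 : 0 ≤ A.τ₁ := by rw [hτ₁]; positivity
  have hτ₂0 : 0 ≤ A.τ₂ := by rw [hτ₂]; positivity
  have hmj := measurable_coord_fst (d := d)
  have hsx := h.subgaussian_coord
  have b1 := fun l => integral_abs_sub_shrink_mul_le hσ (hsx j) (hsx l) (hmj j) (hmj l) hL hτ₁
  have b2 := integral_abs_sub_shrink_mul_le hσ (hsx j) h.subgaussian_y (hmj j) measurable_snd hL hτ₁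
  have b3 := fun l => integral_abs_sub_shrink_mul_le hσ (hsx l) (hsx j) (hmj l) (hmj j) hL hτ₁
  have b4 := integral_abs_sub_shrink_mul_le hσ h.subgaussian_y (hsx j) measurable_snd (hmj j) hL hτ₂
  -- Orthogonality of noise and covariates turns Σ(θ - θ*) into the mean of the unshrunken gradient.
  have e1 : (secondMoment P).mulVec (θ - θstar : Vec d) j =
      ∫ p, p.1 j * (inner ℝ θ p.1 - p.2) ∂P := by
    have i1 := h.integrable_coord_mul_inner j (θ - θstar)
    have i2 := h.integral_coord_mul_noise j
    rw [← i1.2]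
    have hIn : Integrable (fun p : Vec d × ℝ => p.1 j * (p.2 - inner ℝ θstar p.1)) P := by
      have := (h.integrable_coord_mul_snd j).sub (h.integrable_coord_mul_inner j θstar).1
      refine this.congr (Filter.Eventually.of_forall fun p => ?_)
      simp only [Pi.sub_apply]
      ring
    rw [← sub_zero (∫ p, p.1 j * inner ℝ (θ - θstar) p.1 ∂P), ← i2, ← integral_sub i1.1 hIn]
    refine integral_congr_ae (Filter.Eventually.of_forall fun p => ?_)
    simp only [inner_sub_left]
    ring
  have hIg := integrable_userGradient (P := P) hτ₁0 hτ₂0 h0 h2 j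
  have hIr : Integrable (fun p : Vec d × ℝ => p.1 j * (inner ℝ θ p.1 - p.2)) P := by
    have := (h.integrable_coord_mul_inner j θ).1.sub (h.integrable_coord_mul_snd j)
    refine this.congr (Filter.Eventually.of_forall fun p => ?_)
    simp only [Pi.sub_apply]
    ring
  set D : Vec d × ℝ → ℝ := fun p =>
    (∑ l, |θ l| * (|p.1 j - shrink A.τ₁ (p.1 j)| * |p.1 l|)) +
      |p.1 j - shrink A.τ₁ (p.1 j)| * |p.2| +
      (∑ l, |θ l| * (|p.1 l - shrink A.τ₁ (p.1 l)| * |p.1 j|)) +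
      |p.2 - shrink A.τ₂ p.2| * |p.1 j| with hD
  have I1 : Integrable (fun p : Vec d × ℝ =>
      ∑ l, |θ l| * (|p.1 j - shrink A.τ₁ (p.1 j)| * |p.1 l|)) P :=
    integrable_finsetSum _ fun l _ => (b1 l).1.const_mul _
  have I3 : Integrable (fun p : Vec d × ℝ =>
      ∑ l, |θ l| * (|p.1 l - shrink A.τ₁ (p.1 l)| * |p.1 j|)) P :=
    integrable_finsetSum _ fun l _ => (b3 l).1.const_mul _
  have I12 : Integrable (fun p : Vec d × ℝ =>
      (∑ l, |θ l| * (|p.1 j - shrink A.τ₁ (p.1 j)| * |p.1 l|)) +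
      |p.1 j - shrink A.τ₁ (p.1 j)| * |p.2|) P := I1.add b2.1
  have I123 : Integrable (fun p : Vec d × ℝ =>
      (∑ l, |θ l| * (|p.1 j - shrink A.τ₁ (p.1 j)| * |p.1 l|)) +
      |p.1 j - shrink A.τ₁ (p.1 j)| * |p.2| +
      (∑ l, |θ l| * (|p.1 l - shrink A.τ₁ (p.1 l)| * |p.1 j|))) P := I12.add I3
  have ID : Integrable D P := I123.add b4.1
  have hpt : ∀ p, |userGradient A θ p j - p.1 j * (inner ℝ θ p.1 - p.2)| ≤ D p := by
    intro p
    set x := p.1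
    set x' := shrinkVec A.τ₁ x with hx'
    have hx'l : ∀ l, x' l = shrink A.τ₁ (x l) := fun l => rfl
    set y' := shrink A.τ₂ p.2 with hy'
    -- One factor is exchanged at a time, so every term contains a single shrinkage error times an
    -- unshrunken variable, weighted by the entries of `θ`.
    have e2 : userGradient A θ p j - x j * (inner ℝ θ x - p.2) =
        -((x j - x' j) * (inner ℝ θ x' - y')) - x j * (inner ℝ θ (x - x') - (p.2 - y')) := by
      rw [userGradient, PiLp.smul_apply, smul_eq_mul, inner_sub_right]
      ring
    have a1 : |inner ℝ θ x' - y'| ≤ ∑ l, |θ l| * |x l| + |p.2| := by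
      refine (abs_sub _ _).trans (add_le_add ((abs_inner_le_sum _ _).trans ?_)
        (abs_shrink_le_abs _ _ hτ₂0).1)
      exact Finset.sum_le_sum fun l _ =>
        mul_le_mul_of_nonneg_left (abs_shrink_le_abs A.τ₁ (x l) hτ₁0).1 (abs_nonneg _)
    have a2 : |inner ℝ θ (x - x') - (p.2 - y')| ≤ ∑ l, |θ l| * |x l - x' l| + |p.2 - y'| :=
      (abs_sub _ _).trans (add_le_add_left (abs_inner_le_sum θ (x - x')) _)
    calc _ = |-((x j - x' j) * (inner ℝ θ x' - y')) -
          x j * (inner ℝ θ (x - x') - (p.2 - y'))| := by rw [e2]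
      _ ≤ |x j - x' j| * |inner ℝ θ x' - y'| +
          |x j| * |inner ℝ θ (x - x') - (p.2 - y')| := by
          refine (abs_sub _ _).trans (le_of_eq ?_)
          rw [abs_neg, abs_mul, abs_mul]
      _ ≤ |x j - x' j| * (∑ l, |θ l| * |x l| + |p.2|) +
          |x j| * (∑ l, |θ l| * |x l - x' l| + |p.2 - y'|) := by gcongr
      _ = D p := by
          simp only [hD, mul_add, Finset.mul_sum, hx'l]
          have s1 : ∀ l, |x j - shrink A.τ₁ (x j)| * (|θ l| * |x l|) =
              |θ l| * (|x j - shrink A.τ₁ (x j)| * |x l|) := fun l => by ring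
          have s2 : ∀ l, |x j| * (|θ l| * |x l - shrink A.τ₁ (x l)|) =
              |θ l| * (|x l - shrink A.τ₁ (x l)| * |x j|) := fun l => by ring
          simp only [s1, s2]
          ring
  have hDint : ∫ p, D p ∂P ≤ 2 * (∑ l, |θ l| + 1) * β := by
    have e3 : ∫ p, D p ∂P = (∑ l, |θ l| * ∫ p, |p.1 j - shrink A.τ₁ (p.1 j)| * |p.1 l| ∂P) +
        (∫ p, |p.1 j - shrink A.τ₁ (p.1 j)| * |p.2| ∂P) +
        (∑ l, |θ l| * ∫ p, |p.1 l - shrink A.τ₁ (p.1 l)| * |p.1 j| ∂P) +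
        ∫ p, |p.2 - shrink A.τ₂ p.2| * |p.1 j| ∂P := by
      rw [hD, integral_add I123 b4.1, integral_add I12 I3, integral_add I1 b2.1,
        integral_finsetSum _ fun l _ => (b1 l).1.const_mul _,
        integral_finsetSum _ fun l _ => (b3 l).1.const_mul _]
      simp only [integral_const_mul]
    rw [e3]
    calc _ ≤ (∑ l, |θ l| * β) + β + (∑ l, |θ l| * β) + β := by
          gcongr with l _ l _
          · exact (b1 l).2
          · exact b2.2
          · exact (b3 l).2
          · exact b4.2
      _ = _ := by rw [← Finset.sum_mul]; ring
  rw [e1]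
  simp only [meanGradient]
  rw [← integral_sub hIg hIr]
  exact (abs_integral_le_integral_abs).trans
    ((integral_mono (hIg.sub hIr).abs ID hpt).trans hDint)

/-! ### The population step -/

lemma secondMoment_isHermitian (P : Measure (Vec d × ℝ)) : (secondMoment P).IsHermitian := by
  ext i j
  simp only [Matrix.conjTranspose_apply, secondMoment, Matrix.of_apply, star_trivial]
  exact integral_congr_ae (Filter.Eventually.of_forall fun p => mul_comm _ _)

/-- In an eigenbasis the coordinates are multiplied by 1 - 2λ/(3γ). As μ ≤ λ ≤ γ, these factors lie
between 1/3 and 1 - 2μ/(3γ), so no sign problem arises. -/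
lemma norm_sub_smul_mulVec_le {M : Matrix (Fin d) (Fin d) ℝ} (hM : M.IsHermitian) {γ μ : ℝ}
    (hμ : 0 < μ) (hγ : ∀ x ∈ spectrum ℝ M, x ≤ γ) (hμM : ∀ x ∈ spectrum ℝ M, μ ≤ x)
    (hμγ : μ ≤ γ) (w : Vec d) :
    ‖w - (2 / (3 * γ)) • (WithLp.toLp 2 (M.mulVec w) : Vec d)‖ ≤
      (1 - 2 / 3 * (μ / γ)) * ‖w‖ := by
  have hγ0 : 0 < γ := hμ.trans_le hμγ
  have hr : μ / γ ≤ 1 := by rw [div_le_one hγ0]; exact hμγ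
  set b := hM.eigenvectorBasis
  set l := hM.eigenvalues
  have hb : ∀ i, inner ℝ (b i) (WithLp.toLp 2 (M.mulVec w) : Vec d) =
      l i * inner ℝ (b i) w := by
    intro i
    have h1 : M.mulVec (b i) = l i • (b i : Fin d → ℝ) := hM.mulVec_eigenvectorBasis i
    have hMt : M.transpose = M := by
      have := hM.eq
      rwa [Matrix.conjTranspose_eq_transpose_of_trivial] at this
    have e1 : inner ℝ (b i) (WithLp.toLp 2 (M.mulVec w) : Vec d) =
        (b i : Fin d → ℝ) ⬝ᵥ M.mulVec w := by
      rw [real_inner_eq_sum]; rfl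
    have e2 : inner ℝ (b i) w = (b i : Fin d → ℝ) ⬝ᵥ (w : Fin d → ℝ) := by
      rw [real_inner_eq_sum]; rfl
    rw [e1, e2, Matrix.dotProduct_mulVec, ← Matrix.mulVec_transpose, hMt, h1, smul_dotProduct,
      smul_eq_mul]
  refine (sq_le_sq₀ (norm_nonneg _) (mul_nonneg (by linarith) (norm_nonneg _))).1 ?_
  rw [mul_pow, ← b.sum_sq_norm_inner_right, ← b.sum_sq_norm_inner_right w, Finset.mul_sum]
  refine Finset.sum_le_sum fun i _ => ?_
  have hl := hM.eigenvalues_mem_spectrum_real i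
  have h1 : l i ≤ γ := hγ _ hl
  have h2 : μ ≤ l i := hμM _ hl
  rw [inner_sub_right, inner_smul_right, hb, Real.norm_eq_abs, Real.norm_eq_abs, sq_abs, sq_abs]
  have e : inner ℝ (b i) w - 2 / (3 * γ) * (l i * inner ℝ (b i) w) =
      (1 - 2 / 3 * (l i / γ)) * inner ℝ (b i) w := by field_simp
  rw [e, mul_pow]
  refine mul_le_mul_of_nonneg_right ?_ (sq_nonneg _)
  have h3 : l i / γ ≤ 1 := by rw [div_le_one hγ0]; exact h1
  have h4 : μ / γ ≤ l i / γ := by gcongr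
  exact pow_le_pow_left₀ (by linarith) (by linarith) 2

/-- For σ = 0 the covariates vanish almost surely and the spectrum is {0}. Positivity of σ makes the
shrinkage levels and the radius positive. -/
lemma IsSparseModel.pos (h : IsSparseModel P θstar k σ) (hd : 0 < d) {μ : ℝ} (hμ : 0 < μ)
    (hμM : μ ∈ spectrum ℝ (secondMoment P)) : 0 < σ := by
  by_contra hσ
  have hσ0 : σ = 0 := by simpa using hσ
  have : Nonempty (Fin d) := ⟨⟨0, hd⟩⟩
  have hsq : ∀ j : Fin d, ∫ p, p.1 j ^ 2 ∂P = 0 := by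
    intro j
    refine le_antisymm (le_of_forall_pos_le_add fun ε hε => ?_)
      (integral_nonneg fun _ => sq_nonneg _)
    -- With σ = 0 the second moment is at most 4/s² for every s > 0; this s makes it ε.
    have hs : 0 < √(4 / ε) := Real.sqrt_pos.2 (by positivity)
    have h1 := (integral_sq_le (h.subgaussian_coord j) (measurable_coord_fst j) hs).2
    rw [hσ0, Real.sq_sqrt (by positivity)] at h1
    simp only [NNReal.coe_zero, ne_eq, OfNat.ofNat_ne_zero, not_false_eq_true, zero_pow, zero_mul,
      zero_div, exp_zero, mul_one] at h1
    rw [zero_add]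
    refine h1.trans (le_of_eq (by field_simp))
  have hz : ∀ j : Fin d, (fun p : Vec d × ℝ => p.1 j ^ 2) =ᵐ[P] 0 := fun j =>
    (integral_eq_zero_iff_of_nonneg (fun _ => sq_nonneg _)
      (integral_sq_le (h.subgaussian_coord j) (measurable_coord_fst j) one_pos).1).1 (hsq j)
  have hM : secondMoment P = 0 := by
    ext i j
    simp only [secondMoment, Matrix.of_apply, Matrix.zero_apply]
    rw [integral_congr_ae (g := fun _ => (0 : ℝ))]
    · simp
    · filter_upwards [hz i] with p hp
      have : p.1 i = 0 := by simpa using hp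
      rw [this, zero_mul]
  rw [hM, spectrum.zero_eq] at hμM
  exact hμ.ne' hμM

end Population

/-! ### Convergence of the iteration -/

lemma norm_le_sum_abs {d : ℕ} (θ : Vec d) : ‖θ‖ ≤ ∑ j, |θ j| := by
  have h0 : 0 ≤ ∑ j, |θ j| := Finset.sum_nonneg fun _ _ => abs_nonneg _
  refine (sq_le_sq₀ (norm_nonneg _) h0).1 ?_
  rw [EuclideanSpace.real_norm_sq_eq, sq (∑ j, |θ j|), Finset.sum_mul]
  refine Finset.sum_le_sum fun j hj => ?_
  rw [← sq_abs, sq]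
  gcongr
  exact Finset.single_le_sum (f := fun j => |θ j|) (fun _ _ => abs_nonneg _) hj

lemma sqrt_sum_add_sq_le {d : ℕ} (I : Finset (Fin d)) (v w : Fin d → ℝ) :
    √(∑ j ∈ I, (v j + w j) ^ 2) ≤ √(∑ j ∈ I, v j ^ 2) + √(∑ j ∈ I, w j ^ 2) := by
  rw [← norm_toLp_ite I v, ← norm_toLp_ite I w, ← norm_toLp_ite I (fun j => v j + w j)]
  refine le_trans (le_of_eq ?_) (norm_add_le _ _)
  congr 1
  ext j
  simp only [PiLp.add_apply]
  split_ifs <;> simp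

/-- One step of iterative hard thresholding with a perturbed population gradient. -/
lemma norm_step_sub_le {d s k : ℕ} {M : Matrix (Fin d) (Fin d) ℝ} (hM : M.IsHermitian) {γ μ : ℝ}
    (hμ : 0 < μ) (hγ : ∀ x ∈ spectrum ℝ M, x ≤ γ) (hμM : ∀ x ∈ spectrum ℝ M, μ ≤ x)
    (hμγ : μ ≤ γ) (hs : 0 < s) (hks : 72 * (γ / μ) ^ 2 * k ≤ s) {θstar θ e : Vec d}
    (hsp : l0 θstar ≤ k) (hθs : ‖θstar‖ ≤ 2) {Λ : ℝ} (hΛ : 0 ≤ Λ) (he : ∀ j, |e j| ≤ Λ) :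
    ‖projBall (trunc s (θ - (2 / (3 * γ)) •
        ((WithLp.toLp 2 (M.mulVec (θ - θstar : Vec d)) : Vec d) + e))) - θstar‖ ≤
      (1 - 1 / 2 * (μ / γ)) * ‖θ - θstar‖ + 2 * (2 / (3 * γ)) * √(2 * s) * Λ := by
  have hγ0 : 0 < γ := hμ.trans_le hμγ
  have hκ : 1 ≤ γ / μ := by rw [one_le_div hμ]; exact hμγ
  have hs' : (0 : ℝ) < s := by exact_mod_cast hs
  have hk0 : (0 : ℝ) ≤ k := by positivity
  have hκ2 : 1 ≤ (γ / μ) ^ 2 := one_le_pow₀ hκ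
  have hks' : k ≤ s := by
    have : (k : ℝ) ≤ s := by nlinarith
    exact_mod_cast this
  set η := 2 / (3 * γ) with hη
  have hη0 : 0 < η := by positivity
  set r := μ / γ with hr
  have hr0 : 0 < r := by positivity
  have hr1 : r ≤ 1 := by rw [hr, div_le_one hγ0]; exact hμγ
  have hrκ : γ / μ * r = 1 := by rw [hr]; field_simp
  set w : Vec d := (θ - θstar) - η • (WithLp.toLp 2 (M.mulVec (θ - θstar : Vec d)) : Vec d) with hw
  have hwn : ‖w‖ ≤ (1 - 2 / 3 * r) * ‖θ - θstar‖ :=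
    norm_sub_smul_mulVec_le hM hμ hγ hμM hμγ (θ - θstar)
  set v : Vec d := θ - η • ((WithLp.toLp 2 (M.mulVec (θ - θstar : Vec d)) : Vec d) + e) with hv
  have hvw : ∀ j, v j - θstar j = w j + -(η * e j) := by
    intro j
    simp only [hv, hw, PiLp.sub_apply, PiLp.smul_apply, PiLp.add_apply, smul_eq_mul]
    ring
  obtain ⟨I, hI, hle⟩ := norm_trunc_sub_le hs hks' v θstar hsp
  set q := √((k : ℝ) / s) with hq
  have hq0 : 0 ≤ q := Real.sqrt_nonneg _
  -- The constant 72 exceeds 64 = 8². Then (1 + r/8)(1 - 2r/3) ≤ 1 - 13r/24, which is below 1 - r/2.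
  have hq1 : q ≤ r / 8 := by
    rw [hq]
    refine Real.sqrt_le_iff.2 ⟨by positivity, ?_⟩
    rw [div_le_iff₀ hs']
    have h1 : r ^ 2 * (72 * (γ / μ) ^ 2 * k) ≤ r ^ 2 * s := by gcongr
    have h2 : r ^ 2 * (72 * (γ / μ) ^ 2 * k) = 72 * k := by
      calc _ = 72 * (γ / μ * r) ^ 2 * k := by ring
        _ = _ := by rw [hrκ]; ring
    nlinarith
  -- Only the at most s + k ≤ 2s coordinates of `I` matter, so the perturbation is paid with √(2s)
  -- and not √d.
  have h3 : √(∑ j ∈ I, (v j - θstar j) ^ 2) ≤ ‖w‖ + √(2 * s) * (η * Λ) := by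
    simp_rw [hvw]
    refine (sqrt_sum_add_sq_le I w (fun j => -(η * e j))).trans (add_le_add ?_ ?_)
    · rw [EuclideanSpace.norm_eq]
      refine Real.sqrt_le_sqrt ?_
      simp only [Real.norm_eq_abs, sq_abs]
      exact Finset.sum_le_sum_of_subset_of_nonneg (Finset.subset_univ _) fun _ _ _ => sq_nonneg _
    · refine Real.sqrt_le_iff.2 ⟨by positivity, ?_⟩
      rw [mul_pow, Real.sq_sqrt (by positivity)]
      calc ∑ j ∈ I, (-(η * e j)) ^ 2 ≤ ∑ j ∈ I, (η * Λ) ^ 2 := by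
            refine Finset.sum_le_sum fun j _ => ?_
            rw [neg_sq, ← sq_abs (η * e j), abs_mul, abs_of_pos hη0]
            have := he j
            gcongr
        _ = I.card * (η * Λ) ^ 2 := by simp
        _ ≤ 2 * s * (η * Λ) ^ 2 := by
            have h4 : (I.card : ℝ) ≤ s + k := by exact_mod_cast hI
            have h5 : (k : ℝ) ≤ s := by exact_mod_cast hks'
            gcongr
            linarith
  have hN := norm_nonneg (θ - θstar)
  have hS : 0 ≤ √(2 * (s : ℝ)) * (η * Λ) := by positivity
  calc _ ≤ ‖trunc s v - θstar‖ := norm_projBall_sub_le _ _ hθs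
    _ ≤ (1 + q) * √(∑ j ∈ I, (v j - θstar j) ^ 2) := hle
    _ ≤ (1 + q) * ((1 - 2 / 3 * r) * ‖θ - θstar‖ + √(2 * s) * (η * Λ)) := by
        gcongr
        linarith
    _ = (1 + q) * (1 - 2 / 3 * r) * ‖θ - θstar‖ + (1 + q) * (√(2 * s) * (η * Λ)) := by ring
    _ ≤ (1 - 1 / 2 * r) * ‖θ - θstar‖ + 2 * (√(2 * s) * (η * Λ)) := by
        gcongr
        · nlinarith
        · linarith
    _ = _ := by ring

/-- The perturbations sum to the fixed point E/r of the affine recursion, and 1 - r ≤ e^(-r) handles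
the initial value. -/
lemma le_geometric {u : ℕ → ℝ} {r E : ℝ} (hr0 : 0 < r) (hr1 : r ≤ 1) {T : ℕ}
    (h : ∀ t < T, u (t + 1) ≤ (1 - r) * u t + E) :
    ∀ t ≤ T, u t ≤ exp (-(r * t)) * max (u 0) 0 + max E 0 / r := by
  intro t
  induction t with
  | zero =>
    intro _
    have : 0 ≤ max E 0 / r := div_nonneg (le_max_right _ _) hr0.le
    simp only [Nat.cast_zero, mul_zero, neg_zero, exp_zero, one_mul]
    linarith [le_max_left (u 0) 0]
  | succ t ih =>
    intro ht
    have h1 := ih (by omega)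
    have h2 := h t (by omega)
    have h3 : 1 - r ≤ exp (-r) := by linarith [add_one_le_exp (-r)]
    have h4 : exp (-(r * (t + 1 : ℕ))) = exp (-r) * exp (-(r * t)) := by
      rw [← exp_add]; congr 1; push_cast; ring
    have h5 : 0 ≤ exp (-(r * t)) * max (u 0) 0 := mul_nonneg (exp_pos _).le (le_max_right _ _)
    calc u (t + 1) ≤ (1 - r) * u t + E := h2
      _ ≤ (1 - r) * (exp (-(r * t)) * max (u 0) 0 + max E 0 / r) + max E 0 := by
          have : 0 ≤ 1 - r := by linarith
          gcongr
          exact le_max_left _ _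
      _ = (1 - r) * (exp (-(r * t)) * max (u 0) 0) + max E 0 / r := by field_simp; ring
      _ ≤ exp (-r) * (exp (-(r * t)) * max (u 0) 0) + max E 0 / r := by gcongr
      _ = _ := by rw [h4]; ring

/-- When T ≤ n the quotient ⌊n/T⌋ is at least 1, so rounding costs at most a factor 2. -/
lemma div_two_mul_le_card_group {n T t : ℕ} (hT : 0 < T) (hTn : T ≤ n) :
    (n : ℝ) / (2 * T) ≤ (group n T t).card := by
  have h1 : n / T ≤ (group n T t).card := by
    rw [group, Nat.card_Ico]
    split_ifs with h
    · have h2 := Nat.mul_div_le n T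
      rw [← h, Nat.add_mul, one_mul] at h2
      rw [← h]; omega
    · rw [Nat.add_mul, one_mul]; omega
  have h2 : 1 ≤ n / T := (Nat.one_le_div_iff hT).2 hTn
  have h3 : n < n / T * T + T := Nat.lt_div_mul_add hT
  have h4 : (n : ℝ) ≤ (n / T : ℕ) * (2 * T) := by
    have : n ≤ n / T * (2 * T) := by nlinarith
    exact_mod_cast this
  have hT' : (0 : ℝ) < T := by exact_mod_cast hT
  rw [div_le_iff₀ (by positivity)]
  refine h4.trans ?_
  have : ((n / T : ℕ) : ℝ) ≤ (group n T t).card := by exact_mod_cast h1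
  gcongr

/-- The error of the output on the event that all group averages are close to their means. -/
lemma IsSparseModel.norm_iterate_sub_le {d n k : ℕ} {A : Params d} {P : Measure (Vec d × ℝ)}
    [IsProbabilityMeasure P] {θstar : Vec d} {σ : ℝ≥0} (h : IsSparseModel P θstar k σ)
    (hσ : 0 < σ) {γ μ : ℝ} (hμ : 0 < μ) (hγ : ∀ x ∈ spectrum ℝ (secondMoment P), x ≤ γ)
    (hμM : ∀ x ∈ spectrum ℝ (secondMoment P), μ ≤ x) (hμγ : μ ≤ γ) (hk' : 0 < A.k')
    (hks : 72 * (γ / μ) ^ 2 * k ≤ A.k') (hη : A.η = 2 / (3 * γ)) {L : ℝ} (hL : 1 ≤ L)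
    (hτ₁ : A.τ₁ = 2 * σ * √L) (hτ₂ : A.τ₂ = 2 * σ * √L) (h0 : l0 A.θ₀ ≤ A.k')
    (hinit : ‖A.θ₀ - θstar‖ ≤ 1 / 2) {ξ : ℝ} (hξ : 0 ≤ ξ) {z : ℕ → Vec d}
    (hz : ∀ t < A.T, ∀ j,
      |groupMean n A z t j - meanGradient A P (iterate n A z t) j| ≤ ξ) :
    ‖iterate n A z A.T - θstar‖ ≤ exp (-(1 / 2 * (μ / γ) * A.T)) +
      2 * (γ / μ) * (2 * (2 / (3 * γ)) * √(2 * A.k') *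
        (ξ + 36 * σ ^ 2 * √A.k' * exp (-(L / 2)))) := by
  have hγ0 : 0 < γ := hμ.trans_le hμγ
  have hθs1 : ‖θstar‖ ≤ 1 := (norm_le_sum_abs θstar).trans h.l1_le
  have h2 : ‖A.θ₀‖ ≤ 2 := by
    have := norm_add_le (A.θ₀ - θstar) θstar
    rw [sub_add_cancel] at this
    linarith
  have hsk : 1 ≤ √(A.k' : ℝ) := Real.one_le_sqrt.2 (by exact_mod_cast hk')
  set bias := 36 * (σ : ℝ) ^ 2 * √A.k' * exp (-(L / 2)) with hbias
  have hbias0 : 0 ≤ bias := by positivity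
  set E := 2 * (2 / (3 * γ)) * √(2 * A.k') * (ξ + bias) with hE
  have hE0 : 0 ≤ E := by positivity
  have hr0 : 0 < 1 / 2 * (μ / γ) := by positivity
  have hr1 : 1 / 2 * (μ / γ) ≤ 1 := by
    have : μ / γ ≤ 1 := by rw [div_le_one hγ0]; exact hμγ
    linarith
  have hstep : ∀ t < A.T, ‖iterate n A z (t + 1) - θstar‖ ≤
      (1 - 1 / 2 * (μ / γ)) * ‖iterate n A z t - θstar‖ + E := by
    intro t ht
    set θ := iterate n A z t with hθ
    obtain ⟨m1, m2⟩ := iterate_mem n A h0 h2 z t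
    rw [← hθ] at m1 m2
    -- The perturbation is the sampling error of the group plus the shrinkage bias of its mean.
    set e : Vec d := groupMean n A z t -
      WithLp.toLp 2 ((secondMoment P).mulVec (θ - θstar : Vec d)) with he
    have hbound : ∀ j, |e j| ≤ ξ + bias := by
      intro j
      have b1 := hz t ht j
      have b2 := h.abs_meanGradient_sub_le hσ A hL hτ₁ hτ₂ m1 m2 j
      have b3 : ∑ l, |θ l| ≤ 2 * √A.k' := by
        refine (sum_abs_le_sqrt_l0 θ).trans ?_
        calc √(l0 θ) * ‖θ‖ ≤ √A.k' * 2 := by gcongr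
          _ = _ := mul_comm _ _
      have b4 : 2 * (∑ l, |θ l| + 1) * (6 * (σ : ℝ) ^ 2 * exp (-(L / 2))) ≤ bias := by
        -- As 1 ≤ √k', the ℓ¹ norm plus one is at most 3√k'; 36 = 2·3·6.
        calc _ ≤ 2 * (2 * √A.k' + √A.k') * (6 * (σ : ℝ) ^ 2 * exp (-(L / 2))) := by gcongr
          _ = bias := by rw [hbias]; ring
      have b5 : e j = (groupMean n A z t j - meanGradient A P θ j) +
          (meanGradient A P θ j - (secondMoment P).mulVec (θ - θstar : Vec d) j) := by
        simp only [he, PiLp.sub_apply]; ring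
      rw [b5]
      exact (abs_add_le _ _).trans (add_le_add b1 (b2.trans b4))
    have hit : iterate n A z (t + 1) = projBall (trunc A.k' (θ - (2 / (3 * γ)) •
        ((WithLp.toLp 2 ((secondMoment P).mulVec (θ - θstar : Vec d)) : Vec d) + e))) := by
      rw [he, add_sub_cancel, ← hη]
      rfl
    rw [hit]
    exact norm_step_sub_le (secondMoment_isHermitian P) hμ hγ hμM hμγ hk' hks h.sparse
      (hθs1.trans (by norm_num)) (by positivity) hbound
  have hgeo := le_geometric (u := fun t => ‖iterate n A z t - θstar‖) hr0 hr1 hstep A.T le_rfl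
  refine hgeo.trans ?_
  rw [max_eq_left (norm_nonneg _), max_eq_left hE0]
  have e1 : E / (1 / 2 * (μ / γ)) = 2 * (γ / μ) * E := by field_simp
  rw [e1]
  gcongr
  refine mul_le_of_le_one_right (exp_pos _).le ?_
  exact le_trans hinit (by norm_num)

/-! ### The accuracy guarantee -/

/-- The consequences of the lower bound on the sample size. -/
lemma sample_size_consequences {d n k' : ℕ} {ε δ κ : ℝ} (hd : 2 ≤ d) (hn : 1 ≤ n) (hk' : 1 ≤ k')
    (hε : 0 < ε) (hδ : 0 < δ) (hδ1 : δ < 1) (hκ : 1 ≤ κ)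
    (h : 12 * κ * ((k' : ℝ) ^ 2 * d / min ε 1 ^ 2) * log (n * d / δ) ^ 2 ≤ n) :
    1 ≤ log n ∧ 3 * κ * log n ≤ n ∧ 2 * log (n * d / δ) * (6 * κ * log n) ≤ n ∧
      2 ≤ n * d / δ := by
  have hd' : (2 : ℝ) ≤ d := by exact_mod_cast hd
  have hn' : (1 : ℝ) ≤ n := by exact_mod_cast hn
  have hk1 : (1 : ℝ) ≤ k' := by exact_mod_cast hk'
  have hm0 : 0 < min ε 1 := lt_min hε one_pos
  have hm1 : min ε 1 ≤ 1 := min_le_right _ _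
  have hfac : 1 ≤ (k' : ℝ) ^ 2 * d / min ε 1 ^ 2 := by
    rw [one_le_div (by positivity)]
    have h1 : min ε 1 ^ 2 ≤ 1 := pow_le_one₀ hm0.le hm1
    have h2 : (1 : ℝ) ≤ (k' : ℝ) ^ 2 := one_le_pow₀ hk1
    nlinarith
  have hq : n * d ≤ n * d / δ := by
    rw [le_div_iff₀ hδ]
    nlinarith [mul_nonneg (by linarith : (0 : ℝ) ≤ n) (by linarith : (0 : ℝ) ≤ d)]
  have hnd : 2 * (n : ℝ) ≤ n * d := by nlinarith
  have h2q : 2 ≤ n * d / δ := by linarith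
  set W := log (n * d / δ) with hW
  have hWlog2 : log 2 ≤ W := log_le_log (by norm_num) h2q
  have hl2 := log_two_gt_d9
  have hWL : log n ≤ W := log_le_log (by linarith) (by linarith)
  have hL0 : 0 ≤ log n := log_nonneg hn'
  have hmain : 12 * κ * W ^ 2 ≤ n := by
    refine le_trans ?_ h
    have : 12 * κ * 1 * W ^ 2 ≤ 12 * κ * ((k' : ℝ) ^ 2 * d / min ε 1 ^ 2) * W ^ 2 := by gcongr
    linarith
  -- Since 12 (log 2)² > 2, n is at least 3 > e.
  have hn3 : (3 : ℝ) ≤ n := by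
    have h1 : (2 : ℝ) < n := by nlinarith [sq_nonneg W]
    have h2 : 2 < n := by exact_mod_cast h1
    exact_mod_cast h2
  have hL1 : 1 ≤ log n := by
    rw [le_log_iff_exp_le (by linarith)]
    have := exp_one_lt_d9
    linarith
  -- The constant 12 is the product 2·6 needed for the third claim; one of the two logarithms pays
  -- for T, the other for the union bound.
  have hκW : log n * W ≤ W ^ 2 := by nlinarith
  refine ⟨hL1, ?_, ?_, h2q⟩
  · nlinarith
  · nlinarith

lemma log_mul_le_of_le {d T : ℕ} {δ κ L : ℝ} (hd : 2 ≤ d) (hT : 1 ≤ T) (hδ : 0 < δ) (hδ1 : δ < 1)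
    (hκ : 1 ≤ κ) (hL : 1 ≤ L) (hTL : T ≤ 3 * κ * L) :
    1 / 2 ≤ log (d / δ) ∧ log (2 * d * T / δ) ≤ 15 * κ * L * log (d / δ) := by
  have hd' : (2 : ℝ) ≤ d := by exact_mod_cast hd
  have hT' : (1 : ℝ) ≤ T := by exact_mod_cast hT
  have hq : (2 : ℝ) ≤ d / δ := by rw [le_div_iff₀ hδ]; nlinarith
  have hW : 1 / 2 ≤ log (d / δ) := by
    have h1 : log 2 ≤ log (d / δ) := log_le_log (by norm_num) hq
    linarith [log_two_gt_d9]
  refine ⟨hW, ?_⟩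
  set W := log (d / δ) with hWdef
  have h1 : log (2 * d * T / δ) ≤ log (6 * κ * L * (d / δ)) := by
    refine log_le_log (by positivity) ?_
    calc 2 * d * T / δ = 2 * T * (d / δ) := by ring
      _ ≤ 2 * (3 * κ * L) * (d / δ) := by gcongr
      _ = _ := by ring
  have h2 : log (6 * κ * L * (d / δ)) = log (6 * κ) + log L + W := by
    rw [log_mul (by positivity) (by positivity), log_mul (by positivity) (by positivity)]
  have h3 : log (6 * κ) ≤ 6 * κ := log_le_self (by positivity)
  have h4 : log L ≤ L := log_le_self (by positivity)
  have h5 : 6 * κ ≤ 6 * κ * L := le_mul_of_one_le_right (by positivity) hL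
  have h6 : L ≤ κ * L := le_mul_of_one_le_left (by positivity) hκ
  have h7 : κ * L ≤ κ * L * (2 * W) := le_mul_of_one_le_right (by positivity) (by linarith)
  have h8 : W ≤ κ * L * W := le_mul_of_one_le_left (by linarith) (by nlinarith)
  -- Bounding 1 by 2W, the three logarithms cost 12, 2 and 1 times κLW, which makes 15.
  nlinarith

/-- The size of the noise of the randomized gradient averages. -/
lemma noise_le {d k' : ℕ} {ε κ L W n ξlog s : ℝ} {B r : ℝ} (hε : 0 < ε) (hκ : 1 ≤ κ)
    (hL : 1 ≤ L) (hn : 0 < n) (hd : 0 < d) (hk' : 0 < k') (hW : 0 ≤ W)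
    (hr : r = √d * (2 * s * √L) * (2 * √k' * (2 * s * √L) + 2 * s * √L)) (hs : 0 < s)
    (hB : B ≤ 128 * √d * r / min ε 1) (hlog : ξlog ≤ 15 * κ * L * W) :
    4 * B / √d * √(ξlog / (n / (6 * κ * L))) ≤
      61440 * κ * s ^ 2 * √k' * (√d * L ^ 2 * √W / (√n * min ε 1)) := by
  have hd' : (0 : ℝ) < √d := Real.sqrt_pos.2 (by exact_mod_cast hd)
  have hk1 : (1 : ℝ) ≤ √k' := Real.one_le_sqrt.2 (by exact_mod_cast hk')
  have hm0 : 0 < min ε 1 := lt_min hε one_pos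
  have hL2 : √L ^ 2 = L := Real.sq_sqrt (by linarith)
  have hsn : 0 < √n := Real.sqrt_pos.2 hn
  have hr12 : r ≤ 12 * s ^ 2 * √d * √k' * L := by
    have e1 : r = √d * (4 * s ^ 2 * L) * (2 * √k' + 1) := by
      rw [hr]
      calc _ = √d * (4 * s ^ 2 * √L ^ 2) * (2 * √k' + 1) := by ring
        _ = _ := by rw [hL2]
    rw [e1]
    calc _ ≤ √d * (4 * s ^ 2 * L) * (2 * √k' + √k') := by gcongr
      _ = _ := by ring
  -- 15·6 = 90 is rounded up to 10². The final constant is 61440 = 4·128·12·10; one √d from B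
  -- cancels and the √d of r remains.
  have hsq : √(ξlog / (n / (6 * κ * L))) ≤ 10 * κ * L * √W / √n := by
    have hcalc : ξlog * (6 * κ * L) ≤ (10 * κ * L) ^ 2 * W := by
      calc ξlog * (6 * κ * L) ≤ 15 * κ * L * W * (6 * κ * L) := by gcongr
        _ = 90 * ((κ * L) ^ 2 * W) := by ring
        _ ≤ 100 * ((κ * L) ^ 2 * W) := by gcongr; norm_num
        _ = _ := by ring
    refine Real.sqrt_le_iff.2 ⟨by positivity, ?_⟩
    rw [div_pow, mul_pow, Real.sq_sqrt hW, Real.sq_sqrt hn.le, div_div_eq_mul_div]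
    exact div_le_div_of_nonneg_right hcalc hn.le
  calc 4 * B / √d * √(ξlog / (n / (6 * κ * L)))
      ≤ 4 * (128 * √d * (12 * s ^ 2 * √d * √k' * L) / min ε 1) / √d *
        (10 * κ * L * √W / √n) := by
        gcongr
        refine hB.trans ?_
        gcongr
    _ = _ := by field_simp; ring

/-- Collection of the error terms into the final rate. -/
lemma rate_le {d k k' : ℕ} {ε κ γ L W n s ξ : ℝ} (hε : 0 < ε) (hκ : 1 ≤ κ) (hγ : 0 < γ)
    (hL : 1 ≤ L) (hn : 1 ≤ n) (hd : 1 ≤ d) (hk : 1 ≤ k) (hk' : (k' : ℝ) ≤ 73 * κ ^ 2 * k)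
    (hW : 1 / 2 ≤ W) (hLn : L = log n)
    (hξ : ξ ≤ 61440 * κ * s ^ 2 * √k' * (√d * L ^ 2 * √W / (√n * min ε 1))) :
    1 / n + 2 * κ * (2 * (2 / (3 * γ)) * √(2 * k') * (ξ + 36 * s ^ 2 * √k' * exp (-(L / 2)))) ≤
      (2 + 8 / (3 * γ) * 146 * 61512 * κ ^ 4 * s ^ 2) *
        (√d * k * L ^ 2 * √W / (√n * min ε 1)) := by
  have hm0 : 0 < min ε 1 := lt_min hε one_pos
  have hm1 : min ε 1 ≤ 1 := min_le_right _ _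
  have hd' : (1 : ℝ) ≤ √d := Real.one_le_sqrt.2 (by exact_mod_cast hd)
  have hk1 : (1 : ℝ) ≤ k := by exact_mod_cast hk
  have hn0 : 0 < n := by linarith
  have hsn : 1 ≤ √n := Real.one_le_sqrt.2 hn
  have hsn2 : √n ^ 2 = n := Real.sq_sqrt hn0.le
  have hWs : 1 / 2 ≤ √W := Real.le_sqrt_of_sq_le (by linarith)
  set R := √d * L ^ 2 * √W / (√n * min ε 1) with hR
  have hR0 : 0 ≤ R := by positivity
  have hnR : 1 / √n ≤ 2 * R := by
    have h1 : 1 ≤ 2 * (√d * L ^ 2 * √W / min ε 1) := by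
      have h2 : 1 ≤ L ^ 2 := one_le_pow₀ hL
      have h3 : √d * L ^ 2 * √W ≤ √d * L ^ 2 * √W / min ε 1 := le_div_self (by positivity) hm0 hm1
      have h4 : 1 * 1 * (1 / 2) ≤ √d * L ^ 2 * √W := by gcongr
      linarith
    have h5 : 2 * R = 2 * (√d * L ^ 2 * √W / min ε 1) * (1 / √n) := by
      rw [hR]; field_simp
    rw [h5]
    exact le_mul_of_one_le_left (by positivity) h1
  -- The shrinkage bias is therefore of the same n^(-1/2) order as the noise; it adds 72 to the
  -- constant 61440.
  have hexp : exp (-(L / 2)) = 1 / √n := by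
    have : exp (L / 2) = √n := by
      rw [Real.exp_half, hLn, Real.exp_log hn0]
    rw [exp_neg, this, one_div]
  have h1n : 1 / n ≤ 2 * (k * R) := by
    have h1 : 1 / n ≤ 1 / √n := by
      refine one_div_le_one_div_of_le (by linarith) ?_
      nlinarith
    have h2 : R ≤ k * R := le_mul_of_one_le_left hR0 hk1
    linarith
  -- One root comes from the truncation and one from the gradient radius or the bias; together with
  -- k' ≤ 73κ²k they give 146κ²k.
  have hsk : √(2 * (k' : ℝ)) * √k' ≤ 2 * k' := by
    rw [← Real.sqrt_mul (by positivity)]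
    refine Real.sqrt_le_iff.2 ⟨by positivity, ?_⟩
    nlinarith [sq_nonneg (k' : ℝ)]
  have hsum : ξ + 36 * s ^ 2 * √k' * exp (-(L / 2)) ≤ 61512 * κ * s ^ 2 * √k' * R := by
    have h1 : 36 * s ^ 2 * √k' * exp (-(L / 2)) ≤ 36 * s ^ 2 * √k' * (2 * R) := by
      rw [hexp]; gcongr
    have h2 : 72 * (s ^ 2 * √k' * R) ≤ 72 * (s ^ 2 * √k' * R) * κ :=
      le_mul_of_one_le_right (by positivity) hκ
    linarith
  have hgoal : √d * k * L ^ 2 * √W / (√n * min ε 1) = k * R := by rw [hR]; ring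
  rw [hgoal, add_mul]
  refine add_le_add h1n ?_
  calc 2 * κ * (2 * (2 / (3 * γ)) * √(2 * k') * (ξ + 36 * s ^ 2 * √k' * exp (-(L / 2))))
      ≤ 2 * κ * (2 * (2 / (3 * γ)) * √(2 * k') * (61512 * κ * s ^ 2 * √k' * R)) := by gcongr
    _ = 8 / (3 * γ) * 61512 * κ ^ 2 * s ^ 2 * R * (√(2 * k') * √k') := by ring
    _ ≤ 8 / (3 * γ) * 61512 * κ ^ 2 * s ^ 2 * R * (2 * (73 * κ ^ 2 * k)) := by
        refine mul_le_mul_of_nonneg_left ?_ (by positivity)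
        exact hsk.trans (mul_le_mul_of_nonneg_left hk' two_pos.le)
    _ = _ := by ring

lemma measurable_output {d n : ℕ} (A : Params d) :
    Measurable (output A : (Fin n → Vec d) → Vec d) :=
  (measurable_iterate n A A.T).comp measurable_padZero

lemma outputLaw_accuracy {d n k : ℕ} {ε δ : ℝ} {P : Measure (Vec d × ℝ)} [IsProbabilityMeasure P]
    {θstar θ₀ : Vec d} {A : Params d} {σ : ℝ≥0} {γ μ : ℝ} (hμ : 0 < μ) (hμγ : μ ≤ γ)
    (hd : 2 ≤ d) (hn : 1 ≤ n) (hk : 1 ≤ k) (hε : 0 < ε) (hδ : 0 < δ) (hδ1 : δ < 1)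
    (h : IsSparseModel P θstar k σ)
    (hγ : IsGreatest (spectrum ℝ (secondMoment P)) γ)
    (hμM : IsLeast (spectrum ℝ (secondMoment P)) μ)
    (hA : A = tunedParams 2 2 σ γ μ n k ε θ₀) (h0 : l0 θ₀ ≤ A.k')
    (hinit : ‖θ₀ - θstar‖ ≤ 1 / 2 * (μ / γ))
    (hsize : 12 * (γ / μ) * ((A.k' : ℝ) ^ 2 * d / min ε 1 ^ 2) * log (n * d / δ) ^ 2 ≤ n) :
    ENNReal.ofReal (1 - δ) ≤ outputLaw n A P
      {θ | ‖θ - θstar‖ ≤ (2 + 8 / (3 * γ) * 146 * 61512 * (γ / μ) ^ 4 * σ ^ 2) *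
        (√d * k * log n ^ 2 * √(log (d / δ)) / (√n * min ε 1))} := by
  have hγ0 : 0 < γ := hμ.trans_le hμγ
  have hκ : 1 ≤ γ / μ := by rw [one_le_div hμ]; exact hμγ
  have hr1 : μ / γ ≤ 1 := by rw [div_le_one hγ0]; exact hμγ
  have hd0 : 0 < d := by omega
  have hσ : 0 < σ := h.pos hd0 hμ hμM.1
  have hσ' : (0 : ℝ) < σ := by exact_mod_cast hσ
  have hk1 : (1 : ℝ) ≤ k := by exact_mod_cast hk
  have hn' : (1 : ℝ) ≤ n := by exact_mod_cast hn
  have aT : A.T = ⌈2 * (γ / μ) * log n⌉₊ := by rw [hA]; rfl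
  have aε : A.ε = ε := by rw [hA]; rfl
  have aη : A.η = 2 / (3 * γ) := by rw [hA]; rfl
  have aτ₁ : A.τ₁ = 2 * σ * √(log n) := by rw [hA]; rfl
  have aτ₂ : A.τ₂ = 2 * σ * √(log n) := by rw [hA]; rfl
  have ak' : A.k' = ⌈72 * (γ / μ) ^ 2 * k⌉₊ := by rw [hA]; rfl
  have aθ : A.θ₀ = θ₀ := by rw [hA]; rfl
  rw [← aθ] at h0 hinit
  have hk'0 : 0 < A.k' := by rw [ak']; exact Nat.ceil_pos.2 (by positivity)
  have hk'1 : 72 * (γ / μ) ^ 2 * k ≤ A.k' := by rw [ak']; exact Nat.le_ceil _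
  have hk'2 : (A.k' : ℝ) ≤ 73 * (γ / μ) ^ 2 * k := by
    have h1 : (A.k' : ℝ) < 72 * (γ / μ) ^ 2 * k + 1 := by
      rw [ak']; exact Nat.ceil_lt_add_one (by positivity)
    have h2 : 1 * 1 ≤ (γ / μ) ^ 2 * k := mul_le_mul (one_le_pow₀ hκ) hk1 zero_le_one (by positivity)
    linarith
  obtain ⟨hL, hTn, hlogn, h2q⟩ := sample_size_consequences hd hn hk'0 hε hδ hδ1 hκ hsize
  set L := log n with hLdef
  have hT0 : 0 < A.T := by rw [aT]; exact Nat.ceil_pos.2 (by positivity)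
  have hT1 : 2 * (γ / μ) * L ≤ A.T := by rw [aT]; exact Nat.le_ceil _
  have hT2 : (A.T : ℝ) ≤ 3 * (γ / μ) * L := by
    have h1 : (A.T : ℝ) < 2 * (γ / μ) * L + 1 := by
      rw [aT]; exact Nat.ceil_lt_add_one (by positivity)
    have h2 : 1 * 1 ≤ γ / μ * L := mul_le_mul hκ hL zero_le_one (by positivity)
    linarith
  have hTn' : A.T ≤ n := by
    have : (A.T : ℝ) ≤ n := hT2.trans hTn
    exact_mod_cast this
  have hTpos : (0 : ℝ) < A.T := by exact_mod_cast hT0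
  have hτ₁0 : 0 < A.τ₁ := by rw [aτ₁]; positivity
  have hτ₂0 : 0 < A.τ₂ := by rw [aτ₂]; positivity
  have hdpos : (0 : ℝ) < d := by exact_mod_cast hd0
  have hr : 0 < radius A := by unfold radius; positivity
  have hinit' : ‖A.θ₀ - θstar‖ ≤ 1 / 2 := hinit.trans (by linarith)
  have hθ0 : ‖A.θ₀‖ ≤ 2 := by
    have h1 : ‖θstar‖ ≤ 1 := (norm_le_sum_abs θstar).trans h.l1_le
    have h2 := norm_add_le (A.θ₀ - θstar) θstar
    rw [sub_add_cancel] at h2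
    linarith
  obtain ⟨hW, hlogT⟩ := log_mul_le_of_le (κ := γ / μ) (L := L) hd hT0 hδ hδ1 hκ hL hT2
  -- A group has at least n/(2T) users, and T ≤ 3(γ/μ) log n.
  set N₀ := (n : ℝ) / (6 * (γ / μ) * L) with hN₀
  have hN₀0 : 0 < N₀ := by positivity
  have hN : ∀ t < A.T, N₀ ≤ (group n A.T t).card := by
    intro t _
    refine le_trans ?_ (div_two_mul_le_card_group (t := t) hT0 hTn')
    rw [hN₀]
    exact div_le_div_of_nonneg_left (by positivity) (by positivity) (by linarith)
  have hlogN : log (2 * d * A.T / δ) ≤ N₀ := by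
    rw [hN₀, le_div_iff₀ (by positivity)]
    refine le_trans ?_ hlogn
    gcongr
    calc log (2 * d * A.T / δ) ≤ log ((n * d / δ) ^ 2) := by
          refine log_le_log (by positivity) ?_
          have h1 : (A.T : ℝ) ≤ n := by exact_mod_cast hTn'
          calc 2 * d * A.T / δ = 2 * (A.T * d / δ) := by ring
            _ ≤ 2 * (n * d / δ) := by gcongr
            _ ≤ n * d / δ * (n * d / δ) := by gcongr
            _ = _ := by ring
      _ = 2 * log (n * d / δ) := by rw [log_pow]; norm_num
  have hclose := messageLaw_forall_close (n := n) (P := P) hd0 hT0 (aε ▸ hε) hr hτ₁0.le hτ₂0.le h0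
    hθ0 hδ hδ1 hN₀0 hN hlogN
  rw [outputLaw, Measure.map_apply (measurable_output A)
    (measurableSet_le (by fun_prop) measurable_const)]
  refine hclose.trans (measure_mono fun z hz => ?_)
  have hB := outputScale_le hd0 (aε ▸ hε : 0 < A.ε) hr
  set ξ := 4 * outputScale d A.ε (radius A) / √d * √(log (2 * d * A.T / δ) / N₀) with hξ
  have hξ0 : 0 ≤ ξ := by
    have := outputScale_pos hd0 (aε ▸ hε : 0 < A.ε) hr
    positivity
  have hnoise : ξ ≤ 61440 * (γ / μ) * (σ : ℝ) ^ 2 * √A.k' *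
      (√d * L ^ 2 * √(log (d / δ)) / (√n * min ε 1)) := by
    refine noise_le (r := radius A) hε hκ hL (by linarith) hd0 hk'0 (by linarith) ?_ hσ'
      (aε ▸ hB) hlogT
    rw [radius, aτ₁, aτ₂]
  have hfinal := h.norm_iterate_sub_le hσ hμ hγ.2 hμM.2 hμγ hk'0 hk'1 aη hL aτ₁ aτ₂ h0 hinit' hξ0 hz
  refine hfinal.trans (le_trans ?_ (rate_le hε hκ hγ0 hL hn' (by omega) hk hk'2 hW hLdef hnoise))
  gcongr
  -- The value c₁ = 2 compensates the contraction rate μ/(2γ), so the initial error decays to 1/n.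
  have h1 : L ≤ 1 / 2 * (μ / γ) * A.T := by
    calc L = 1 / 2 * (μ / γ) * (2 * (γ / μ) * L) := by field_simp
      _ ≤ _ := by gcongr
  calc exp (-(1 / 2 * (μ / γ) * A.T)) ≤ exp (-L) := exp_le_exp.2 (by linarith)
    _ = 1 / n := by rw [exp_neg, hLdef, exp_log (by linarith), one_div]

end LDPIHT


/-! ### The main theorem -/

theorem mainTheorem7 :
    -- privacy, for all inputs
    (∀ (d n : ℕ) (A : LDPIHT.Params d), 0 < d → 1 ≤ A.T → 0 < A.ε → 0 < A.τ₁ → 0 < A.τ₂ →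
      LDPIHT.l0 A.θ₀ ≤ A.k' → ‖A.θ₀‖ ≤ 2 →
        LDPIHT.IsSeqLDP A.ε (LDPIHT.protocol n A) ∧
        -- the randomizer is only used on its domain
        ∀ (i : Fin n) (q : (LDPIHT.Vec d × ℝ) × (Fin i → LDPIHT.Vec d)),
          ‖LDPIHT.sentGradient n A i q‖ ≤ LDPIHT.radius A) ∧
    -- accuracy
    (∃ c₁ > (0 : ℝ), ∃ c₂ > (0 : ℝ), ∃ a : ℕ, ∀ (σ : ℝ≥0) (γ μ : ℝ), 0 < μ →
      ∃ C₀ > (0 : ℝ), ∃ C > (0 : ℝ),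
        ∀ (d n k : ℕ) (ε δ : ℝ) (P : Measure (LDPIHT.Vec d × ℝ)) [IsProbabilityMeasure P]
          (θstar θ₀ : LDPIHT.Vec d) (A : LDPIHT.Params d),
          2 ≤ d → 1 ≤ n → 1 ≤ k → 0 < ε → 0 < δ → δ < 1 →
          LDPIHT.IsSparseModel P θstar k σ →
          IsGreatest (spectrum ℝ (LDPIHT.secondMoment P)) γ →
          IsLeast (spectrum ℝ (LDPIHT.secondMoment P)) μ →
          A = LDPIHT.tunedParams c₁ c₂ σ γ μ n k ε θ₀ →
          LDPIHT.l0 θ₀ ≤ A.k' →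
          ‖θ₀ - θstar‖ ≤ 1 / 2 * (μ / γ) →
          C₀ * ((A.k' : ℝ) ^ 2 * d / min ε 1 ^ 2) * log (n * d / δ) ^ a ≤ n →
          ENNReal.ofReal (1 - δ) ≤ LDPIHT.outputLaw n A P
            {θ | ‖θ - θstar‖ ≤
              C * (√d * k * log n ^ 2 * √(log (d / δ)) / (√n * min ε 1))}) := by
  refine ⟨fun d n A hd _ hε hτ₁ hτ₂ h0 h2 => ⟨LDPIHT.isSeqLDP_protocol hd n A hε, fun i q =>
    LDPIHT.norm_sentGradient_le n A hτ₁.le hτ₂.le h0 h2 i q⟩, 2, two_pos, 2, two_pos, 2, ?_⟩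
  intro σ γ μ hμ
  -- The constants are fixed before `P`. If μ > γ, no law can have these extreme eigenvalues and
  -- arbitrary constants serve.
  by_cases hμγ : μ ≤ γ
  · have hγ : 0 < γ := hμ.trans_le hμγ
    refine ⟨12 * (γ / μ), by positivity,
      2 + 8 / (3 * γ) * 146 * 61512 * (γ / μ) ^ 4 * σ ^ 2, by positivity, ?_⟩
    intro d n k ε δ P _ θstar θ₀ A hd hn hk hε hδ hδ1 h hγM hμM hA h0 hinit hsize
    exact LDPIHT.outputLaw_accuracy hμ hμγ hd hn hk hε hδ hδ1 h hγM hμM hA h0 hinit hsize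
  · refine ⟨1, one_pos, 1, one_pos, ?_⟩
    intro d n k ε δ P _ θstar θ₀ A _ _ _ _ _ _ _ hγM hμM
    exact absurd (hγM.2 hμM.1) hμγ
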